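/- **Setting.** Let $\Gamma$ be a connected oriented multigraph (loops and multiple edges allowed) with vertex set $V$ and edge set $E$, whose degrees are bounded. Let $E_v^-$ (resp. $E_v^+$) be the set of edges starting (resp. ending) at $v$, $E_v=E_v^-\cup E_v^+$, and let $S_v$ be a copy of the Riemann sphere $\mathbb C\cup\{\infty\}$ for each $v\in V$. The parameters are points $p=(p_e^\pm)_{e\in E}$ of $\mathbb C$ (for $e$ from $v$ to $v'$, $p_e^-\in S_v$ and $p_e^+\in S_{v'}$), numbers $t=(t_e)_{e\in E}\in\mathbb C^E$, and vectors $\xi=(\xi_e^\pm)_{e\in E}$ in finite-dimensional normed complex vector spaces of uniformly bounded dimension. Let $z_e^\pm(z)=\zeta_e^\pm(z-p_e^\pm,\xi_e^\pm)$, where $\zeta_e^\pm$ is holomorphic in all its variables on an open set. Let $\underline p,\underline\xi$ be central values, and assume that the coordinates are admissible for all $(p,\xi)$ in an $\ell^\infty$-neighbourhood of $(\underline p,\underline\xi)$, with fixed constants $\rho,c_1,c_2>0$: $z_e^\pm$ is biholomorphic from a domain $D_e^\pm\ni p_e^\pm$ onto the disk $D(0,\rho)$, $z_e^\pm(p_e^\pm)=0$,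 for every $v$ the domains $D_e^-$ $(e\in E_v^-)$ and $D_e^+$ $(e\in E_v^+)$ are disjoint, and $c_1|z_e^\pm(z)|\le|z-p_e^\pm|\le c_2|z_e^\pm(z)|$ on $D_e^\pm$. For $|t_e|<\rho^2$, $\Sigma_{p,t,\xi}$ is the Riemann surface with nodes obtained from the disjoint union of the $S_v$ as follows: if $t_e\ne0$, remove $|z_e^\pm|\le|t_e|/\rho$ and identify $z\in D_e^-$ with $z'\in D_e^+$ whenever $z_e^-(z)z_e^+(z')=t_e$; if $t_e=0$, identify $p_e^-$ with $p_e^+$ to form a node. A regular differential is a $1$-form holomorphic away from the nodes, with at most simple poles with opposite residues on the two sides of each node. Let $\gamma_e$ be the homology class of $\partial D_e^+$. Fix $0<\epsilon\le\rho c_1$, let $\Omega_{v,\epsilon}$ be $S_v$ minus the closed disks of radius $\epsilon$ centred at $\underline p_e^-$ $(e\in E_v^-)$ and $\underline p_e^+$ $(e\in E_v^+)$, and let $\Omega_\epsilon$ be the disjoint union of the $\Omega_{v,\epsilon}$. Let $\ell^\infty_c(E)$ be the space of bounded $\alpha\in\mathbb C^E$ with $\sum_{e\in E_v^-}\alpha_e=\sum_{e\in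 E_v^+}\alpha_e$ for all $v$, with the sup norm. Denote by $\omega(p,t,\xi,\alpha)$ the regular differential $\omega$ on $\Sigma_{p,t,\xi}$ such that $\sup_v\sup_{\Omega_{v,\epsilon}}|\omega/dz|<\infty$ and $\int_{\gamma_e}\omega=\alpha_e$ for all $e\in E$. Let $\mathcal B_E\subset\mathbb C^E$ and $\mathcal B_V\subset\mathbb C^V$ be subspaces with admissible norms: they are Banach spaces; the norms are monotonic (if $u$ is in the space and $|w_i|\le|u_i|$ for all $i$, then $w$ is in the space and $\|w\|\le\|u\|$); the operators $\alpha\mapsto(\sum_{e\in E_v}|\alpha_e|)_{v}$ from $\mathcal B_E$ to $\mathcal B_V$ and $u\mapsto(|u_v|+|u_{v'}|)_{e=vv'}$ from $\mathcal B_V$ to $\mathcal B_E$ are bounded; and the space of double sequences $(\lambda_{e,n})_{e\in E,n\in\mathbb N}$ with $(\sup_n|\lambda_{e,n}|)_e\in\mathcal B_E$, normed by $\|(\sup_n|\lambda_{e,n}|)_e\|_E$, is a Banach space. Perturbations $\dot p$, $\dot t$, $\dot\xi$ are measured by $\|\dot p\|_E=\|(\max|\dot p_e^\pm|)_e\|_E$,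 $\|\dot t\|_E$ and $\|\dot\xi\|_E=\|(\max\|\dot\xi_e^\pm\|)_e\|_E$. Let $\mathcal H^1(\Omega_\epsilon)$ be the space of holomorphic differentials $w$ on $\Omega_\epsilon$ with $(\sup_{\Omega_{v,\epsilon}}|w/dz|)_v\in\mathcal B_V$, with the corresponding norm. **Theorem.** Assume that $\mathcal B_E\hookrightarrow\ell^\infty(E)$ continuously. (1) If $\|\underline t\|_\infty$ is small enough, there is $\delta>0$ such that for $\|\dot p\|_E,\|\dot t\|_E,\|\dot\xi\|_E<\delta$ and $\alpha\in\ell^\infty_c(E)$ the differential $\omega(\underline p+\dot p,\underline t+\dot t,\underline\xi+\dot\xi,\alpha)$ exists and is unique, the restriction of $$\omega(\underline p+\dot p,\underline t+\dot t,\underline\xi+\dot\xi,\alpha)-\omega(\underline p,\underline t,\underline\xi,\alpha)$$ to $\Omega_\epsilon$ belongs to $\mathcal H^1(\Omega_\epsilon)$, and it is a smooth function (of class $C^\infty$ over $\mathbb C$) of $(\dot p,\dot t,\dot\xi,\alpha)$, for the norms $\|\cdot\|_E$ on $\dot p,\dot t,\dot\xi$, the $\ell^\infty$ norm on $\alpha$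 and the norm of $\mathcal H^1(\Omega_\epsilon)$ on the target. (2) Let $r>1$ and $v_0\in V$, and let $d$ be the graph distance. If $\|\underline t\|_\infty$ is small enough, then for every edge $e$ there is $\delta>0$ such that, whenever $(p,t,\xi)$ coincides with $(\underline p,\underline t,\underline\xi)$ except at the edge $e$, where $p_e^\pm,t_e,\xi_e^\pm$ differ from the central values by less than $\delta$, and $\alpha\in\ell^\infty_c(E)$, the differential $\omega(p,t,\xi,\alpha)$ exists and is unique, and there is $C$ with $$\sup_{\Omega_{v,\epsilon}}\left|\frac{\omega(p,t,\xi,\alpha)-\omega(\underline p,\underline t,\underline\xi,\alpha)}{dz}\right|\le C\,r^{-d(v,v_0)}\qquad\text{for all }v\in V.$$ -/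

import Mathlib

open scoped Topology BoundedContinuousFunction

noncomputable section

namespace Traizet

/-! ### Norms on spaces of sequences -/

/-- A monotonic norm on a linear space `space` of families of complex numbers indexed by `ι`.
As is customary, the norm of a family is called "defined" if the family lies in `space`, so
monotonicity says in particular that a family dominated by a member of `space` is in `space`.
Only the values of `norm` on `space` are meaningful. -/
structure MonotoneNorm (ι : Type*) where
  space : Submodule ℂ (ι → ℂ)
  norm : (ι → ℂ) → ℝ
  norm_add_le : ∀ u ∈ space, ∀ w ∈ space, norm (u + w) ≤ norm u + norm w
  norm_smul : ∀ (a : ℂ), ∀ u ∈ space, norm (a • u) = ‖a‖ * norm u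
  eq_zero_of_norm : ∀ u ∈ space, norm u = 0 → u = 0
  mono : ∀ u ∈ space, ∀ w : ι → ℂ, (∀ i, ‖w i‖ ≤ ‖u i‖) → w ∈ space ∧ norm w ≤ norm u

namespace MonotoneNorm

variable {ι : Type*} (N : MonotoneNorm ι)

theorem norm_zero : N.norm 0 = 0 := by
  have h := N.norm_smul 0 0 N.space.zero_mem
  simpa using h

theorem norm_nonneg {u : ι → ℂ} (hu : u ∈ N.space) : 0 ≤ N.norm u := by
  have h := (N.mono u hu 0 (fun i => by simp)).2
  rwa [N.norm_zero] at h

variable (Y : ι → Type*) [∀ i, NormedAddCommGroup (Y i)] [∀ i, NormedSpace ℂ (Y i)]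

/-- Families `y` of vectors `y i ∈ Y i` such that the norm of `(‖y i‖)_i` is defined. -/
def famSubmodule : Submodule ℂ (∀ i, Y i) where
  carrier := {y | (fun i => ((‖y i‖ : ℝ) : ℂ)) ∈ N.space}
  zero_mem' := by
    have : (fun i => ((‖(0 : ∀ i, Y i) i‖ : ℝ) : ℂ)) = 0 := by ext i; simp
    simp only [Set.mem_ofPred_eq, this]
    exact N.space.zero_mem
  add_mem' := by
    intro a b ha hb
    refine (N.mono _ (N.space.add_mem ha hb) _ (fun i => ?_)).1
    have h1 : ‖a i + b i‖ ≤ ‖a i‖ + ‖b i‖ := _root_.norm_add_le _ _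
    have h2 : (((‖a i‖ : ℝ) : ℂ) + ((‖b i‖ : ℝ) : ℂ)) = ((‖a i‖ + ‖b i‖ : ℝ) : ℂ) := by
      push_cast; rfl
    simp only [Pi.add_apply, h2, Complex.norm_real, Real.norm_eq_abs]
    rw [abs_of_nonneg (by positivity), abs_of_nonneg (by positivity)]
    exact h1
  smul_mem' := by
    intro c a ha
    refine (N.mono _ (N.space.smul_mem c ha) _ (fun i => ?_)).1
    simp [_root_.norm_smul]

/-- The space of families `y` of vectors `y i ∈ Y i` such that the norm of `(‖y i‖)_i` is
defined, with that norm. For `Y i = ℂ` it is `N.space` itself. -/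
def Fam : Type _ := ↥(N.famSubmodule Y)

instance : AddCommGroup (N.Fam Y) := inferInstanceAs (AddCommGroup ↥(N.famSubmodule Y))

instance : Module ℂ (N.Fam Y) := inferInstanceAs (Module ℂ ↥(N.famSubmodule Y))

instance : CoeFun (N.Fam Y) (fun _ => ∀ i, Y i) := ⟨fun y => y.1⟩

instance : Norm (N.Fam Y) := ⟨fun y => N.norm (fun i => ((‖y i‖ : ℝ) : ℂ))⟩

theorem fam_core : NormedSpace.Core ℂ (N.Fam Y) where
  norm_nonneg y := N.norm_nonneg y.2
  norm_smul c y := by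
    have h : (fun i => ((‖(c • y : N.Fam Y) i‖ : ℝ) : ℂ))
        = ((‖c‖ : ℝ) : ℂ) • (fun i => ((‖y i‖ : ℝ) : ℂ)) := by
      ext i
      have : (c • y : N.Fam Y) i = c • y i := rfl
      simp [this, _root_.norm_smul]
    change N.norm _ = ‖c‖ * N.norm _
    rw [h, N.norm_smul _ _ y.2]
    simp
  norm_triangle x y := by
    change N.norm _ ≤ N.norm _ + N.norm _
    refine le_trans (N.mono _ (N.space.add_mem x.2 y.2) _ (fun i => ?_)).2
      (N.norm_add_le _ x.2 _ y.2)
    have h0 : (x + y : N.Fam Y) i = x i + y i := rfl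
    have h1 : ‖x i + y i‖ ≤ ‖x i‖ + ‖y i‖ := _root_.norm_add_le _ _
    have h2 : (((‖x i‖ : ℝ) : ℂ) + ((‖y i‖ : ℝ) : ℂ)) = ((‖x i‖ + ‖y i‖ : ℝ) : ℂ) := by
      push_cast; rfl
    simp only [Pi.add_apply, h0]
    rw [h2, Complex.norm_real, Complex.norm_real, Real.norm_eq_abs, Real.norm_eq_abs,
      abs_of_nonneg (by positivity), abs_of_nonneg (by positivity)]
    exact h1
  norm_eq_zero_iff y := by
    constructor
    · intro h
      have h' := N.eq_zero_of_norm _ y.2 h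
      apply Subtype.ext
      funext i
      have h2 := congrFun h' i
      have h3 : y i = 0 := by simpa using h2
      exact h3
    · rintro rfl
      change N.norm _ = 0
      have : (fun i => ((‖(0 : N.Fam Y) i‖ : ℝ) : ℂ)) = 0 := by
        ext i
        have : (0 : N.Fam Y) i = 0 := rfl
        simp [this]
      rw [this, N.norm_zero]

instance : NormedAddCommGroup (N.Fam Y) := NormedAddCommGroup.ofCore (N.fam_core Y)

instance : NormedSpace ℂ (N.Fam Y) := NormedSpace.ofCore (N.fam_core Y)

end MonotoneNorm

/-! ### Graphs -/

/-- A connected oriented multigraph (multiple edges and loops are allowed) all of whose vertices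
have finite degree. -/
structure Graph (V E : Type*) where
  /-- the starting point of an edge -/
  src : E → V
  /-- the endpoint of an edge -/
  tgt : E → V
  connected : (SimpleGraph.fromRel (fun v w => ∃ e, src e = v ∧ tgt e = w)).Connected
  finite_edges : ∀ v, {e | src e = v ∨ tgt e = v}.Finite

namespace Graph

variable {V E : Type*} (G : Graph V E)

/-- The two ends of an edge: `false` (the sign `-`) is the starting point, `true` (the sign `+`)
is the endpoint. -/
def endpt (e : E) : Bool → V
  | false => G.src e
  | true => G.tgt e

/-- The set of edges adjacent to a vertex. -/
def edgesAt (v : V) : Set E := {e | G.src e = v ∨ G.tgt e = v}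

/-- The graphical distance. -/
def dist (v w : V) : ℕ :=
  (SimpleGraph.fromRel (fun v w => ∃ e, G.src e = v ∧ G.tgt e = w)).dist v w

/-- The bounded families `α` with `∑_{e starts at v} α_e = ∑_{e ends at v} α_e` for every `v`,
with the supremum norm. -/
def compatible : Submodule ℂ (lp (fun _ : E => ℂ) (⊤ : ENNReal)) where
  carrier := {α | ∀ v, ∑ᶠ e ∈ {e | G.src e = v}, α e = ∑ᶠ e ∈ {e | G.tgt e = v}, α e}
  zero_mem' := by intro v; simp
  add_mem' := by
    intro a b ha hb v
    have h1 : {e | G.src e = v}.Finite := (G.finite_edges v).subset fun e he => Or.inl he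
    have h2 : {e | G.tgt e = v}.Finite := (G.finite_edges v).subset fun e he => Or.inr he
    simp only [lp.coeFn_add, Pi.add_apply]
    rw [finsum_mem_add_distrib h1, finsum_mem_add_distrib h2, ha v, hb v]
  smul_mem' := by
    intro c a ha v
    have h1 : {e | G.src e = v}.Finite := (G.finite_edges v).subset fun e he => Or.inl he
    have h2 : {e | G.tgt e = v}.Finite := (G.finite_edges v).subset fun e he => Or.inr he
    simp only [lp.coeFn_smul, Pi.smul_apply]
    rw [← smul_finsum_mem h1, ← smul_finsum_mem h2, ha v]

/-- Admissible norms: both spaces are Banach spaces, the norms are monotonic (this is part of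
`MonotoneNorm`), the two incidence operators are bounded, and the space of double sequences with
the mixed norm is a Banach space. -/
structure AdmissibleNorms (NE : MonotoneNorm E) (NV : MonotoneNorm V) : Prop where
  complete_edges : CompleteSpace (NE.Fam (fun _ => ℂ))
  complete_vertices : CompleteSpace (NV.Fam (fun _ => ℂ))
  edges_to_vertices : ∃ K : ℝ, ∀ α ∈ NE.space,
    (fun v => ((∑ᶠ e ∈ G.edgesAt v, ‖α e‖ : ℝ) : ℂ)) ∈ NV.space ∧
      NV.norm (fun v => ((∑ᶠ e ∈ G.edgesAt v, ‖α e‖ : ℝ) : ℂ)) ≤ K * NE.norm α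
  vertices_to_edges : ∃ K : ℝ, ∀ u ∈ NV.space,
    (fun e => ((‖u (G.src e)‖ + ‖u (G.tgt e)‖ : ℝ) : ℂ)) ∈ NE.space ∧
      NE.norm (fun e => ((‖u (G.src e)‖ + ‖u (G.tgt e)‖ : ℝ) : ℂ)) ≤ K * NV.norm u
  complete_double : CompleteSpace (NE.Fam (fun _ => lp (fun _ : ℕ => ℂ) (⊤ : ENNReal)))

end Graph

/-! ### Coordinates used to open the nodes -/

/-- Functions `ζ_e^±(z, ξ)`, holomorphic in all variables on open sets, where the parameter `ξ`
is a vector in `X e s` (`s = false` for the sign `-` and `s = true` for the sign `+`). -/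
structure CoordinateFamily (E : Type*) (X : E → Bool → Type*)
    [∀ e s, NormedAddCommGroup (X e s)] [∀ e s, NormedSpace ℂ (X e s)] where
  dom : ∀ e s, Set (ℂ × X e s)
  zeta : ∀ e s, ℂ × X e s → ℂ
  isOpen_dom : ∀ e s, IsOpen (dom e s)
  differentiableOn : ∀ e s, DifferentiableOn ℂ (zeta e s) (dom e s)

section Surface

variable {V E : Type*} {X : E → Bool → Type*}
  [∀ e s, NormedAddCommGroup (X e s)] [∀ e s, NormedSpace ℂ (X e s)]

namespace CoordinateFamily

variable (Z : CoordinateFamily E X)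

/-- The topological disk `D_e^±` around `p_e^±`. -/
def disk (p : E → Bool → ℂ) (ξ : ∀ e s, X e s) (e : E) (s : Bool) : Set ℂ :=
  {z | (z - p e s, ξ e s) ∈ Z.dom e s}

/-- The coordinate `z_e^±(z) = ζ_e^±(z - p_e^±, ξ_e^±)`. -/
def coord (p : E → Bool → ℂ) (ξ : ∀ e s, X e s) (e : E) (s : Bool) (z : ℂ) : ℂ :=
  Z.zeta e s (z - p e s, ξ e s)

/-- The part `|z_e^±| ≤ |t_e| / ρ` of `D_e^±` that is removed when the node is opened; it is
the single point `p_e^±` if `t_e = 0`. -/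
def core (ρ : ℝ) (p : E → Bool → ℂ) (t : E → ℂ) (ξ : ∀ e s, X e s) (e : E) (s : Bool) : Set ℂ :=
  {z ∈ Z.disk p ξ e s | ‖Z.coord p ξ e s z‖ ≤ ‖t e‖ / ρ}

end CoordinateFamily

/-- Admissibility of the coordinates `z_e^±`, with constants `ρ`, `c₁`, `c₂`. -/
structure AdmissibleCoordinates (G : Graph V E) (Z : CoordinateFamily E X) (ρ c₁ c₂ : ℝ)
    (p : E → Bool → ℂ) (ξ : ∀ e s, X e s) : Prop where
  bijOn : ∀ e s, Set.BijOn (Z.coord p ξ e s) (Z.disk p ξ e s) (Metric.ball 0 ρ)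
  center_mem : ∀ e s, p e s ∈ Z.disk p ξ e s
  coord_center : ∀ e s, Z.coord p ξ e s (p e s) = 0
  disjoint : ∀ e s e' s', G.endpt e s = G.endpt e' s' → (e, s) ≠ (e', s') →
    Disjoint (Z.disk p ξ e s) (Z.disk p ξ e' s')
  bounds : ∀ e s, ∀ z ∈ Z.disk p ξ e s,
    c₁ * ‖Z.coord p ξ e s z‖ ≤ ‖z - p e s‖ ∧ ‖z - p e s‖ ≤ c₂ * ‖Z.coord p ξ e s z‖

/-! ### Differentials

A differential on a piece of the Riemann sphere `S_v` is written `f dz`. -/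

/-- The differential `f(z) dz` is holomorphic at `∞`: in the coordinate `w = 1 / z` it is
`- f(1 / w) / w ^ 2 dw`. -/
def HolomorphicAtInfty (f : ℂ → ℂ) : Prop :=
  ∃ g : ℂ → ℂ, AnalyticAt ℂ g 0 ∧ ∀ᶠ w in 𝓝[≠] (0 : ℂ), g w = -f w⁻¹ / w ^ 2

/-- The finite part of the sphere `S_v` without the parts removed when opening the nodes. -/
def sphereDomain (G : Graph V E) (Z : CoordinateFamily E X) (ρ : ℝ)
    (p : E → Bool → ℂ) (t : E → ℂ) (ξ : ∀ e s, X e s) (v : V) : Set ℂ :=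
  {z | ∀ e s, G.endpt e s = v → z ∉ Z.core ρ p t ξ e s}

/-- `f` is (the family of the quotients `ω / dz` on the spheres `S_v` of) a regular differential
`ω` on the surface with nodes defined by the parameters `p`, `t`, `ξ`. -/
structure IsRegularDifferential (G : Graph V E) (Z : CoordinateFamily E X) (ρ : ℝ)
    (p : E → Bool → ℂ) (t : E → ℂ) (ξ : ∀ e s, X e s) (f : V → ℂ → ℂ) : Prop where
  holomorphic : ∀ v, DifferentiableOn ℂ (f v) (sphereDomain G Z ρ p t ξ v)
  holomorphic_infty : ∀ v, HolomorphicAtInfty (f v)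
  /-- values off the domain are normalised, so that a differential is determined by `f` only -/
  eq_zero_off : ∀ v, ∀ z ∉ sphereDomain G Z ρ p t ξ v, f v z = 0
  /-- On the necks, `f_v(z) dz = f_{v'}(z') dz'` whenever `z` and `z'` are identified, that is,
  `z_e^-(z) z_e^+(z') = t_e`, so that
  `dz' / dz = - (z_e^-)'(z) z_e^+(z') / (z_e^-(z) (z_e^+)'(z'))`. -/
  neck : ∀ e, t e ≠ 0 → ∀ z ∈ Z.disk p ξ e false, ∀ z' ∈ Z.disk p ξ e true,
    Z.coord p ξ e false z * Z.coord p ξ e true z' = t e →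
      f (G.src e) z = f (G.tgt e) z' *
        -(deriv (Z.coord p ξ e false) z * Z.coord p ξ e true z' /
          (Z.coord p ξ e false z * deriv (Z.coord p ξ e true) z'))
  /-- At the nodes there are (at most) simple poles with opposite residues. -/
  node : ∀ e, t e = 0 → ∃ (a : ℂ) (gm gp : ℂ → ℂ),
    AnalyticAt ℂ gm (p e false) ∧ AnalyticAt ℂ gp (p e true) ∧
    (∀ᶠ z in 𝓝[≠] (p e false), f (G.src e) z = -a / (z - p e false) + gm z) ∧
    (∀ᶠ z in 𝓝[≠] (p e true), f (G.tgt e) z = a / (z - p e true) + gp z)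

/-- The integral of `f` over the cycle `γ_e` (the homology class of the boundary of `D_e^+`)
is `a`; the cycle is represented by a round circle inside `D_e^+` around the removed part. -/
def HasPeriod (G : Graph V E) (Z : CoordinateFamily E X) (ρ : ℝ)
    (p : E → Bool → ℂ) (t : E → ℂ) (ξ : ∀ e s, X e s) (f : V → ℂ → ℂ) (e : E) (a : ℂ) : Prop :=
  ∃ r > 0, Metric.closedBall (p e true) r ⊆ Z.disk p ξ e true ∧
    Z.core ρ p t ξ e true ⊆ Metric.ball (p e true) r ∧
    (∮ z in C(p e true, r), f (G.tgt e) z) = a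

/-- The finite part of `Ω_{v,ε}`, the sphere `S_v` minus the closed disks of radius `ε` centred
at the points `p₀_e^±`. -/
def Omega (G : Graph V E) (p₀ : E → Bool → ℂ) (ε : ℝ) (v : V) : Set ℂ :=
  {z | ∀ e s, G.endpt e s = v → ε < ‖z - p₀ e s‖}

/-- `f` is a regular differential that is bounded on the domains `Ω_{v,ε}`, uniformly in `v`, and
has period `α_e` on `γ_e` for every edge `e`. -/
structure HasPeriods (G : Graph V E) (Z : CoordinateFamily E X) (ρ : ℝ)
    (p₀ : E → Bool → ℂ) (ε : ℝ)
    (p : E → Bool → ℂ) (t : E → ℂ) (ξ : ∀ e s, X e s) (α : E → ℂ) (f : V → ℂ → ℂ) : Prop where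
  regular : IsRegularDifferential G Z ρ p t ξ f
  bounded : ∃ M : ℝ, ∀ v, ∀ z ∈ Omega G p₀ ε v, ‖f v z‖ ≤ M
  periods : ∀ e, HasPeriod G Z ρ p t ξ f e (α e)

theorem HolomorphicAtInfty.add {f g : ℂ → ℂ} (hf : HolomorphicAtInfty f)
    (hg : HolomorphicAtInfty g) : HolomorphicAtInfty (f + g) := by
  obtain ⟨F, hF, hF'⟩ := hf
  obtain ⟨H, hH, hH'⟩ := hg
  refine ⟨F + H, hF.add hH, ?_⟩
  filter_upwards [hF', hH'] with w h1 h2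
  simp only [Pi.add_apply, h1, h2]
  ring

theorem HolomorphicAtInfty.smul {f : ℂ → ℂ} (c : ℂ) (hf : HolomorphicAtInfty f) :
    HolomorphicAtInfty (c • f) := by
  obtain ⟨F, hF, hF'⟩ := hf
  refine ⟨c • F, analyticAt_const.smul hF, ?_⟩
  filter_upwards [hF'] with w h1
  simp only [Pi.smul_apply, h1, smul_eq_mul]
  ring

/-- The bounded holomorphic differentials on `U ∪ {∞}`, written `g dz` with `g` a function on `U`,
with the supremum norm of `g`. -/
def boundedForms (U : Set ℂ) : Submodule ℂ (U →ᵇ ℂ) where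
  carrier := {g | ∃ f : ℂ → ℂ, DifferentiableOn ℂ f U ∧ HolomorphicAtInfty f ∧ ∀ z : U, g z = f z}
  zero_mem' := ⟨0, differentiableOn_const 0, ⟨0, analyticAt_const, by simp⟩, by simp⟩
  add_mem' := by
    rintro a b ⟨f, h1, h2, h3⟩ ⟨g, k1, k2, k3⟩
    exact ⟨f + g, h1.add k1, h2.add k2, fun z => by simp [h3, k3]⟩
  smul_mem' := by
    rintro c a ⟨f, h1, h2, h3⟩
    exact ⟨c • f, h1.const_smul c, h2.smul c, fun z => by simp [h3]⟩

/-- The space of holomorphic differentials `w` on `Ω_ε` (the disjoint union of the `Ω_{v,ε}`)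
such that the `V`-norm of `(sup_{Ω_{v,ε}} |w / dz|)_v` is defined, with that norm. -/
abbrev HolForms (G : Graph V E) (NV : MonotoneNorm V) (p₀ : E → Bool → ℂ) (ε : ℝ) : Type _ :=
  NV.Fam (fun v => ↥(boundedForms (Omega G p₀ ε v)))

end Surface

/-! ### Parameter spaces -/

/-- Perturbations of the points, normed by `‖(max (|p_e^+|, |p_e^-|))_e‖_E`. -/
abbrev PointSpace {E : Type*} (NE : MonotoneNorm E) : Type _ := NE.Fam (fun _ => Bool → ℂ)

/-- Perturbations of the parameter `t`, normed by `‖t‖_E`. -/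
abbrev NeckSpace {E : Type*} (NE : MonotoneNorm E) : Type _ := NE.Fam (fun _ => ℂ)

/-- Perturbations of the parameter `ξ`, normed by `‖(max (‖ξ_e^+‖, ‖ξ_e^-‖))_e‖_E`. -/
abbrev CoordSpace {E : Type*} (NE : MonotoneNorm E) (X : E → Bool → Type*)
    [∀ e s, NormedAddCommGroup (X e s)] [∀ e s, NormedSpace ℂ (X e s)] : Type _ :=
  NE.Fam (fun e => ∀ s, X e s)

end Traizet

end

noncomputable section

namespace Traizet

open Metric Set Filter Complex

/-! ### Cauchy integrals on circles -/

/-! The differential is encoded by its singular parts on small fixed circles, which turns the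
problem into a linear fixed-point equation whose operator is of size `O(‖t‖)`.

On a neck, in the coordinate `ζ = z_e^±`, a regular differential has the Laurent form `(Q(ζ) + β/ζ -
(t/ζ²) Q'(t/ζ)) dζ` (`neckForm`), where `Q` and `Q'` are holomorphic in the disk of radius `ρ` and
belong to the two ends; at the other end `Q`, `Q'` are exchanged and `β` changes sign. The period
fixes `β`. The layer `ψ_e` is the part without `Q`, restricted to the circles of radius `ε/4` about
the central points. By the Cauchy formula in the complement of the disks (`exterior_cauchy`), the
differential outside them is the sum of the Cauchy integrals of the layers at that vertex, hence a
decaying regular part depending on `ψ` plus explicit poles depending on `α` (`outerForm`).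
Conversely `Q'` is a Cauchy integral of the differential over the circle of radius `ε/2` at the
opposite end (`innerCoeff`). Together these give the layer equation `ψ = α b + K (T ψ + P α)`
(`isLayerSolution_iff`): `b` and `K` act edge by edge, `K` is of size `O(‖t‖)`, and the traces `T`,
`P` are sums over adjacent edges, bounded for admissible norms. For small `t` the equation is a
contraction.

The equation is equivalent to the geometric problem. A bounded regular differential has layers that
solve it (`exists_layers`), these are bounded (`norm_layer_le`), and the layers determine the
differential (`eq_of_eq_outside`). A bounded solution glues to a regular differential
(`exists_neckForm_outerForm`, `exists_hasPeriods`); compatibility of `α` says that the residues at a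
vertex cancel, so there is no pole at infinity.

For the dependence on parameters, `K_e` and `b_e` are holomorphic functions of the parameters at `e`
alone, with bounds uniform in `e`. Cauchy estimates make the induced superposition operators on
families holomorphic (`exists_superposition`), and holomorphic maps into Banach spaces are smooth.
The layers themselves are only bounded families, because `α` is. The difference `D` from the central
solution satisfies `D = K(y) T D + (Δb α + ΔK (T Ψ + P α))`, and each source term has a factor in
the `E`-normed space and a bounded one; so `D` lies in that space and is smooth by inversion of `1 -
K(y) T` (`exists_smooth_solution`). The polar sums cancel in the difference of the two
differentials.

Exponential decay is the same theorem for weighted supremum norms with weights `r ^ (-d(v, v₀))`: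
weights of neighbours differ by a factor at most `r`, so the incidence operators are bounded, and a
perturbation at a single edge lies in the weighted space. -/

theorem hasDerivAt_integral_mul_inv {ψ c : ℝ → ℂ} (hψ : Continuous ψ) (hc : Continuous c)
    {z₀ : ℂ} {d : ℝ} (hd : 0 < d) (h : ∀ θ, 2 * d ≤ ‖z₀ - c θ‖) :
    DifferentiableAt ℂ (fun z => ∫ θ in (0:ℝ)..(2 * Real.pi), ψ θ * (z - c θ)⁻¹) z₀ := by
  -- The distance `2 * d` at `z₀` leaves a margin `d` on the whole ball, which dominates the
  -- derivative of the integrand uniformly in `z`.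
  have hne : ∀ θ, ∀ z ∈ ball z₀ d, d ≤ ‖z - c θ‖ := by
    intro θ z hz
    have h1 := h θ
    have h2 : ‖z₀ - c θ‖ ≤ ‖z₀ - z‖ + ‖z - c θ‖ := norm_sub_le_norm_sub_add_norm_sub _ _ _
    rw [mem_ball, dist_comm, dist_eq_norm] at hz
    linarith
  have hne0 : ∀ θ, ∀ z ∈ ball z₀ d, z - c θ ≠ 0 := fun θ z hz => by
    have := hne θ z hz
    rw [← norm_pos_iff]; linarith
  have hz₀ : z₀ ∈ ball z₀ d := mem_ball_self hd
  have hcont : ∀ z ∈ ball z₀ d, Continuous fun θ => ψ θ * (z - c θ)⁻¹ := fun z hz =>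
    hψ.mul ((continuous_const.sub hc).inv₀ fun θ => hne0 θ z hz)
  have key := intervalIntegral.hasDerivAt_integral_of_dominated_loc_of_deriv_le
    (μ := MeasureTheory.volume) (a := 0) (b := 2 * Real.pi)
    (F := fun z θ => ψ θ * (z - c θ)⁻¹)
    (F' := fun z θ => ψ θ * (-1 / (z - c θ) ^ 2)) (x₀ := z₀) (s := ball z₀ d)
    (bound := fun θ => ‖ψ θ‖ * (1 / d ^ 2)) (ball_mem_nhds _ hd)
    (by
      filter_upwards [ball_mem_nhds z₀ hd] with z hz
      exact (hcont z hz).aestronglyMeasurable)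
    ((hcont z₀ hz₀).intervalIntegrable _ _)
    (by
      have : Continuous fun θ => ψ θ * (-1 / (z₀ - c θ) ^ 2) :=
        hψ.mul (continuous_const.div ((continuous_const.sub hc).pow 2)
          fun θ => pow_ne_zero 2 (hne0 θ z₀ hz₀))
      exact this.aestronglyMeasurable)
    (by
      refine Filter.Eventually.of_forall fun θ _ z hz => ?_
      rw [norm_mul]
      refine mul_le_mul_of_nonneg_left ?_ (norm_nonneg _)
      rw [norm_div, norm_neg, norm_one, norm_pow]
      have := hne θ z hz
      gcongr)
    ((hψ.norm.mul continuous_const).intervalIntegrable _ _)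
    (by
      refine Filter.Eventually.of_forall fun θ _ z hz => ?_
      have h1 : HasDerivAt (fun z : ℂ => z - c θ) 1 z := (hasDerivAt_id z).sub_const _
      exact (h1.inv (hne0 θ z hz)).const_mul (ψ θ))
  exact key.2.differentiableAt

/-- The Cauchy integral `(2πi)⁻¹ ∮ ψ(w) / (z - w) dw` over the circle of centre `a` and radius `r`,
where `ψ` is given as a function of the angle. -/
def cauchyExt (a : ℂ) (r : ℝ) (ψ : ℝ → ℂ) (z : ℂ) : ℂ :=
  (2 * Real.pi * I)⁻¹ *
    ∫ θ in (0:ℝ)..(2 * Real.pi), (circleMap 0 r θ * I * ψ θ) * (z - circleMap a r θ)⁻¹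

theorem circleIntegral_mul_eq (a : ℂ) (r : ℝ) (f k : ℂ → ℂ) :
    (∮ w in C(a, r), k w * f w) =
      ∫ θ in (0:ℝ)..(2 * Real.pi), (circleMap 0 r θ * I * f (circleMap a r θ)) *
        k (circleMap a r θ) := by
  rw [circleIntegral]
  congr 1
  ext θ
  rw [deriv_circleMap, smul_eq_mul]
  ring

theorem cauchyExt_comp (a : ℂ) (r : ℝ) (f : ℂ → ℂ) (z : ℂ) :
    cauchyExt a r (fun θ => f (circleMap a r θ)) z =
      (2 * Real.pi * I)⁻¹ * ∮ w in C(a, r), (z - w)⁻¹ * f w := by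
  rw [cauchyExt, circleIntegral_mul_eq a r f fun w => (z - w)⁻¹]

theorem norm_circleMap_sub_ge {a z : ℂ} {r : ℝ} (θ : ℝ) :
    abs (‖z - a‖ - abs r) ≤ ‖z - circleMap a r θ‖ := by
  have h : ‖circleMap a r θ - a‖ = |r| := by
    simp [circleMap]
  have h1 : z - circleMap a r θ = (z - a) - (circleMap a r θ - a) := by ring
  rw [h1, ← h]
  exact abs_norm_sub_norm_le _ _

theorem differentiableAt_cauchyExt {a : ℂ} {r : ℝ} {ψ : ℝ → ℂ} (hψ : Continuous ψ) {z : ℂ}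
    (hz : ‖z - a‖ ≠ |r|) : DifferentiableAt ℂ (cauchyExt a r ψ) z := by
  have hpos : 0 < abs (‖z - a‖ - abs r) / 2 := by
    have : 0 < abs (‖z - a‖ - abs r) := abs_pos.2 (sub_ne_zero.2 hz)
    linarith
  refine DifferentiableAt.const_mul (hasDerivAt_integral_mul_inv ?_ (continuous_circleMap a r) hpos
    fun θ => ?_) _
  · exact ((continuous_circleMap 0 r).mul continuous_const).mul hψ
  · have := norm_circleMap_sub_ge (a := a) (z := z) (r := r) θ
    linarith

theorem norm_cauchyExt_le {a : ℂ} {r : ℝ} {ψ : ℝ → ℂ} {z : ℂ} {M d : ℝ} (hr : 0 ≤ r)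
    (hM : ∀ θ, ‖ψ θ‖ ≤ M) (hd : 0 < d) (h : r + d ≤ ‖z - a‖) :
    ‖cauchyExt a r ψ z‖ ≤ r * M / d := by
  have h1 : ‖∫ θ in (0:ℝ)..(2 * Real.pi), (circleMap 0 r θ * I * ψ θ) * (z - circleMap a r θ)⁻¹‖
      ≤ (r * M * d⁻¹) * |2 * Real.pi - 0| := by
    refine intervalIntegral.norm_integral_le_of_norm_le_const fun θ _ => ?_
    have h2 := norm_circleMap_sub_ge (a := a) (z := z) (r := r) θ
    have h3 : d ≤ ‖z - circleMap a r θ‖ := by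
      refine le_trans ?_ h2
      rw [abs_of_nonneg hr]
      exact le_trans (by linarith) (le_abs_self _)
    rw [norm_mul, norm_mul, norm_mul, norm_inv, norm_I, mul_one]
    have h4 : ‖circleMap 0 r θ‖ = r := by simp [abs_of_nonneg hr]
    rw [h4]
    have := hM θ
    have hM0 : 0 ≤ M := (norm_nonneg _).trans this
    gcongr
  rw [cauchyExt, norm_mul, norm_inv]
  have h5 : ‖(2 * Real.pi * I : ℂ)‖ = 2 * Real.pi := by
    simp [abs_of_pos Real.pi_pos]
  rw [h5]
  rw [sub_zero, abs_of_pos (by positivity)] at h1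
  calc (2 * Real.pi)⁻¹ * _ ≤ (2 * Real.pi)⁻¹ * ((r * M * d⁻¹) * (2 * Real.pi)) := by gcongr
    _ = r * M / d := by
      have := Real.pi_pos
      field_simp

theorem tendsto_cauchyExt {a : ℂ} {r : ℝ} {ψ : ℝ → ℂ} {M : ℝ} (hr : 0 ≤ r)
    (hM : ∀ θ, ‖ψ θ‖ ≤ M) : Tendsto (cauchyExt a r ψ) (cocompact ℂ) (𝓝 0) := by
  have hT : Tendsto (fun z : ℂ => ‖z - a‖ - r) (cocompact ℂ) atTop := by
    refine tendsto_atTop_add_const_right _ _ ?_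
    have : Tendsto (fun z : ℂ => ‖z‖ - ‖a‖) (cocompact ℂ) atTop :=
      tendsto_atTop_add_const_right _ _ tendsto_norm_cocompact_atTop
    exact tendsto_atTop_mono (fun z => norm_sub_norm_le z a) this
  refine squeeze_zero_norm' (a := fun z => r * M / (‖z - a‖ - r)) ?_ (hT.const_div_atTop _)
  filter_upwards [hT.eventually_gt_atTop 0] with z hz
  exact norm_cauchyExt_le hr hM hz (by linarith)

/-- The Cauchy formula in an annulus. -/
theorem annulus_cauchy {f : ℂ → ℂ} {a z : ℂ} {s₀ s₁ : ℝ} (hs₀ : 0 < s₀)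
    (hf : ∀ w, s₀ ≤ ‖w - a‖ → ‖w - a‖ ≤ s₁ → DifferentiableAt ℂ f w)
    (hz₀ : s₀ < ‖z - a‖) (hz₁ : ‖z - a‖ < s₁) :
    (∮ w in C(a, s₁), (w - z)⁻¹ * f w) - (∮ w in C(a, s₀), (w - z)⁻¹ * f w) =
      2 * Real.pi * I * f z := by
  have hs₁ : 0 < s₁ := by linarith
  -- The divided difference `dslope f z` has no pole at `z`, so its integrals over the two circles
  -- agree; expanding it gives the Cauchy integrals of `f` and a winding number term, `2πi` on the
  -- outer circle and `0` on the inner one.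
  have hd : ∀ w ≠ z, s₀ ≤ ‖w - a‖ → ‖w - a‖ ≤ s₁ → DifferentiableAt ℂ (dslope f z) w :=
    fun w hw h0 h1 => (differentiableAt_dslope_of_ne hw).2 (hf w h0 h1)
  have hc : ContinuousOn (dslope f z) (closedBall a s₁ \ ball a s₀) := by
    intro w hw
    rw [Set.mem_sdiff, mem_closedBall, mem_ball, dist_eq_norm, not_lt] at hw
    rcases eq_or_ne w z with rfl | hwz
    · exact (continuousAt_dslope_same.2 (hf w hw.2 hw.1)).continuousWithinAt
    · exact (hd w hwz hw.2 hw.1).continuousAt.continuousWithinAt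
  have h1 := circleIntegral_eq_of_differentiable_on_annulus_off_countable (c := a) hs₀
    (by linarith) (countable_singleton z) hc (fun w hw => by
      rw [Set.mem_sdiff, Set.mem_sdiff, mem_closedBall, mem_ball, dist_eq_norm, not_le,
        mem_singleton_iff] at hw
      exact hd w hw.2 hw.1.2.le hw.1.1.le)
  have h2 : ∀ s, s₀ ≤ s → s ≤ s₁ → ‖z - a‖ ≠ s → (∮ w in C(a, s), dslope f z w) =
      (∮ w in C(a, s), (w - z)⁻¹ * f w) - (∮ w in C(a, s), (w - z)⁻¹) * f z := by
    intro s hs hs' hzs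
    have hs0 : 0 ≤ s := by linarith
    have hne : ∀ w ∈ sphere a s, w - z ≠ 0 := by
      intro w hw h
      rw [sub_eq_zero] at h
      rw [mem_sphere, dist_eq_norm, h] at hw
      exact hzs hw
    have hinv : ContinuousOn (fun w => (w - z)⁻¹) (sphere a s) :=
      (continuousOn_id.sub continuousOn_const).inv₀ hne
    have hfc : ContinuousOn f (sphere a s) := fun w hw => by
      rw [mem_sphere, dist_eq_norm] at hw
      exact (hf w (by linarith) (by linarith)).continuousAt.continuousWithinAt
    have e1 : (∮ w in C(a, s), (w - z)⁻¹) * f z = ∮ w in C(a, s), (w - z)⁻¹ * f z := by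
      simp_rw [circleIntegral, smul_eq_mul, ← mul_assoc]
      rw [intervalIntegral.integral_mul_const]
    have i1 : CircleIntegrable (fun w => (w - z)⁻¹ * f w) a s :=
      ContinuousOn.circleIntegrable hs0 (hinv.mul hfc)
    have i2 : CircleIntegrable (fun w => (w - z)⁻¹ * f z) a s :=
      ContinuousOn.circleIntegrable hs0 (hinv.mul continuousOn_const)
    rw [e1, ← circleIntegral.integral_sub i1 i2]
    refine circleIntegral.integral_congr hs0 fun w hw => ?_
    have : w ≠ z := sub_ne_zero.1 (hne w hw)
    rw [dslope_of_ne _ this, slope_def_field]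
    field_simp
  rw [h2 s₁ (by linarith) le_rfl (by linarith), h2 s₀ le_rfl (by linarith) (by linarith),
    circleIntegral.integral_sub_inv_of_mem_ball (by rwa [mem_ball, dist_eq_norm])] at h1
  have h3 : (∮ w in C(a, s₀), (w - z)⁻¹) = 0 := by
    refine DiffContOnCl.circleIntegral_eq_zero hs₀.le (DifferentiableOn.diffContOnCl ?_)
    intro w hw
    have hw' := closure_ball_subset_closedBall hw
    rw [mem_closedBall, dist_eq_norm] at hw'
    refine (DifferentiableAt.inv (differentiableAt_id.sub_const z) ?_).differentiableWithinAt
    rintro h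
    rw [sub_eq_zero, id] at h
    rw [h] at hw'
    linarith
  rw [h3] at h1
  linear_combination h1

theorem two_pi_I_ne_zero' : (2 * Real.pi * I : ℂ) ≠ 0 := Complex.two_pi_I_ne_zero

theorem annulus_cauchy_ext {f : ℂ → ℂ} {a z : ℂ} {s₀ s₁ : ℝ} (hs₀ : 0 < s₀)
    (hf : ∀ w, s₀ ≤ ‖w - a‖ → ‖w - a‖ ≤ s₁ → DifferentiableAt ℂ f w)
    (hz₀ : s₀ < ‖z - a‖) (hz₁ : ‖z - a‖ < s₁) :
    f z = cauchyExt a s₀ (fun θ => f (circleMap a s₀ θ)) z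
      - cauchyExt a s₁ (fun θ => f (circleMap a s₁ θ)) z := by
  have h := annulus_cauchy hs₀ hf hz₀ hz₁
  have e : ∀ s, (∮ w in C(a, s), (w - z)⁻¹ * f w) = -∮ w in C(a, s), (z - w)⁻¹ * f w := by
    intro s
    rw [circleIntegral, circleIntegral, ← intervalIntegral.integral_neg]
    congr 1
    ext w
    rw [← neg_sub z (circleMap a s w), inv_neg, smul_eq_mul, smul_eq_mul]
    ring
  rw [e, e] at h
  rw [cauchyExt_comp, cauchyExt_comp]
  have h0 := two_pi_I_ne_zero'
  have h1 : f z = (2 * Real.pi * I)⁻¹ * (2 * Real.pi * I * f z) := by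
    rw [inv_mul_cancel_left₀ h0]
  rw [h1, ← h]
  ring

theorem continuous_comp_circleMap {f : ℂ → ℂ} {a : ℂ} {r : ℝ} (hr : 0 ≤ r)
    (hf : ∀ w, ‖w - a‖ = r → ContinuousAt f w) : Continuous fun θ => f (circleMap a r θ) := by
  rw [continuous_iff_continuousAt]
  intro θ
  exact ContinuousAt.comp (f := circleMap a r)
    (hf _ (by simp [circleMap, abs_of_nonneg hr])) (continuous_circleMap a r).continuousAt

theorem exists_bound_circle {f : ℂ → ℂ} {a : ℂ} {r : ℝ} (hr : 0 ≤ r)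
    (hf : ∀ w, ‖w - a‖ = r → ContinuousAt f w) : ∃ M, ∀ θ, ‖f (circleMap a r θ)‖ ≤ M := by
  have h : ContinuousOn f (sphere a r) := fun w hw =>
    (hf w (by rwa [mem_sphere, dist_eq_norm] at hw)).continuousWithinAt
  obtain ⟨M, hM⟩ := (isCompact_sphere a r).exists_bound_of_continuousOn h
  exact ⟨M, fun θ => hM _ (circleMap_mem_sphere a hr θ)⟩

/-! ### Decompositions of holomorphic functions -/

/-- Laurent splitting. Cauchy integrals `G`, `P` over circles of radii `s₀ < s₁` inside the annulus
give `f = G - P` between the circles only; each half is continued to its full domain by subtracting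
the other half from `f`. -/
theorem exists_split {f : ℂ → ℂ} {a : ℂ} {σ ρ : ℝ} (hσ : 0 ≤ σ) (hσρ : σ < ρ)
    (hf : ∀ w, σ < ‖w - a‖ → ‖w - a‖ < ρ → DifferentiableAt ℂ f w) :
    ∃ Q N : ℂ → ℂ, DifferentiableOn ℂ Q (ball a ρ) ∧
      (∀ z, σ < ‖z - a‖ → DifferentiableAt ℂ N z) ∧
      (∀ z, σ < ‖z - a‖ → ‖z - a‖ < ρ → f z = Q z + N z) ∧
      Tendsto N (cocompact ℂ) (𝓝 0) := by
  obtain ⟨s₀, h0, h0'⟩ := exists_between hσρ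
  obtain ⟨s₁, h1, h1'⟩ := exists_between h0'
  have hs₀ : 0 < s₀ := by linarith
  have hs₁ : 0 < s₁ := by linarith
  have c0 : Continuous fun θ => f (circleMap a s₀ θ) := continuous_comp_circleMap hs₀.le
    fun w hw => (hf w (by linarith) (by linarith)).continuousAt
  have c1 : Continuous fun θ => f (circleMap a s₁ θ) := continuous_comp_circleMap hs₁.le
    fun w hw => (hf w (by linarith) (by linarith)).continuousAt
  set G := cauchyExt a s₀ (fun θ => f (circleMap a s₀ θ)) with hG
  set P := cauchyExt a s₁ (fun θ => f (circleMap a s₁ θ)) with hP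
  have hGd : ∀ z, s₀ < ‖z - a‖ → DifferentiableAt ℂ G z := fun z hz =>
    differentiableAt_cauchyExt c0 (by rw [abs_of_pos hs₀]; exact hz.ne')
  have hPd : ∀ z, ‖z - a‖ < s₁ → DifferentiableAt ℂ P z := fun z hz =>
    differentiableAt_cauchyExt c1 (by rw [abs_of_pos hs₁]; exact hz.ne)
  have hsplit : ∀ z, s₀ < ‖z - a‖ → ‖z - a‖ < s₁ → f z = G z - P z := fun z hz hz' =>
    annulus_cauchy_ext hs₀ (fun w hw hw' => hf w (by linarith) (by linarith)) hz hz'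
  have hcn : Continuous fun z : ℂ => ‖z - a‖ := by fun_prop
  have hlt : ∀ s z, ‖z - a‖ < s → ∀ᶠ w in 𝓝 z, ‖w - a‖ < s := fun s z hz =>
    hcn.continuousAt.eventually_lt continuousAt_const hz
  have hgt : ∀ s z, s < ‖z - a‖ → ∀ᶠ w in 𝓝 z, s < ‖w - a‖ := fun s z hz =>
    continuousAt_const.eventually_lt hcn.continuousAt hz
  refine ⟨fun z => if ‖z - a‖ < s₁ then -P z else f z - G z,
    fun z => if s₀ < ‖z - a‖ then G z else f z + P z, ?_, ?_, ?_, ?_⟩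
  · intro z hz
    rw [mem_ball, dist_eq_norm] at hz
    refine DifferentiableAt.differentiableWithinAt ?_
    rcases lt_or_ge ‖z - a‖ s₁ with h | h
    · refine (hPd z h).neg.congr_of_eventuallyEq ?_
      filter_upwards [hlt _ _ h] with w hw
      simp [hw]
    · refine ((hf z (by linarith) hz).sub (hGd z (by linarith))).congr_of_eventuallyEq ?_
      filter_upwards [hgt s₀ z (by linarith)] with w hw
      split_ifs with hw1
      · simp [hsplit w hw hw1]
      · rfl
  · intro z hz
    rcases lt_or_ge s₀ ‖z - a‖ with h | h
    · refine (hGd z h).congr_of_eventuallyEq ?_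
      filter_upwards [hgt _ _ h] with w hw
      simp [hw]
    · refine ((hf z (by linarith) (by linarith)).add (hPd z (by linarith))).congr_of_eventuallyEq ?_
      filter_upwards [hlt s₁ z (by linarith)] with w hw
      split_ifs with hw1
      · simp [hsplit w hw1 hw]
      · rfl
  · intro z hz hz'
    dsimp only
    split_ifs with h h'
    · rw [hsplit z h' h]; ring
    · ring
    · ring
    · linarith
  · obtain ⟨M, hM⟩ := exists_bound_circle (f := f) (a := a) hs₀.le
      fun w hw => (hf w (by linarith) (by linarith)).continuousAt
    refine (tendsto_cauchyExt (a := a) hs₀.le hM).congr' ?_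
    have hT : Tendsto (fun z : ℂ => ‖z - a‖) (cocompact ℂ) atTop := by
      have : Tendsto (fun z : ℂ => ‖z‖ - ‖a‖) (cocompact ℂ) atTop :=
        tendsto_atTop_add_const_right _ _ tendsto_norm_cocompact_atTop
      exact tendsto_atTop_mono (fun z => norm_sub_norm_le z a) this
    filter_upwards [hT.eventually_gt_atTop s₀] with z hz
    simp [hz, hG]

theorem tendsto_norm_sub_cocompact (a : ℂ) :
    Tendsto (fun z : ℂ => ‖z - a‖) (cocompact ℂ) atTop := by
  have : Tendsto (fun z : ℂ => ‖z‖ - ‖a‖) (cocompact ℂ) atTop :=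
    tendsto_atTop_add_const_right _ _ tendsto_norm_cocompact_atTop
  exact tendsto_atTop_mono (fun z => norm_sub_norm_le z a) this

/-- The Cauchy formula in the complement of finitely many disks. -/
theorem exterior_cauchy {ι : Type*} (S : Finset ι) (a : ι → ℂ) {r R : ℝ} (hr : 0 < r) (hrR : r < R)
    (hdisj : ∀ i ∈ S, ∀ j ∈ S, i ≠ j → Disjoint (ball (a i) R) (ball (a j) R)) {f : ℂ → ℂ}
    (hf : ∀ z, (∀ i ∈ S, r ≤ ‖z - a i‖) → DifferentiableAt ℂ f z)
    (hinf : Tendsto f (cocompact ℂ) (𝓝 0)) {z : ℂ} (hz : ∀ i ∈ S, r < ‖z - a i‖) :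
    f z = ∑ i ∈ S, cauchyExt (a i) r (fun θ => f (circleMap (a i) r θ)) z := by
  classical
  obtain ⟨s, hs, hs'⟩ := exists_between hrR
  have hs0 : 0 < s := by linarith
  have hann : ∀ i ∈ S, ∀ w, r ≤ ‖w - a i‖ → ‖w - a i‖ ≤ s → ∀ j ∈ S, r ≤ ‖w - a j‖ := by
    intro i hi w hw hw' j hj
    rcases eq_or_ne i j with rfl | hij
    · exact hw
    · by_contra h
      exact (Set.disjoint_left.1 (hdisj i hi j hj hij)
        (show w ∈ ball (a i) R by rw [mem_ball, dist_eq_norm]; linarith))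
        (by rw [mem_ball, dist_eq_norm]; linarith)
  have hout : ∀ i ∈ S, ∀ w, ‖w - a i‖ < R → ∀ j ∈ S, i ≠ j → R ≤ ‖w - a j‖ := by
    intro i hi w hw j hj hij
    by_contra h
    exact (Set.disjoint_left.1 (hdisj i hi j hj hij)
        (show w ∈ ball (a i) R by rwa [mem_ball, dist_eq_norm]))
        (by rw [mem_ball, dist_eq_norm]; linarith)
  have hfann : ∀ i ∈ S, ∀ w, r ≤ ‖w - a i‖ → ‖w - a i‖ ≤ s → DifferentiableAt ℂ f w :=
    fun i hi w hw hw' => hf w (hann i hi w hw hw')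
  set G : ι → ℂ → ℂ := fun i => cauchyExt (a i) r (fun θ => f (circleMap (a i) r θ)) with hG
  set P : ι → ℂ → ℂ := fun i => cauchyExt (a i) s (fun θ => f (circleMap (a i) s θ)) with hP
  have hGd : ∀ i ∈ S, ∀ z, r < ‖z - a i‖ → DifferentiableAt ℂ (G i) z := fun i hi z hz =>
    differentiableAt_cauchyExt (continuous_comp_circleMap hr.le
      fun w hw => (hfann i hi w (by linarith) (by linarith)).continuousAt)
      (by rw [abs_of_pos hr]; exact hz.ne')
  have hPd : ∀ i ∈ S, ∀ z, ‖z - a i‖ < s → DifferentiableAt ℂ (P i) z := fun i hi z hz =>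
    differentiableAt_cauchyExt (continuous_comp_circleMap hs0.le
      fun w hw => (hfann i hi w (by linarith) (by linarith)).continuousAt)
      (by rw [abs_of_pos hs0]; exact hz.ne)
  have hsplit : ∀ i ∈ S, ∀ z, r < ‖z - a i‖ → ‖z - a i‖ < s → f z = G i z - P i z :=
    fun i hi z hz hz' => annulus_cauchy_ext hr (hfann i hi) hz hz'
  set A : ι → ℂ → ℂ := fun i z => -P i z - ∑ j ∈ S.erase i, G j z with hA
  -- `f` minus all the Cauchy integrals extends to an entire function: inside the disk `i` it equals
  -- `-P i` minus the integrals over the other circles, by the annulus formula. It vanishes at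
  -- infinity, hence everywhere by Liouville.
  set J : ℂ → ℂ := fun z => if h : ∃ i ∈ S, ‖z - a i‖ ≤ r then A h.choose z
    else f z - ∑ j ∈ S, G j z with hJ
  have hJA : ∀ i ∈ S, ∀ z, ‖z - a i‖ < s → J z = A i z := by
    intro i hi z hz
    simp only [hJ]
    split_ifs with h
    · obtain ⟨hk, hk'⟩ := h.choose_spec
      have : h.choose = i := by
        by_contra hne
        have := hout i hi z (by linarith) _ hk (Ne.symm hne)
        linarith
      rw [this]
    · push Not at h
      rw [hsplit i hi z (h i hi) hz, hA, ← Finset.add_sum_erase S _ hi]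
      ring
  have hcn : ∀ i, Continuous fun z : ℂ => ‖z - a i‖ := fun i => by fun_prop
  have hJd : Differentiable ℂ J := by
    intro z
    by_cases h : ∃ i ∈ S, ‖z - a i‖ ≤ r
    · obtain ⟨i, hi, hir⟩ := h
      have h1 : DifferentiableAt ℂ (A i) z := by
        refine (hPd i hi z (by linarith)).neg.sub ?_
        refine DifferentiableAt.fun_sum fun j hj => ?_
        rw [Finset.mem_erase] at hj
        refine hGd j hj.2 z ?_
        have := hout i hi z (by linarith) j hj.2 (Ne.symm hj.1)
        linarith
      refine h1.congr_of_eventuallyEq ?_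
      have : ∀ᶠ w in 𝓝 z, ‖w - a i‖ < s :=
        (hcn i).continuousAt.eventually_lt continuousAt_const (by linarith)
      filter_upwards [this] with w hw
      exact hJA i hi w hw
    · push Not at h
      have h1 : DifferentiableAt ℂ (fun z => f z - ∑ j ∈ S, G j z) z :=
        (hf z fun i hi => (h i hi).le).sub
          (DifferentiableAt.fun_sum fun j hj => hGd j hj z (h j hj))
      refine h1.congr_of_eventuallyEq ?_
      have : ∀ᶠ w in 𝓝 z, ∀ i ∈ S, r < ‖w - a i‖ := by
        rw [Filter.eventually_all_finset]
        exact fun i hi => continuousAt_const.eventually_lt (hcn i).continuousAt (h i hi)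
      filter_upwards [this] with w hw
      have : ¬ ∃ i ∈ S, ‖w - a i‖ ≤ r := by
        push Not; exact hw
      simp only [hJ, dif_neg this]
  have hext : ∀ z, (∀ i ∈ S, r < ‖z - a i‖) → J z = f z - ∑ j ∈ S, G j z := by
    intro z hz
    have : ¬ ∃ i ∈ S, ‖z - a i‖ ≤ r := by
      push Not; exact hz
    simp only [hJ, dif_neg this]
  have hJ0 : Tendsto J (cocompact ℂ) (𝓝 0) := by
    have h1 : Tendsto (fun z => f z - ∑ j ∈ S, G j z) (cocompact ℂ) (𝓝 0) := by
      have : Tendsto (fun z => ∑ j ∈ S, G j z) (cocompact ℂ) (𝓝 (∑ j ∈ S, 0)) := by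
        refine tendsto_finsetSum _ fun j hj => ?_
        obtain ⟨M, hM⟩ := exists_bound_circle (f := f) (a := a j) hr.le
          fun w hw => (hfann j hj w (by linarith) (by linarith)).continuousAt
        exact tendsto_cauchyExt hr.le hM
      simpa using hinf.sub this
    refine h1.congr' ?_
    have : ∀ᶠ w in cocompact ℂ, ∀ i ∈ S, r < ‖w - a i‖ := by
      rw [Filter.eventually_all_finset]
      exact fun i hi => (tendsto_norm_sub_cocompact (a i)).eventually_gt_atTop r
    filter_upwards [this] with w hw
    exact (hext w hw).symm
  have := hJd.apply_eq_of_tendsto_cocompact z hJ0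
  rw [hext z hz] at this
  exact sub_eq_zero.1 this

/-! ### Conformal charts onto a disk -/

/-- `φ` is a biholomorphic map from the open set `D` onto the disk of radius `ρ` about `0`. -/
structure IsChart (φ : ℂ → ℂ) (D : Set ℂ) (ρ : ℝ) : Prop where
  isOpen : IsOpen D
  differentiableOn : DifferentiableOn ℂ φ D
  bijOn : BijOn φ D (ball 0 ρ)

namespace IsChart

variable {φ : ℂ → ℂ} {D : Set ℂ} {ρ : ℝ} (h : IsChart φ D ρ)
include h

theorem norm_lt {z : ℂ} (hz : z ∈ D) : ‖φ z‖ < ρ := by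
  simpa using h.bijOn.mapsTo hz

theorem differentiableAt {z : ℂ} (hz : z ∈ D) : DifferentiableAt ℂ φ z :=
  h.differentiableOn.differentiableAt (h.isOpen.mem_nhds hz)

theorem analyticAt {z : ℂ} (hz : z ∈ D) : AnalyticAt ℂ φ z :=
  h.differentiableOn.analyticAt (h.isOpen.mem_nhds hz)

/-- The inverse is continuous by the open mapping theorem and holomorphic where the derivative does
not vanish. The zeros of the derivative are isolated, since the chart is not locally constant, and
continuity removes the remaining singularities. Nonvanishing of the derivative then follows from the
chain rule. -/
theorem exists_inverse : ∃ g : ℂ → ℂ, DifferentiableOn ℂ g (ball 0 ρ) ∧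
    (∀ ζ ∈ ball (0:ℂ) ρ, g ζ ∈ D ∧ φ (g ζ) = ζ) ∧ (∀ z ∈ D, g (φ z) = z) := by
  set g := Function.invFunOn φ D with hg
  have hinv := h.bijOn.invOn_invFunOn
  have hg1 : ∀ ζ ∈ ball (0:ℂ) ρ, g ζ ∈ D ∧ φ (g ζ) = ζ := fun ζ hζ =>
    ⟨Function.invFunOn_mem (h.bijOn.surjOn hζ), hinv.2 hζ⟩
  have hg2 : ∀ z ∈ D, g (φ z) = z := fun z hz => hinv.1 hz
  have hnonconst : ∀ z ∈ D, ¬ ∀ᶠ w in 𝓝 z, φ w = φ z := by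
    intro z hz hc
    have h1 : ∀ᶠ w in 𝓝 z, w = z := by
      filter_upwards [hc, h.isOpen.mem_nhds hz] with w hw hwD
      exact h.bijOn.injOn hwD hz hw
    have h2 : ∀ᶠ w in 𝓝[≠] z, w = z := h1.filter_mono nhdsWithin_le_nhds
    obtain ⟨w, hw, hw'⟩ := (h2.and self_mem_nhdsWithin).exists
    exact hw' hw
  have hcont : ∀ z ∈ D, ContinuousAt g (φ z) := by
    intro z hz
    have h1 := ((h.analyticAt hz).eventually_constant_or_nhds_le_map_nhds).resolve_left
      (hnonconst z hz)
    rw [ContinuousAt, hg2 z hz]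
    refine (tendsto_map' ?_).mono_left h1
    refine (tendsto_congr' ?_).2 tendsto_id
    filter_upwards [h.isOpen.mem_nhds hz] with w hw
    exact hg2 w hw
  have hreg : ∀ z ∈ D, deriv φ z ≠ 0 → DifferentiableAt ℂ g (φ z) := by
    intro z hz hd
    refine (HasDerivAt.of_local_left_inverse (f := φ) (f' := deriv φ z) (hcont z hz) ?_ hd
      ?_).differentiableAt
    · rw [hg2 z hz]
      exact (h.differentiableAt hz).hasDerivAt
    · have : φ z ∈ ball (0:ℂ) ρ := h.bijOn.mapsTo hz
      filter_upwards [isOpen_ball.mem_nhds this] with ζ hζ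
      exact (hg1 ζ hζ).2
  refine ⟨g, ?_, hg1, hg2⟩
  intro ζ hζ
  obtain ⟨hz, hφz⟩ := hg1 ζ hζ
  set z := g ζ
  rw [← hφz]
  refine (analyticAt_of_differentiable_on_punctured_nhds_of_continuousAt ?_
    (hcont z hz)).differentiableAt.differentiableWithinAt
  have hda : AnalyticAt ℂ (deriv φ) z := (h.analyticAt hz).deriv
  have hne : ∀ᶠ w in 𝓝[≠] z, deriv φ w ≠ 0 := by
    refine hda.eventually_eq_zero_or_eventually_ne_zero.resolve_left fun h0 => ?_
    refine hnonconst z hz ?_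
    obtain ⟨r, hr, hball⟩ := Metric.eventually_nhds_iff_ball.1 (h0.and (h.isOpen.mem_nhds hz))
    filter_upwards [ball_mem_nhds z hr] with w hw
    refine (convex_ball z r).is_const_of_fderivWithin_eq_zero (𝕜 := ℂ) (f := φ)
      (fun x hx => (h.differentiableAt (hball x hx).2).differentiableWithinAt) ?_ hw
      (mem_ball_self hr)
    intro x hx
    rw [fderivWithin_of_isOpen isOpen_ball hx]
    ext
    simp [(hball x hx).1]
  have h2 : ∀ᶠ w in 𝓝 z, w ≠ z → deriv φ w ≠ 0 := eventually_nhdsWithin_iff.1 hne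
  have h3 := (hcont z hz).eventually (by rw [hg2 z hz]; exact h2)
  rw [eventually_nhdsWithin_iff]
  have hb : ball (0:ℂ) ρ ∈ 𝓝 (φ z) := isOpen_ball.mem_nhds (h.bijOn.mapsTo hz)
  filter_upwards [h3, hb] with η hη hηb hηne
  obtain ⟨hw, hφw⟩ := hg1 η hηb
  rw [← hφw]
  refine hreg _ hw (hη ?_)
  intro hgz
  rw [hgz] at hφw
  exact hηne hφw.symm

theorem deriv_ne_zero {z : ℂ} (hz : z ∈ D) : deriv φ z ≠ 0 := by
  obtain ⟨g, hg, hg1, hg2⟩ := h.exists_inverse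
  have hb : ball (0:ℂ) ρ ∈ 𝓝 (φ z) := isOpen_ball.mem_nhds (h.bijOn.mapsTo hz)
  have h1 : HasDerivAt (g ∘ φ) (deriv g (φ z) * deriv φ z) z :=
    (hg.differentiableAt hb).hasDerivAt.comp z (h.differentiableAt hz).hasDerivAt
  have h2 : HasDerivAt (g ∘ φ) 1 z := by
    refine (hasDerivAt_id z).congr_of_eventuallyEq ?_
    filter_upwards [h.isOpen.mem_nhds hz] with w hw
    exact hg2 w hw
  intro h0
  have := h1.unique h2
  rw [h0, mul_zero] at this
  exact zero_ne_one this

end IsChart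

/-- With `u = 1/φ` the integrand is `-K(u) du`. Since `K` has a primitive on the disk, the integrand
is an exact derivative along the circle, and no winding number of the image curve is needed. -/
theorem circleIntegral_inverse_square_eq_zero {φ K : ℂ → ℂ} {a : ℂ} {r T : ℝ} (hr : 0 ≤ r)
    (hφ : ∀ w ∈ sphere a r, DifferentiableAt ℂ φ w ∧ φ w ≠ 0 ∧ ‖φ w‖⁻¹ < T)
    (hK : DifferentiableOn ℂ K (ball 0 T)) :
    (∮ w in C(a, r), deriv φ w * (φ w ^ 2)⁻¹ * K (φ w)⁻¹) = 0 := by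
  obtain ⟨P, hP⟩ := hK.isExactOn_ball
  refine circleIntegral.integral_eq_zero_of_hasDerivWithinAt' (f := fun w => -P (φ w)⁻¹) ?_
  intro w hw
  rw [abs_of_nonneg hr] at hw
  obtain ⟨h1, h2, h3⟩ := hφ w hw
  have h4 : HasDerivAt (fun w => (φ w)⁻¹) (-deriv φ w / φ w ^ 2) w := h1.hasDerivAt.inv h2
  have h5 := ((hP (φ w)⁻¹ (by simpa using h3)).comp w h4).neg
  refine (h5.congr_deriv ?_).hasDerivWithinAt
  rw [div_eq_mul_inv]
  ring

/-- The expression in the coordinate `φ` of a form on a neck whose part that is holomorphic in the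
disk is `Q(ζ) dζ`, whose residue is `β` and whose part that is holomorphic in the opposite disk
is `Q'(ζ') dζ'`, `ζ ζ' = t`. -/
def neckForm (φ : ℂ → ℂ) (β t : ℂ) (Q Q' : ℂ → ℂ) (z : ℂ) : ℂ :=
  deriv φ z * (Q (φ z) + β / φ z - t / φ z ^ 2 * Q' (t / φ z))

theorem mul_mem_ball_of_norm_le {t u : ℂ} {ρ m : ℝ} (hρ : 0 < ρ) (hm : 0 < m)
    (ht : ‖t‖ ≤ ρ * m) (hu : u ∈ ball (0:ℂ) m⁻¹) : t * u ∈ ball (0:ℂ) ρ := by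
  rw [mem_ball_zero_iff] at hu ⊢
  have hm1 : ‖u‖ * m < 1 := by
    rw [← lt_div_iff₀ hm, one_div]; exact hu
  rw [norm_mul]
  calc ‖t‖ * ‖u‖ ≤ ρ * m * ‖u‖ := by gcongr
    _ = ρ * (‖u‖ * m) := by ring
    _ < ρ * 1 := by gcongr
    _ = ρ := mul_one _

namespace IsChart

variable {φ : ℂ → ℂ} {D : Set ℂ} {ρ : ℝ} (h : IsChart φ D ρ)
include h

theorem deriv_differentiableOn : DifferentiableOn ℂ (deriv φ) D :=
  h.differentiableOn.deriv h.isOpen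

theorem exists_eq_deriv_mul_comp {q : ℂ → ℂ} (hq : DifferentiableOn ℂ q D) :
    ∃ Q, DifferentiableOn ℂ Q (ball 0 ρ) ∧ ∀ z ∈ D, q z = deriv φ z * Q (φ z) := by
  obtain ⟨g, hg, hg1, hg2⟩ := h.exists_inverse
  refine ⟨fun ζ => q (g ζ) / deriv φ (g ζ), ?_, ?_⟩
  · refine DifferentiableOn.div (hq.comp hg fun ζ hζ => (hg1 ζ hζ).1)
      (h.deriv_differentiableOn.comp hg fun ζ hζ => (hg1 ζ hζ).1)
      fun ζ hζ => h.deriv_ne_zero (hg1 ζ hζ).1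
  · intro z hz
    simp only [hg2 z hz]
    rw [mul_div_cancel₀ _ (h.deriv_ne_zero hz)]

/-- The image of the circle under `φ` is not a circle, so variables are not changed. Instead `φ w -
φ z = (w - z) * dslope φ z w` with a nonvanishing second factor, and the ordinary Cauchy formula
applies to the quotient. -/
theorem circleIntegral_sub_inv_mul {q : ℂ → ℂ} (hq : DifferentiableOn ℂ q D) {a z : ℂ} {r : ℝ}
    (hr : 0 ≤ r) (hD : closedBall a r ⊆ D) (hz : z ∈ ball a r) :
    (∮ w in C(a, r), (φ w - φ z)⁻¹ * q w) = 2 * Real.pi * I * (q z / deriv φ z) := by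
  have hzD : z ∈ D := hD (ball_subset_closedBall hz)
  have hds : DifferentiableOn ℂ (dslope φ z) D :=
    (differentiableOn_dslope (h.isOpen.mem_nhds hzD)).2 h.differentiableOn
  have hne : ∀ w ∈ D, dslope φ z w ≠ 0 := by
    intro w hw
    rcases eq_or_ne w z with rfl | hwz
    · rw [dslope_same]; exact h.deriv_ne_zero hw
    · rw [dslope_of_ne _ hwz, slope_def_field]
      refine div_ne_zero (sub_ne_zero.2 fun he => hwz (h.bijOn.injOn hw hzD he)) (sub_ne_zero.2 hwz)
  have h1 := DifferentiableOn.circleIntegral_sub_inv_smul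
    (f := fun w => q w / dslope φ z w) ((hq.div hds hne).mono hD) hz
  rw [smul_eq_mul, dslope_same] at h1
  rw [← h1]
  refine circleIntegral.integral_congr hr fun w hw => ?_
  have hwz : w ≠ z := by
    rintro rfl
    rw [mem_sphere] at hw
    rw [mem_ball] at hz
    linarith
  have hwD : w ∈ D := hD (sphere_subset_closedBall hw)
  have h2 : φ w - φ z ≠ 0 := sub_ne_zero.2 fun he => hwz (h.bijOn.injOn hwD hzD he)
  have h3 : w - z ≠ 0 := sub_ne_zero.2 hwz
  simp only [smul_eq_mul]
  rw [dslope_of_ne _ hwz, slope_def_field]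
  field_simp

/-- The Cauchy formula that recovers the holomorphic part of a form on a neck. -/
theorem circleIntegral_neckForm {Q Q' : ℂ → ℂ} {β t : ℂ} {ρ' m : ℝ} {a z : ℂ} {r : ℝ}
    (hQ : DifferentiableOn ℂ Q (ball 0 ρ)) (hQ' : DifferentiableOn ℂ Q' (ball 0 ρ'))
    (hρ' : 0 < ρ')
    (hr : 0 ≤ r) (hD : closedBall a r ⊆ D) (hz : z ∈ ball a r) (hm : 0 < m)
    (hmw : ∀ w ∈ sphere a r, m < ‖φ w‖) (hzm : ‖φ z‖ ≤ m) (ht : ‖t‖ ≤ ρ' * m) :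
    (∮ w in C(a, r), (φ w - φ z)⁻¹ * neckForm φ β t Q Q' w) = 2 * Real.pi * I * Q (φ z) := by
  have hzD : z ∈ D := hD (ball_subset_closedBall hz)
  have hsD : ∀ w ∈ sphere a r, w ∈ D := fun w hw => hD (sphere_subset_closedBall hw)
  have hQφ : DifferentiableOn ℂ (fun w => deriv φ w * Q (φ w)) D :=
    h.deriv_differentiableOn.mul (hQ.comp h.differentiableOn h.bijOn.mapsTo)
  have h1 := h.circleIntegral_sub_inv_mul hQφ hr hD hz
  rw [mul_div_cancel_left₀ _ (h.deriv_ne_zero hzD)] at h1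
  -- The terms with `β` and `Q'` have the form `φ' φ⁻² K(1/φ)`. Here `‖φ z‖ ≤ m` and the bound on
  -- `t` make `K` holomorphic for `‖u‖ < 1/m`, while `‖φ w‖ > m` on the circle, so these terms
  -- integrate to zero.
  set K : ℂ → ℂ := fun u => (1 - φ z * u)⁻¹ * (β - t * u * Q' (t * u)) with hK
  have hne : ∀ w ∈ sphere a r, φ w ≠ 0 := fun w hw h0 => by
    have := hmw w hw
    rw [h0, norm_zero] at this
    linarith
  have hK' : DifferentiableOn ℂ K (ball 0 m⁻¹) := by
    have hin := fun u (hu : u ∈ ball (0:ℂ) m⁻¹) => mul_mem_ball_of_norm_le hρ' hm ht hu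
    have hid : DifferentiableOn ℂ (fun u : ℂ => t * u) (ball 0 m⁻¹) := by fun_prop
    refine DifferentiableOn.mul (DifferentiableOn.inv (by fun_prop) fun u hu => ?_) ?_
    · intro h0
      rw [sub_eq_zero] at h0
      have h2 : ‖φ z * u‖ < 1 := by
        rw [mem_ball_zero_iff] at hu
        rw [norm_mul]
        calc ‖φ z‖ * ‖u‖ ≤ m * ‖u‖ := by gcongr
          _ < m * m⁻¹ := by gcongr
          _ = 1 := mul_inv_cancel₀ hm.ne'
      rw [← h0, norm_one] at h2
      exact lt_irrefl _ h2
    · exact (differentiableOn_const β).sub (hid.mul (hQ'.comp hid hin))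
  have h2 := circleIntegral_inverse_square_eq_zero (φ := φ) (a := a) (T := m⁻¹) hr
    (fun w hw => ⟨h.differentiableAt (hsD w hw), hne w hw,
      (inv_lt_inv₀ (norm_pos_iff.2 (hne w hw)) hm).2 (hmw w hw)⟩) hK'
  have hφz : ∀ w ∈ sphere a r, φ w - φ z ≠ 0 := fun w hw h0 => by
    rw [sub_eq_zero] at h0
    have := hmw w hw
    rw [h0] at this
    linarith
  have hcφ : ContinuousOn φ (sphere a r) := fun w hw =>
    (h.differentiableAt (hsD w hw)).continuousAt.continuousWithinAt
  have hcd : ContinuousOn (deriv φ) (sphere a r) := fun w hw =>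
    (h.deriv_differentiableOn.differentiableAt
      (h.isOpen.mem_nhds (hsD w hw))).continuousAt.continuousWithinAt
  have i1 : CircleIntegrable (fun w => (φ w - φ z)⁻¹ * (deriv φ w * Q (φ w))) a r := by
    refine ContinuousOn.circleIntegrable hr ?_
    exact ((hcφ.sub continuousOn_const).inv₀ hφz).mul
      (hQφ.continuousOn.mono fun w hw => hsD w hw)
  have i2 : CircleIntegrable (fun w => deriv φ w * (φ w ^ 2)⁻¹ * K (φ w)⁻¹) a r := by
    refine ContinuousOn.circleIntegrable hr ?_
    refine (hcd.mul ((hcφ.pow 2).inv₀ fun w hw => pow_ne_zero 2 (hne w hw))).mul ?_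
    refine hK'.continuousOn.comp (hcφ.inv₀ hne) fun w hw => ?_
    rw [mem_ball_zero_iff, norm_inv]
    exact (inv_lt_inv₀ (norm_pos_iff.2 (hne w hw)) hm).2 (hmw w hw)
  rw [← h1, ← add_zero (∮ w in C(a, r), (φ w - φ z)⁻¹ * (deriv φ w * Q (φ w))), ← h2,
    ← circleIntegral.integral_add i1 i2]
  refine circleIntegral.integral_congr hr fun w hw => ?_
  have e1 := hφz w hw
  have e2 := hne w hw
  simp only [neckForm, hK]
  have e3 : 1 - φ z * (φ w)⁻¹ = (φ w - φ z) * (φ w)⁻¹ := by field_simp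
  have e4 : t * (φ w)⁻¹ = t / φ w := (div_eq_mul_inv _ _).symm
  rw [e3, e4, mul_inv, inv_inv]
  field_simp
  ring

/-- Since `φ z = 0`, the terms `Q + β/φ` are `(φ Q + β)/(φ - φ z)`, and the Cauchy formula evaluates
the numerator at the centre. The `Q'` term is exact in `1/φ`. -/
theorem circleIntegral_neckForm_residue {Q Q' : ℂ → ℂ} {β t : ℂ} {ρ' m : ℝ} {a z : ℂ} {r : ℝ}
    (hQ : DifferentiableOn ℂ Q (ball 0 ρ)) (hQ' : DifferentiableOn ℂ Q' (ball 0 ρ')) (hρ' : 0 < ρ')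
    (hr : 0 ≤ r) (hD : closedBall a r ⊆ D) (hz : z ∈ ball a r) (hz0 : φ z = 0) (hm : 0 < m)
    (hmw : ∀ w ∈ sphere a r, m < ‖φ w‖) (ht : ‖t‖ ≤ ρ' * m) :
    (∮ w in C(a, r), neckForm φ β t Q Q' w) = 2 * Real.pi * I * β := by
  have hzD : z ∈ D := hD (ball_subset_closedBall hz)
  have hsD : ∀ w ∈ sphere a r, w ∈ D := fun w hw => hD (sphere_subset_closedBall hw)
  have hne : ∀ w ∈ sphere a r, φ w ≠ 0 := fun w hw h0 => by
    have := hmw w hw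
    rw [h0, norm_zero] at this
    linarith
  have hqφ : DifferentiableOn ℂ (fun w => deriv φ w * (φ w * Q (φ w) + β)) D :=
    h.deriv_differentiableOn.mul ((h.differentiableOn.mul
      (hQ.comp h.differentiableOn h.bijOn.mapsTo)).add_const β)
  have h1 := h.circleIntegral_sub_inv_mul hqφ hr hD hz
  rw [mul_div_cancel_left₀ _ (h.deriv_ne_zero hzD), hz0, zero_mul, zero_add] at h1
  have hid : DifferentiableOn ℂ (fun u : ℂ => t * u) (ball 0 m⁻¹) := by fun_prop
  have hK : DifferentiableOn ℂ (fun u => -t * Q' (t * u)) (ball 0 m⁻¹) :=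
    (hQ'.comp hid fun u hu => mul_mem_ball_of_norm_le hρ' hm ht hu).const_mul _
  have h2 := circleIntegral_inverse_square_eq_zero (φ := φ) (a := a) (T := m⁻¹) hr
    (fun w hw => ⟨h.differentiableAt (hsD w hw), hne w hw,
      (inv_lt_inv₀ (norm_pos_iff.2 (hne w hw)) hm).2 (hmw w hw)⟩) hK
  have hcφ : ContinuousOn φ (sphere a r) := fun w hw =>
    (h.differentiableAt (hsD w hw)).continuousAt.continuousWithinAt
  have hcd : ContinuousOn (deriv φ) (sphere a r) := fun w hw =>
    (h.deriv_differentiableOn.differentiableAt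
      (h.isOpen.mem_nhds (hsD w hw))).continuousAt.continuousWithinAt
  have i1 : CircleIntegrable (fun w => (φ w - 0)⁻¹ * (deriv φ w * (φ w * Q (φ w) + β))) a r := by
    refine ContinuousOn.circleIntegrable hr ?_
    exact ((hcφ.sub continuousOn_const).inv₀ fun w hw => by
      simpa using hne w hw).mul
      (hqφ.continuousOn.mono fun w hw => hsD w hw)
  have i2 : CircleIntegrable (fun w => deriv φ w * (φ w ^ 2)⁻¹ * (-t * Q' (t * (φ w)⁻¹))) a r := by
    refine ContinuousOn.circleIntegrable hr ?_
    refine (hcd.mul ((hcφ.pow 2).inv₀ fun w hw => pow_ne_zero 2 (hne w hw))).mul ?_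
    refine hK.continuousOn.comp (hcφ.inv₀ hne) fun w hw => ?_
    rw [mem_ball_zero_iff, norm_inv]
    exact (inv_lt_inv₀ (norm_pos_iff.2 (hne w hw)) hm).2 (hmw w hw)
  have h3 := circleIntegral.integral_add i1 i2
  rw [h1, h2, add_zero] at h3
  rw [← h3]
  refine circleIntegral.integral_congr hr fun w hw => ?_
  have e2 := hne w hw
  have e4 : t * (φ w)⁻¹ = t / φ w := (div_eq_mul_inv _ _).symm
  simp only [neckForm]
  rw [e4, sub_zero]
  field_simp
  ring

end IsChart

/-! ### Decomposition of a form on a neck -/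

/-- In the variable `u = 1/ζ` the part of the Laurent splitting that decays at infinity is
holomorphic and vanishes at `0`. Two successive divided differences there separate the residue from
the remainder, which is rescaled by `t` to become `Q'`. -/
theorem exists_laurent {F : ℂ → ℂ} {t : ℂ} {ρ : ℝ} (hρ : 0 < ρ) (ht0 : t ≠ 0) (ht : ‖t‖ < ρ ^ 2)
    (hF : ∀ ζ : ℂ, ‖t‖ / ρ < ‖ζ‖ → ‖ζ‖ < ρ → DifferentiableAt ℂ F ζ) :
    ∃ (Q Q' : ℂ → ℂ) (β : ℂ), DifferentiableOn ℂ Q (ball 0 ρ) ∧ DifferentiableOn ℂ Q' (ball 0 ρ) ∧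
      ∀ ζ : ℂ, ‖t‖ / ρ < ‖ζ‖ → ‖ζ‖ < ρ → F ζ = Q ζ + β / ζ - t / ζ ^ 2 * Q' (t / ζ) := by
  have htp : 0 < ‖t‖ := norm_pos_iff.2 ht0
  have hσ : 0 < ‖t‖ / ρ := by positivity
  obtain ⟨Q, N, hQ, hN, hQN, hN0⟩ := exists_split (f := F) (a := 0) (σ := ‖t‖ / ρ) (ρ := ρ) hσ.le
    (by rw [div_lt_iff₀ hρ]; nlinarith) (by simpa using hF)
  simp only [sub_zero] at hN hQN
  set n : ℂ → ℂ := fun u => if u = 0 then 0 else N u⁻¹ with hn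
  have hb0 : ball (0:ℂ) (‖t‖ / ρ)⁻¹ ∈ 𝓝 (0:ℂ) := ball_mem_nhds _ (inv_pos.2 hσ)
  have hnd : DifferentiableOn ℂ n (ball 0 (‖t‖ / ρ)⁻¹) := by
    rw [← differentiableOn_compl_singleton_and_continuousAt_iff hb0]
    constructor
    · rintro u ⟨hu, hu0⟩
      rw [mem_singleton_iff] at hu0
      rw [mem_ball_zero_iff] at hu
      have h1 : DifferentiableAt ℂ (fun u => N u⁻¹) u := by
        refine DifferentiableAt.comp (f := fun u => u⁻¹) u (hN _ ?_) (differentiableAt_inv hu0)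
        rw [norm_inv]
        rwa [lt_inv_comm₀ hσ (norm_pos_iff.2 hu0)]
      refine (h1.congr_of_eventuallyEq ?_).differentiableWithinAt
      filter_upwards [isOpen_ne.mem_nhds hu0] with w hw
      simp only [hn, if_neg hw]
    · rw [continuousAt_iff_punctured_nhds]
      have h1 : Tendsto (fun u : ℂ => N u⁻¹) (𝓝[≠] 0) (𝓝 0) := by
        refine hN0.comp ?_
        rw [← cobounded_eq_cocompact]
        exact tendsto_inv₀_nhdsNE_zero
      simp only [hn, if_true]
      refine h1.congr' ?_
      filter_upwards [self_mem_nhdsWithin] with w hw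
      have hw' : w ≠ 0 := hw
      rw [if_neg hw']
  have hd1 := (differentiableOn_dslope hb0).2 hnd
  have hd2 := (differentiableOn_dslope hb0).2 hd1
  set n1 := dslope n 0 with hn1
  set n2 := dslope n1 0 with hn2
  have e1 : ∀ u, n u = u * n1 u := fun u => by
    have := sub_smul_dslope n 0 u
    simp only [sub_zero, smul_eq_mul, hn, if_true] at this
    simp only [hn1, hn, this]
  have e2 : ∀ u, n1 u = n1 0 + u * n2 u := fun u => by
    have := sub_smul_dslope n1 0 u
    simp only [sub_zero, smul_eq_mul] at this
    rw [hn2, this]; ring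
  -- Chosen so that `-(t/ζ²) Q'(t/ζ) = ζ⁻² n2(1/ζ)`. The disk of radius `ρ/‖t‖` on which `n2` is
  -- holomorphic becomes the disk of radius `ρ`.
  refine ⟨Q, fun η => -(1 / t) * n2 (η / t), n1 0, hQ, ?_, ?_⟩
  · have : DifferentiableOn ℂ (fun η : ℂ => η / t) (ball 0 ρ) := by fun_prop
    refine (hd2.comp this fun η hη => ?_).const_mul _
    rw [mem_ball_zero_iff] at hη ⊢
    rw [norm_div, inv_div]
    gcongr
  · intro ζ h1 h2
    have hζ : ζ ≠ 0 := by
      rw [← norm_pos_iff]; exact hσ.trans h1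
    have h3 : N ζ = n ζ⁻¹ := by
      simp only [hn, inv_eq_zero, if_neg hζ, inv_inv]
    rw [hQN ζ h1 h2, h3, e1, e2]
    have h4 : t / ζ / t = ζ⁻¹ := by field_simp
    simp only [h4]
    field_simp
    ring

/-- A form on an opened neck (`t ≠ 0`) is given by the expressions `neckForm` on both sides. -/
theorem exists_neckForm_of_ne_zero {φ φ' f f' : ℂ → ℂ} {D D' : Set ℂ} {ρ : ℝ} {t : ℂ}
    (h : IsChart φ D ρ) (h' : IsChart φ' D' ρ) (hρ : 0 < ρ) (ht0 : t ≠ 0) (ht : ‖t‖ < ρ ^ 2)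
    (hf : ∀ z ∈ D, ‖t‖ / ρ < ‖φ z‖ → DifferentiableAt ℂ f z)
    (hneck : ∀ z ∈ D, ∀ z' ∈ D', φ z * φ' z' = t →
      f z = f' z' * -(deriv φ z * φ' z' / (φ z * deriv φ' z'))) :
    ∃ (Q Q' : ℂ → ℂ) (β : ℂ), DifferentiableOn ℂ Q (ball 0 ρ) ∧ DifferentiableOn ℂ Q' (ball 0 ρ) ∧
      (∀ z ∈ D, ‖t‖ / ρ < ‖φ z‖ → f z = neckForm φ β t Q Q' z) ∧
      (∀ z ∈ D', ‖t‖ / ρ < ‖φ' z‖ → f' z = neckForm φ' (-β) t Q' Q z) := by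
  obtain ⟨g, hg, hg1, hg2⟩ := h.exists_inverse
  have htp : 0 < ‖t‖ := norm_pos_iff.2 ht0
  set F : ℂ → ℂ := fun ζ => f (g ζ) / deriv φ (g ζ) with hF
  have hFd : ∀ ζ : ℂ, ‖t‖ / ρ < ‖ζ‖ → ‖ζ‖ < ρ → DifferentiableAt ℂ F ζ := by
    intro ζ h1 h2
    have hb : ζ ∈ ball (0:ℂ) ρ := by simpa using h2
    obtain ⟨hz, hφ⟩ := hg1 ζ hb
    have hgd : DifferentiableAt ℂ g ζ := hg.differentiableAt (isOpen_ball.mem_nhds hb)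
    refine DifferentiableAt.div ?_ ?_ (h.deriv_ne_zero hz)
    · exact DifferentiableAt.comp ζ (hf _ hz (by rwa [hφ])) hgd
    · exact DifferentiableAt.comp ζ
        (h.deriv_differentiableOn.differentiableAt (h.isOpen.mem_nhds hz)) hgd
  obtain ⟨Q, Q', β, hQ, hQ', hFQ⟩ := exists_laurent hρ ht0 ht hFd
  refine ⟨Q, Q', β, hQ, hQ', ?_, ?_⟩
  · intro z hz hzt
    have := hFQ (φ z) hzt (h.norm_lt hz)
    simp only [hF, hg2 z hz] at this
    rw [neckForm, ← this, mul_div_cancel₀ _ (h.deriv_ne_zero hz)]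
  · intro z' hz' hzt'
    have hφ' : φ' z' ≠ 0 := by
      rw [← norm_pos_iff]; exact (by positivity : (0:ℝ) < ‖t‖ / ρ).trans hzt'
    have hpos' : 0 < ‖φ' z'‖ := norm_pos_iff.2 hφ'
    have hlt' := h'.norm_lt hz'
    have hζ : ‖t / φ' z'‖ < ρ := by
      rw [norm_div, div_lt_iff₀ hpos']
      rw [div_lt_iff₀ hρ] at hzt'
      linarith
    have hζ2 : ‖t‖ / ρ < ‖t / φ' z'‖ := by
      rw [norm_div]
      gcongr
    -- The point identified with `z'` has coordinate `t/φ' z'`. Under `ζ ↦ t/ζ` the two holomorphic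
    -- parts are exchanged and `dζ/ζ` changes sign, whence `-β`.
    obtain ⟨hz, hφ⟩ := hg1 (t / φ' z') (by simpa using hζ)
    have h0 := hFQ _ hζ2 hζ
    have h1 := hneck _ hz z' hz' (by rw [hφ]; field_simp)
    have hd := h.deriv_ne_zero hz
    have hd' := h'.deriv_ne_zero hz'
    simp only [hF] at h0
    rw [h1, hφ] at h0
    have h2 : t / (t / φ' z') = φ' z' := by field_simp
    rw [h2] at h0
    rw [neckForm]
    set q := Q (t / φ' z')
    set q' := Q' (φ' z')
    field_simp at h0 ⊢
    linear_combination -h0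

/-- A form with a simple pole of residue `b` at the centre of a chart. -/
theorem IsChart.exists_neckForm_zero {φ f A : ℂ → ℂ} {D : Set ℂ} {ρ : ℝ} {b p : ℂ}
    (h : IsChart φ D ρ) (hp : p ∈ D) (hp0 : φ p = 0)
    (hf : ∀ z ∈ D, z ≠ p → DifferentiableAt ℂ f z) (hA : AnalyticAt ℂ A p)
    (hfA : ∀ᶠ z in 𝓝[≠] p, f z = b / (z - p) + A z) :
    ∃ Q : ℂ → ℂ, DifferentiableOn ℂ Q (ball 0 ρ) ∧
      ∀ z ∈ D, z ≠ p → f z = deriv φ z * (Q (φ z) + b / φ z) := by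
  have hDp : D ∈ 𝓝 p := h.isOpen.mem_nhds hp
  set k := dslope φ p with hk
  have hkd : DifferentiableOn ℂ k D := (differentiableOn_dslope hDp).2 h.differentiableOn
  have hk0 : k p ≠ 0 := by rw [hk, dslope_same]; exact h.deriv_ne_zero hp
  have hφk : ∀ z, φ z = (z - p) * k z := fun z => by
    have := sub_smul_dslope φ p z
    rw [hp0, sub_zero, smul_eq_mul] at this
    exact this.symm
  have hka : AnalyticAt ℂ k p := hkd.analyticAt hDp
  have hne : ∀ z ∈ D, z ≠ p → φ z ≠ 0 := fun z hz hzp h0 =>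
    hzp (h.bijOn.injOn hz hp (by rw [h0, hp0]))
  -- Writing `φ z = (z - p) k z` gives `φ'/φ = 1/(z - p) + k'/k`. So subtracting `b φ'/φ` removes
  -- the pole, and the limit at `p` is the value assigned there.
  set q : ℂ → ℂ := fun z => if z = p then A p - b * (deriv k p / k p)
    else f z - b * (deriv φ z / φ z) with hq
  have hev : ∀ᶠ z in 𝓝 p, q z = A z - b * (deriv k z / k z) := by
    rw [eventually_nhdsWithin_iff] at hfA
    filter_upwards [hfA, hDp, hka.continuousAt.eventually_ne hk0] with z hz hzD hkz
    by_cases hzp : z = p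
    · simp only [hq, hzp, if_true]
    · have h1 : deriv φ z = k z + (z - p) * deriv k z := by
        have h2 : HasDerivAt (fun z => (z - p) * k z) (1 * k z + (z - p) * deriv k z) z :=
          ((hasDerivAt_id z).sub_const p).mul
            (hkd.differentiableAt (h.isOpen.mem_nhds hzD)).hasDerivAt
        rw [one_mul] at h2
        rw [← h2.deriv]
        congr 1
        exact funext hφk
      have h3 : z - p ≠ 0 := sub_ne_zero.2 hzp
      simp only [hq, if_neg hzp]
      rw [hz hzp, h1, hφk z]
      field_simp
      ring
  have hqd : DifferentiableOn ℂ q D := by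
    intro z hz
    refine DifferentiableAt.differentiableWithinAt ?_
    by_cases hzp : z = p
    · rw [hzp]
      refine DifferentiableAt.congr_of_eventuallyEq ?_ hev
      exact hA.differentiableAt.sub ((hka.deriv.differentiableAt.div hka.differentiableAt
        hk0).const_mul b)
    · have h1 : DifferentiableAt ℂ (fun z => f z - b * (deriv φ z / φ z)) z :=
        (hf z hz hzp).sub (((h.deriv_differentiableOn.differentiableAt
          (h.isOpen.mem_nhds hz)).div (h.differentiableAt hz) (hne z hz hzp)).const_mul b)
      refine h1.congr_of_eventuallyEq ?_
      filter_upwards [isOpen_ne.mem_nhds hzp] with w hw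
      simp only [hq, if_neg hw]
  obtain ⟨Q, hQ, hQq⟩ := h.exists_eq_deriv_mul_comp hqd
  refine ⟨Q, hQ, fun z hz hzp => ?_⟩
  have := hQq z hz
  simp only [hq, if_neg hzp] at this
  have h2 := hne z hz hzp
  linear_combination this

/-! ### Holomorphy at infinity -/

theorem HolomorphicAtInfty.tendsto {f : ℂ → ℂ} (hf : HolomorphicAtInfty f) :
    Tendsto f (cocompact ℂ) (𝓝 0) := by
  obtain ⟨g, hg, hgf⟩ := hf
  have h1 : Tendsto (fun w : ℂ => -(w ^ 2 * g w)) (𝓝[≠] 0) (𝓝 0) := by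
    have : ContinuousAt (fun w : ℂ => -(w ^ 2 * g w)) 0 :=
      ((continuousAt_id.pow 2).mul hg.continuousAt).neg
    have h2 := this.tendsto
    simp only [ne_eq, OfNat.ofNat_ne_zero, not_false_eq_true, zero_pow, zero_mul, neg_zero] at h2
    exact h2.mono_left nhdsWithin_le_nhds
  have h2 : Tendsto (fun w : ℂ => f w⁻¹) (𝓝[≠] 0) (𝓝 0) := by
    refine h1.congr' ?_
    filter_upwards [hgf, self_mem_nhdsWithin] with w hw hw0
    have : w ≠ 0 := hw0
    rw [hw]
    field_simp
  have h3 := h2.comp (tendsto_inv₀_cobounded' (α := ℂ))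
  rw [← Metric.cobounded_eq_cocompact]
  simpa [Function.comp_def] using h3

/-- Quadratic decay says that `-f(1/w)/w²` is bounded near `0`, so the singularity there is
removable. -/
theorem holomorphicAtInfty_of_norm_le {f : ℂ → ℂ} {R C : ℝ} (hR : 0 < R)
    (hd : ∀ z, R < ‖z‖ → DifferentiableAt ℂ f z) (hb : ∀ z, R < ‖z‖ → ‖f z‖ ≤ C / ‖z‖ ^ 2) :
    HolomorphicAtInfty f := by
  set k : ℂ → ℂ := fun w => -f w⁻¹ / w ^ 2 with hk
  have hs : ball (0:ℂ) R⁻¹ ∈ 𝓝 (0:ℂ) := ball_mem_nhds _ (inv_pos.2 hR)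
  have hlt : ∀ w ∈ ball (0:ℂ) R⁻¹ \ {0}, w ≠ 0 ∧ R < ‖w⁻¹‖ := by
    rintro w ⟨hw, hw0⟩
    rw [mem_singleton_iff] at hw0
    rw [mem_ball_zero_iff] at hw
    refine ⟨hw0, ?_⟩
    rw [norm_inv]
    rwa [lt_inv_comm₀ hR (norm_pos_iff.2 hw0)]
  have h := differentiableOn_update_limUnder_of_bddAbove (f := k) hs ?_ ?_
  · refine ⟨_, h.analyticAt hs, ?_⟩
    filter_upwards [self_mem_nhdsWithin] with w hw
    rw [Function.update_of_ne hw]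
  · intro w hw
    obtain ⟨hw0, hw1⟩ := hlt w hw
    refine DifferentiableAt.differentiableWithinAt ?_
    refine DifferentiableAt.div (DifferentiableAt.neg ?_) (by fun_prop) (pow_ne_zero 2 hw0)
    exact DifferentiableAt.comp (f := fun w => w⁻¹) w (hd _ hw1) (differentiableAt_inv hw0)
  · refine ⟨C, ?_⟩
    rintro _ ⟨w, hw, rfl⟩
    obtain ⟨hw0, hw1⟩ := hlt w hw
    have := hb _ hw1
    have hw0' : 0 < ‖w‖ := norm_pos_iff.2 hw0
    simp only [Function.comp_apply, hk, norm_div, norm_neg, norm_pow]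
    rw [norm_inv, inv_pow, div_inv_eq_mul] at this
    rwa [div_le_iff₀ (by positivity)]

end Traizet

namespace Traizet

open Metric Set Filter

universe u v

/-! ### Holomorphic maps between normed spaces -/

section Holomorphic

variable {X : Type u} {F : Type v} [NormedAddCommGroup X] [NormedSpace ℂ X]
  [NormedAddCommGroup F] [NormedSpace ℂ F]

theorem norm_fderiv_le_of_norm_le {f : X → F} {y : X} {R K : ℝ} (hR : 0 < R)
    (hf : DifferentiableOn ℂ f (ball y R)) (hK : ∀ z ∈ ball y R, ‖f z‖ ≤ K) :
    ‖fderiv ℂ f y‖ ≤ 2 * K / R := by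
  refine Complex.norm_fderiv_le_div_of_mapsTo_ball hf (fun z hz => ?_) hR
  rw [mem_closedBall, dist_eq_norm]
  have h1 := hK z hz
  have h2 := hK y (mem_ball_self hR)
  have := norm_sub_le (f z) (f y)
  linarith

/-- A Schwarz lemma of second order: `f` minus its linear part stays within `2K + 2K` of its value
at `y` and vanishes there to first order, so it is bounded by the square of the relative distance.
This quadratic remainder is the source of all later differentiability statements. -/
theorem norm_taylor_le_of_norm_le {f : X → F} {y h : X} {R K : ℝ} (hR : 0 < R)
    (hf : DifferentiableOn ℂ f (ball y R)) (hK : ∀ z ∈ ball y R, ‖f z‖ ≤ K) (hh : ‖h‖ < R) :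
    ‖f (y + h) - f y - fderiv ℂ f y h‖ ≤ 4 * K * (‖h‖ / R) ^ 2 := by
  set G : X → F := fun z => f z - fderiv ℂ f y (z - y) with hG
  have hGd : DifferentiableOn ℂ G (ball y R) :=
    hf.sub ((fderiv ℂ f y).differentiable.comp (differentiable_id.sub_const y)).differentiableOn
  have hGy : G y = f y := by simp [hG]
  have hmaps : MapsTo G (ball y R) (closedBall (G y) (4 * K)) := by
    intro z hz
    rw [mem_closedBall, dist_eq_norm, hGy]
    have h1 := hK z hz
    have h2 := hK y (mem_ball_self hR)
    have h3 := norm_fderiv_le_of_norm_le hR hf hK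
    have h4 : ‖fderiv ℂ f y (z - y)‖ ≤ 2 * K / R * R := by
      refine ((fderiv ℂ f y).le_opNorm _).trans ?_
      rw [mem_ball, dist_eq_norm] at hz
      have : 0 ≤ 2 * K / R := (norm_nonneg _).trans h3
      gcongr
    rw [div_mul_cancel₀ _ hR.ne'] at h4
    have e : G z - f y = f z - f y - fderiv ℂ f y (z - y) := by simp only [hG]; abel
    rw [e]
    have h5 := norm_sub_le (f z - f y) (fderiv ℂ f y (z - y))
    have h6 := norm_sub_le (f z) (f y)
    linarith
  have hd : HasFDerivAt f (fderiv ℂ f y) y :=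
    (hf.differentiableAt (ball_mem_nhds _ hR)).hasFDerivAt
  have hn : (fun z => G z - G y) =o[𝓝 y] fun w => ‖w - y‖ ^ 1 := by
    have h1 := hd.isLittleO
    simp only [pow_one]
    refine (h1.norm_right).congr_left fun z => ?_
    rw [hGy]
    simp only [hG]; abel
  have := Complex.dist_le_mul_div_pow_of_mapsTo_ball_of_isLittleO (n := 1) (z := y + h) hGd hmaps hn
    (by rw [mem_ball, dist_eq_norm]; simpa using hh)
  rw [dist_eq_norm, dist_eq_norm, hGy, add_sub_cancel_left] at this
  have e : G (y + h) - f y = f (y + h) - f y - fderiv ℂ f y h := by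
    simp only [hG, add_sub_cancel_left]; abel
  rwa [e] at this

theorem exists_ball_bound {f : X → F} {U : Set X} (hU : IsOpen U) (hf : DifferentiableOn ℂ f U)
    {y : X} (hy : y ∈ U) : ∃ R > 0, ∃ K, ball y R ⊆ U ∧ ∀ z ∈ ball y R, ‖f z‖ ≤ K := by
  have h1 : ContinuousAt (fun z => ‖f z‖) y :=
    (hf.differentiableAt (hU.mem_nhds hy)).continuousAt.norm
  have h2 : ∀ᶠ z in 𝓝 y, z ∈ U ∧ ‖f z‖ < ‖f y‖ + 1 :=
    (hU.eventually_mem hy).and (h1.eventually_lt continuousAt_const (by linarith))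
  obtain ⟨R, hR, hb⟩ := Metric.eventually_nhds_iff_ball.1 h2
  exact ⟨R, hR, ‖f y‖ + 1, fun z hz => (hb z hz).1, fun z hz => (hb z hz).2.le⟩

variable [CompleteSpace F]

/-- Uniform limits of holomorphic maps are holomorphic. -/
theorem differentiableAt_of_tendstoUniformlyOn {f : ℕ → X → F} {g : X → F} {y : X} {R : ℝ}
    (hR : 0 < R) (hf : ∀ᶠ n in atTop, DifferentiableOn ℂ (f n) (ball y R))
    (hg : TendstoUniformlyOn f g atTop (ball y R)) : DifferentiableAt ℂ g y := by
  have hR2 : 0 < R / 2 := by positivity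
  have hcauchy : UniformCauchySeqOn (fun n => fderiv ℂ (f n)) atTop (ball y (R / 2)) := by
    rw [Metric.uniformCauchySeqOn_iff]
    intro ε hε
    obtain ⟨N, hN⟩ := (Metric.uniformCauchySeqOn_iff.1 hg.uniformCauchySeqOn) (ε * R / 8)
      (by positivity)
    obtain ⟨N', hN'⟩ := eventually_atTop.1 hf
    refine ⟨max N N', fun m hm n hn z hz => ?_⟩
    have hsub : ball z (R / 2) ⊆ ball y R := by
      refine ball_subset_ball' ?_
      rw [mem_ball] at hz
      linarith
    have hdm := (hN' m (le_of_max_le_right hm)).mono hsub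
    have hdn := (hN' n (le_of_max_le_right hn)).mono hsub
    have h1 := norm_fderiv_le_of_norm_le (f := fun w => f m w - f n w) (K := ε * R / 8) hR2
      (hdm.sub hdn) (fun w hw => by
        have := hN m (le_of_max_le_left hm) n (le_of_max_le_left hn) w (hsub hw)
        rw [dist_eq_norm] at this
        exact this.le)
    have hz' := ball_mem_nhds z hR2
    rw [fderiv_fun_sub (hdm.differentiableAt hz') (hdn.differentiableAt hz')] at h1
    rw [dist_eq_norm]
    refine h1.trans_lt ?_
    have : 2 * (ε * R / 8) / (R / 2) = ε / 2 := by field_simp; ring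
    rw [this]; linarith
  have hlim : ∀ z ∈ ball y (R / 2), ∃ L, Tendsto (fun n => fderiv ℂ (f n) z) atTop (𝓝 L) :=
    fun z hz => cauchySeq_tendsto_of_complete (hcauchy.cauchySeq hz)
  choose! L hL using hlim
  have hunif := hcauchy.tendstoUniformlyOn_of_tendsto hL
  have hy : ball y (R / 2) ∈ 𝓝 y := ball_mem_nhds _ hR2
  refine (hasFDerivAt_of_tendstoUniformlyOnFilter (𝕜 := ℂ) (l := atTop) (f := f) (g := g)
    (f' := fun n => fderiv ℂ (f n)) (g' := L) (x := y) ?_ ?_ ?_).differentiableAt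
  · exact hunif.tendstoUniformlyOnFilter.mono_right (le_principal_iff.2 hy)
  · have := hf.prod_mk (eventually_mem_set.2 hy)
    filter_upwards [this] with p hp
    have h1 : ball p.2 (R / 2) ⊆ ball y R := by
      refine ball_subset_ball' ?_
      have := hp.2
      rw [mem_ball] at this
      linarith
    exact ((hp.1.mono h1).differentiableAt (ball_mem_nhds _ hR2)).hasFDerivAt
  · filter_upwards [hy] with z hz
    exact hg.tendsto_at (ball_subset_ball (by linarith) hz)

/-- A directional derivative is the limit of the holomorphic difference quotients `n (f(z + h/n) - f
z)`, and the Taylor estimate makes the convergence uniform near `y`. -/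
theorem differentiableAt_fderiv_apply {f : X → F} {U : Set X} (hU : IsOpen U)
    (hf : DifferentiableOn ℂ f U) {y : X} (hy : y ∈ U) (h : X) :
    DifferentiableAt ℂ (fun z => fderiv ℂ f z h) y := by
  obtain ⟨R, hR, K, hRU, hK⟩ := exists_ball_bound hU hf hy
  have hK0 : 0 ≤ K := (norm_nonneg _).trans (hK y (mem_ball_self hR))
  have hfR := hf.mono hRU
  have hR2 : 0 < R / 2 := by positivity
  have hbig : ∀ᶠ n : ℕ in atTop, ‖h‖ * 2 < (n + 1 : ℝ) * R := by
    have : Tendsto (fun n : ℕ => ((n : ℝ) + 1) * R) atTop atTop :=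
      (tendsto_atTop_add_const_right _ 1 tendsto_natCast_atTop_atTop).atTop_mul_const hR
    exact this.eventually_gt_atTop _
  have hnorm : ∀ n : ℕ, ‖((n + 1 : ℂ))⁻¹ • h‖ = ‖h‖ / (n + 1 : ℝ) := by
    intro n
    rw [norm_smul, norm_inv]
    have : ‖(n + 1 : ℂ)‖ = (n + 1 : ℝ) := by
      have := Complex.norm_natCast (n + 1)
      push_cast at this
      exact this
    rw [this]; ring
  have hsmall : ∀ n : ℕ, ‖h‖ * 2 < (n + 1 : ℝ) * R → ‖((n + 1 : ℂ))⁻¹ • h‖ < R / 2 := by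
    intro n hn
    have h1 : (0:ℝ) < n + 1 := by positivity
    rw [hnorm, div_lt_iff₀ h1]
    linarith
  refine differentiableAt_of_tendstoUniformlyOn (R := R / 2) hR2
    (f := fun n z => (n + 1 : ℂ) • (f (z + ((n + 1 : ℂ))⁻¹ • h) - f z)) ?_ ?_
  · filter_upwards [hbig] with n hn
    refine DifferentiableOn.const_smul (DifferentiableOn.sub ?_ ?_) _
    · refine hfR.comp (by fun_prop) fun z hz => ?_
      rw [mem_ball] at hz ⊢
      have := hsmall n hn
      calc dist (z + ((n + 1 : ℂ))⁻¹ • h) y ≤ dist (z + ((n + 1 : ℂ))⁻¹ • h) z + dist z y :=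
            dist_triangle _ _ _
        _ < R / 2 + R / 2 := by
            gcongr
            rwa [dist_eq_norm, add_sub_cancel_left]
        _ = R := by ring
    · exact hfR.mono (ball_subset_ball (by linarith))
  · rw [Metric.tendstoUniformlyOn_iff]
    intro ε hε
    have hT : Tendsto (fun n : ℕ => (4 * K * (‖h‖ / (R / 2)) ^ 2) / ((n : ℝ) + 1)) atTop (𝓝 0) :=
      Tendsto.const_div_atTop (tendsto_atTop_add_const_right _ 1 tendsto_natCast_atTop_atTop) _
    filter_upwards [hbig, hT.eventually_lt_const hε] with n hn hn' z hz
    have hsub : ball z (R / 2) ⊆ ball y R := by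
      refine ball_subset_ball' ?_
      rw [mem_ball] at hz
      linarith
    have h1 : (0:ℝ) < n + 1 := by positivity
    have h1' : (n + 1 : ℂ) ≠ 0 := by exact_mod_cast Nat.succ_ne_zero n
    have h2 := norm_taylor_le_of_norm_le hR2 (hfR.mono hsub) (fun w hw => hK w (hsub hw))
      (hsmall n hn)
    rw [dist_comm, dist_eq_norm]
    have e : (n + 1 : ℂ) • (f (z + ((n + 1 : ℂ))⁻¹ • h) - f z) - fderiv ℂ f z h =
        (n + 1 : ℂ) • (f (z + ((n + 1 : ℂ))⁻¹ • h) - f z -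
          fderiv ℂ f z (((n + 1 : ℂ))⁻¹ • h)) := by
      rw [map_smul, smul_sub _ (f _ - f z), smul_smul, mul_inv_cancel₀ h1', one_smul]
    have h3 : ‖(n + 1 : ℂ)‖ = (n + 1 : ℝ) := by
      have := Complex.norm_natCast (n + 1)
      push_cast at this
      exact this
    rw [e, norm_smul, h3]
    refine lt_of_le_of_lt ?_ hn'
    rw [hnorm] at h2
    calc (n + 1 : ℝ) * _ ≤ (n + 1 : ℝ) * (4 * K * (‖h‖ / (n + 1 : ℝ) / (R / 2)) ^ 2) := by gcongr
      _ = (4 * K * (‖h‖ / (R / 2)) ^ 2) / ((n : ℝ) + 1) := by field_simp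

/-- The derivative of a holomorphic map is holomorphic. -/
theorem differentiableOn_fderiv {f : X → F} {U : Set X} (hU : IsOpen U)
    (hf : DifferentiableOn ℂ f U) : DifferentiableOn ℂ (fderiv ℂ f) U := by
  intro y hy
  refine DifferentiableAt.differentiableWithinAt ?_
  obtain ⟨R, hR, K, hRU, hK⟩ := exists_ball_bound hU hf hy
  have hK0 : 0 ≤ K := (norm_nonneg _).trans (hK y (mem_ball_self hR))
  have hfR := hf.mono hRU
  have hR2 : 0 < R / 2 := by positivity
  have hd : ∀ h, DifferentiableOn ℂ (fun z => fderiv ℂ f z h) (ball y (R / 2)) := fun h z hz =>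
    (differentiableAt_fderiv_apply isOpen_ball hfR
      (ball_subset_ball (by linarith) hz) h).differentiableWithinAt
  have hb : ∀ h, ∀ z ∈ ball y (R / 2), ‖fderiv ℂ f z h‖ ≤ 2 * K / (R / 2) * ‖h‖ := by
    intro h z hz
    have hsub : ball z (R / 2) ⊆ ball y R := by
      refine ball_subset_ball' ?_
      rw [mem_ball] at hz
      linarith
    refine ((fderiv ℂ f z).le_opNorm h).trans ?_
    gcongr
    exact norm_fderiv_le_of_norm_le hR2 (hfR.mono hsub) (fun w hw => hK w (hsub hw))
  have hda : ∀ h, DifferentiableAt ℂ (fun z => fderiv ℂ f z h) y := fun h =>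
    (hd h).differentiableAt (ball_mem_nhds _ hR2)
  set C : ℝ := 2 * K / (R / 2) with hC
  have hC0 : 0 ≤ C := by positivity
  let B : X →ₗ[ℂ] X →ₗ[ℂ] F := LinearMap.mk₂ ℂ (fun k h => fderiv ℂ (fun z => fderiv ℂ f z h) y k)
    (fun k k' h => map_add _ _ _) (fun c k h => map_smul _ _ _)
    (fun k h h' => by
      have : (fun z => fderiv ℂ f z (h + h')) = fun z => fderiv ℂ f z h + fderiv ℂ f z h' := by
        ext z; rw [map_add]
      rw [this, fderiv_fun_add (hda h) (hda h')]
      rfl)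
    (fun c k h => by
      have : (fun z => fderiv ℂ f z (c • h)) = fun z => c • fderiv ℂ f z h := by
        ext z; rw [map_smul]
      rw [this, fderiv_fun_const_smul (hda h)]
      rfl)
  let L : X →L[ℂ] X →L[ℂ] F := B.mkContinuous₂ (2 * C / (R / 2)) (fun k h => by
    have h1 := norm_fderiv_le_of_norm_le hR2 (hd h) (hb h)
    calc ‖fderiv ℂ (fun z => fderiv ℂ f z h) y k‖
        ≤ ‖fderiv ℂ (fun z => fderiv ℂ f z h) y‖ * ‖k‖ := ContinuousLinearMap.le_opNorm _ _
      _ ≤ 2 * (C * ‖h‖) / (R / 2) * ‖k‖ := by gcongr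
      _ = 2 * C / (R / 2) * ‖k‖ * ‖h‖ := by ring)
  have hL : ∀ k h, L k h = fderiv ℂ (fun z => fderiv ℂ f z h) y k := fun k h => rfl
  -- The remainder for each fixed direction `h` is quadratic in `z - y` and linear in `‖h‖`, so it
  -- is quadratic in operator norm.
  have hO : (fun z => fderiv ℂ f z - fderiv ℂ f y - L (z - y)) =O[𝓝 y] fun z => ‖z - y‖ ^ 2 := by
    refine Asymptotics.IsBigO.of_bound (4 * C / (R / 2) ^ 2) ?_
    filter_upwards [ball_mem_nhds y hR2] with z hz
    rw [norm_pow, norm_norm]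
    refine ContinuousLinearMap.opNorm_le_bound _ (by positivity) fun h => ?_
    have h1 := norm_taylor_le_of_norm_le (h := z - y) hR2 (hd h) (hb h)
      (by rwa [mem_ball, dist_eq_norm] at hz)
    rw [add_sub_cancel] at h1
    simp only [sub_apply, hL]
    refine h1.trans (le_of_eq ?_)
    field_simp
  have h1 : HasFDerivAt (fun z => fderiv ℂ f z - fderiv ℂ f y - L (z - y)) (0 : X →L[ℂ] X →L[ℂ] F)
      y := hO.hasFDerivAt one_lt_two
  have h2 : HasFDerivAt (fun z => L (z - y) + fderiv ℂ f y) L y := by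
    have h3 : HasFDerivAt (fun z => z - y) (ContinuousLinearMap.id ℂ X) y :=
      (hasFDerivAt_id y).sub_const y
    have := HasFDerivAt.comp (g := L) (f := fun z => z - y) y L.hasFDerivAt h3
    exact (this.add_const _).congr_fderiv (by ext; rfl)
  have h3 := h1.add h2
  refine (h3.congr_of_eventuallyEq (Eventually.of_forall fun z => ?_)).differentiableAt
  simp only [Pi.add_apply]
  abel

end Holomorphic

/-- The induction replaces `F` by `X →L[ℂ] F`, so the universe of the target has to absorb that of
`X`; lifting the target removes this restriction afterwards. -/
theorem contDiffOn_nat_of_differentiableOn {X : Type u} {F : Type (max u v)}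
    [NormedAddCommGroup X] [NormedSpace ℂ X] [NormedAddCommGroup F] [NormedSpace ℂ F]
    [CompleteSpace F] {f : X → F} {U : Set X} (hU : IsOpen U) (hf : DifferentiableOn ℂ f U)
    (n : ℕ) : ContDiffOn ℂ n f U := by
  induction n generalizing F with
  | zero => exact contDiffOn_zero.2 hf.continuousOn
  | succ n ih =>
    push_cast
    rw [contDiffOn_succ_iff_fderiv_of_isOpen hU]
    exact ⟨hf, by simp, ih (differentiableOn_fderiv hU hf)⟩

/-- A holomorphic map from an open subset of a normed space to a Banach space is smooth. -/
theorem contDiffOn_of_differentiableOn {X : Type u} {F : Type v}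
    [NormedAddCommGroup X] [NormedSpace ℂ X] [NormedAddCommGroup F] [NormedSpace ℂ F]
    [CompleteSpace F] {f : X → F} {U : Set X} (hU : IsOpen U) (hf : DifferentiableOn ℂ f U) :
    ContDiffOn ℂ ((⊤ : ℕ∞) : WithTop ℕ∞) f U := by
  rw [contDiffOn_infty]
  intro n
  have e : ULift.{u} F ≃L[ℂ] F := ContinuousLinearEquiv.ulift
  have h1 : DifferentiableOn ℂ (fun x => (e.symm (f x))) U :=
    e.symm.differentiable.comp_differentiableOn hf
  have : CompleteSpace (ULift.{u} F) := inferInstance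
  have h2 := contDiffOn_nat_of_differentiableOn hU h1 n
  have h3 := e.contDiff.comp_contDiffOn (n := n) h2
  refine h3.congr fun x _ => ?_
  simp

/-! ### Spaces of families -/

namespace MonotoneNorm

variable {ι κ : Type*} (N : MonotoneNorm ι) (N' : MonotoneNorm κ)
  {Y : ι → Type*} [∀ i, NormedAddCommGroup (Y i)] [∀ i, NormedSpace ℂ (Y i)]
  {Y' : κ → Type*} [∀ i, NormedAddCommGroup (Y' i)] [∀ i, NormedSpace ℂ (Y' i)]

theorem fam_norm_def (y : N.Fam Y) : ‖y‖ = N.norm (fun i => ((‖y i‖ : ℝ) : ℂ)) := rfl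

variable {N} in
@[simp] theorem fam_add_apply (x y : N.Fam Y) (i : ι) : (x + y) i = x i + y i := rfl

variable {N} in
@[simp] theorem fam_sub_apply (x y : N.Fam Y) (i : ι) : (x - y) i = x i - y i := rfl

variable {N} in
@[simp] theorem fam_smul_apply (c : ℂ) (y : N.Fam Y) (i : ι) : (c • y) i = c • y i := rfl

/-- The member of `N.Fam Y` with given values. -/
def famMk (z : ∀ i, Y i) (hz : z ∈ N.famSubmodule Y) : N.Fam Y :=
  (⟨z, hz⟩ : ↥(N.famSubmodule Y))

@[simp] theorem famMk_apply (z : ∀ i, Y i) (hz : z ∈ N.famSubmodule Y) (i : ι) :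
    N.famMk z hz i = z i := rfl

variable {N} in
theorem fam_ext {x y : N.Fam Y} (h : ∀ i, x i = y i) : x = y := Subtype.ext (funext h)

variable {N} in
theorem fam_mem_of_le {u : ι → ℂ} (hu : u ∈ N.space) {z : ∀ i, Y i} (h : ∀ i, ‖z i‖ ≤ ‖u i‖) :
    z ∈ N.famSubmodule Y ∧ N.norm (fun i => ((‖z i‖ : ℝ) : ℂ)) ≤ N.norm u :=
  N.mono u hu _ fun i => by simpa using h i

variable {N} in
theorem fam_mem_of_le_mul {Z : ι → Type*} [∀ i, NormedAddCommGroup (Z i)]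
    [∀ i, NormedSpace ℂ (Z i)] (y : N.Fam Y) {z : ∀ i, Z i} {C : ℝ} (hC : 0 ≤ C)
    (h : ∀ i, ‖z i‖ ≤ C * ‖y i‖) :
    z ∈ N.famSubmodule Z ∧ N.norm (fun i => ((‖z i‖ : ℝ) : ℂ)) ≤ C * ‖y‖ := by
  have h1 : ((C : ℝ) : ℂ) • (fun i => ((‖y i‖ : ℝ) : ℂ)) ∈ N.space := N.space.smul_mem _ y.2
  have h2 := fam_mem_of_le h1 (z := z) (fun i => by
    simp only [Pi.smul_apply, smul_eq_mul, norm_mul, Complex.norm_real, norm_norm,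
      Real.norm_of_nonneg hC]
    exact h i)
  rw [N.norm_smul _ _ y.2, Complex.norm_real, Real.norm_of_nonneg hC] at h2
  exact h2

/-- The embedding of `N` in the space of bounded families. -/
def BoundedBy (C : ℝ) : Prop := ∀ u ∈ N.space, ∀ i, ‖u i‖ ≤ C * N.norm u

variable {N} in
theorem BoundedBy.norm_apply_le {C : ℝ} (hC : N.BoundedBy C) (y : N.Fam Y) (i : ι) :
    ‖y i‖ ≤ C * ‖y‖ := by
  have := hC _ y.2 i
  rw [fam_norm_def]
  simpa using this

/-- A linear map between spaces of families given by an explicit formula. -/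
def famMap (T : (∀ i, Y i) →ₗ[ℂ] (∀ k, Y' k)) (C : ℝ)
    (hT : ∀ y : N.Fam Y, T y.1 ∈ N'.famSubmodule Y' ∧
      N'.norm (fun k => ((‖T y.1 k‖ : ℝ) : ℂ)) ≤ C * ‖y‖) : N.Fam Y →L[ℂ] N'.Fam Y' :=
  LinearMap.mkContinuous
    { toFun := fun y => N'.famMk (T y.1) (hT y).1
      map_add' := fun x y => Subtype.ext (T.map_add x.1 y.1)
      map_smul' := fun c y => Subtype.ext (T.map_smul c y.1) } C fun y => (hT y).2

theorem norm_famMap_le (T : (∀ i, Y i) →ₗ[ℂ] (∀ k, Y' k)) {C : ℝ} (hC : 0 ≤ C)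
    (hT : ∀ y : N.Fam Y, T y.1 ∈ N'.famSubmodule Y' ∧
      N'.norm (fun k => ((‖T y.1 k‖ : ℝ) : ℂ)) ≤ C * ‖y‖) : ‖famMap N N' T C hT‖ ≤ C :=
  LinearMap.mkContinuous_norm_le _ hC _

variable {Z : ι → Type*} [∀ i, NormedAddCommGroup (Z i)] [∀ i, NormedSpace ℂ (Z i)]

/-- The map between spaces of families that acts as `T i` at the index `i`. -/
def famDiag (T : ∀ i, Y i →L[ℂ] Z i) {C : ℝ} (hC : 0 ≤ C) (hT : ∀ i, ‖T i‖ ≤ C) :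
    N.Fam Y →L[ℂ] N.Fam Z :=
  famMap N N (LinearMap.pi fun i => (T i).toLinearMap ∘ₗ LinearMap.proj i) C fun y =>
    fam_mem_of_le_mul y hC fun i => (T i).le_of_opNorm_le (hT i) (y i)

@[simp] theorem famDiag_apply (T : ∀ i, Y i →L[ℂ] Z i) {C : ℝ} (hC : 0 ≤ C)
    (hT : ∀ i, ‖T i‖ ≤ C) (y : N.Fam Y) (i : ι) : famDiag N T hC hT y i = T i (y i) := rfl

theorem norm_famDiag_le (T : ∀ i, Y i →L[ℂ] Z i) {C : ℝ} (hC : 0 ≤ C) (hT : ∀ i, ‖T i‖ ≤ C) :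
    ‖famDiag N T hC hT‖ ≤ C := norm_famMap_le N N _ hC _

variable {N} in
theorem BoundedBy.tendsto_apply {C : ℝ} (hC : N.BoundedBy C) {y : ℕ → N.Fam Y} {y₀ : N.Fam Y}
    (h : Tendsto y atTop (𝓝 y₀)) (i : ι) : Tendsto (fun n => y n i) atTop (𝓝 (y₀ i)) := by
  rw [tendsto_iff_norm_sub_tendsto_zero] at h ⊢
  refine squeeze_zero (fun n => _root_.norm_nonneg _) (fun n => ?_) (by simpa using h.const_mul C)
  exact hC.norm_apply_le (y n - y₀) i

theorem fam_sum_apply (y : ℕ → N.Fam Y) (n : ℕ) (i : ι) :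
    (∑ k ∈ Finset.range n, y k) i = ∑ k ∈ Finset.range n, y k i := by
  induction n with
  | zero => rfl
  | succ n ih => rw [Finset.sum_range_succ, Finset.sum_range_succ, fam_add_apply, ih]

variable {N} in
/-- Completeness for complex numbers implies completeness for families in Banach spaces. -/
theorem BoundedBy.completeSpace_fam {C : ℝ} (hC : N.BoundedBy C)
    [CompleteSpace (N.Fam fun _ => ℂ)] [∀ i, CompleteSpace (Y i)] : CompleteSpace (N.Fam Y) := by
  refine NormedAddCommGroup.completeSpace_of_summable_imp_tendsto fun u hu => ?_
  -- The scalar families of norms form an absolutely convergent series, whose sum `W` exists by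
  -- completeness for scalars. Evaluation at an index is continuous, so `W i` is the sum of the
  -- norms at `i`, and the tails of `W` dominate those of the vector series.
  set w : ℕ → N.Fam (fun _ => ℂ) := fun k =>
    N.famMk (fun i => ((‖u k i‖ : ℝ) : ℂ)) (fam_mem_of_le (u k).2 fun i => le_rfl).1 with hw
  have hwi : ∀ k i, w k i = ((‖u k i‖ : ℝ) : ℂ) := fun k i => rfl
  have hwn : ∀ k, ‖w k‖ = ‖u k‖ := fun k => by
    rw [fam_norm_def, fam_norm_def]
    simp [hwi]
  have hws : Summable w := Summable.of_norm (by simpa [hwn] using hu)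
  obtain ⟨W, hW⟩ := hws
  have hWt := hW.tendsto_sum_nat
  have hWi : ∀ i, HasSum (fun k => ‖u k i‖) ‖W i‖ := by
    intro i
    have h1 : Summable fun k => ‖u k i‖ := by
      refine Summable.of_nonneg_of_le (fun k => _root_.norm_nonneg _)
        (fun k => hC.norm_apply_le (u k) i) (hu.mul_left C)
    have h2 := hC.tendsto_apply hWt i
    have h3 : Tendsto (fun n => ((∑ k ∈ Finset.range n, ‖u k i‖ : ℝ) : ℂ)) atTop (𝓝 (W i)) := by
      refine h2.congr fun n => ?_
      rw [fam_sum_apply]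
      push_cast
      rfl
    have h4 := h1.hasSum.tendsto_sum_nat.ofReal
    have h5 := tendsto_nhds_unique h3 h4
    have h6 : ‖W i‖ = ∑' k, ‖u k i‖ := by
      rw [h5, Complex.norm_real, Real.norm_of_nonneg (tsum_nonneg fun k => _root_.norm_nonneg _)]
    rw [h6]
    exact h1.hasSum
  have hWe : ∀ i, W i = ((‖W i‖ : ℝ) : ℂ) := by
    intro i
    have h2 := hC.tendsto_apply hWt i
    have h3 : Tendsto (fun n => ((∑ k ∈ Finset.range n, ‖u k i‖ : ℝ) : ℂ)) atTop (𝓝 (W i)) := by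
      refine h2.congr fun n => ?_
      rw [fam_sum_apply]
      push_cast
      rfl
    exact tendsto_nhds_unique h3 ((hWi i).tendsto_sum_nat.ofReal)
  set y : ∀ i, Y i := fun i => ∑' k, u k i with hy
  have hus : ∀ i, Summable fun k => u k i := fun i => Summable.of_norm (hWi i).summable
  have hbound : ∀ n i, ‖y i - ∑ k ∈ Finset.range n, u k i‖ ≤
      ‖(W - ∑ k ∈ Finset.range n, w k) i‖ := by
    intro n i
    have h1 : y i - ∑ k ∈ Finset.range n, u k i = ∑' k, u (k + n) i := by
      have h0 := (hus i).sum_add_tsum_nat_add n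
      rw [sub_eq_iff_eq_add', h0]
    have h2 : Summable fun k => ‖u (k + n) i‖ :=
      (summable_nat_add_iff (f := fun k => ‖u k i‖) n).2 (hWi i).summable
    have h3 := (hWi i).summable.sum_add_tsum_nat_add n
    rw [(hWi i).tsum_eq] at h3
    rw [h1]
    refine (norm_tsum_le_tsum_norm h2).trans ?_
    rw [fam_sub_apply, fam_sum_apply, hWe i]
    simp only [hwi]
    rw [← Complex.ofReal_sum, ← Complex.ofReal_sub, Complex.norm_real]
    refine le_trans (le_of_eq ?_) (Real.le_norm_self _)
    linarith
  have hmem : y ∈ N.famSubmodule Y := by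
    refine (fam_mem_of_le W.2 fun i => ?_).1
    have := hbound 0 i
    simpa using this
  refine ⟨N.famMk y hmem, ?_⟩
  rw [tendsto_iff_norm_sub_tendsto_zero]
  rw [tendsto_iff_norm_sub_tendsto_zero] at hWt
  refine squeeze_zero (fun n => _root_.norm_nonneg _) (fun n => ?_) hWt
  rw [norm_sub_rev, norm_sub_rev _ W]
  refine le_trans (le_of_eq ?_) ((fam_mem_of_le_mul (W - ∑ k ∈ Finset.range n, w k)
    (zero_le_one) (z := fun i => y i - ∑ k ∈ Finset.range n, u k i) (fun i => by
      rw [one_mul]; exact hbound n i)).2.trans (le_of_eq (one_mul _)))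
  rw [fam_norm_def]
  congr 1
  ext i
  rw [fam_sub_apply, fam_sum_apply, famMk_apply]

end MonotoneNorm

/-! ### Weighted supremum norms -/

/-- The norm `sup ‖u_i‖ / w_i`. -/
def supNorm {ι : Type*} (w : ι → ℝ) (hw : ∀ i, 0 < w i) : MonotoneNorm ι where
  space :=
    { carrier := {u | ∃ C : ℝ, ∀ i, ‖u i‖ ≤ C * w i}
      zero_mem' := ⟨0, fun i => by simp⟩
      add_mem' := by
        rintro a b ⟨C, hC⟩ ⟨C', hC'⟩
        refine ⟨C + C', fun i => ?_⟩
        rw [add_mul]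
        exact (norm_add_le _ _).trans (add_le_add (hC i) (hC' i))
      smul_mem' := by
        rintro c a ⟨C, hC⟩
        refine ⟨‖c‖ * C, fun i => ?_⟩
        rw [Pi.smul_apply, norm_smul, mul_assoc]
        exact mul_le_mul_of_nonneg_left (hC i) (norm_nonneg _) }
  norm u := ⨆ i, ‖u i‖ / w i
  norm_add_le := by
    rintro u ⟨C, hC⟩ u' ⟨C', hC'⟩
    have hb : ∀ (u : ι → ℂ) (C : ℝ), (∀ i, ‖u i‖ ≤ C * w i) →
        BddAbove (range fun i => ‖u i‖ / w i) := by
      rintro u C h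
      refine ⟨C, ?_⟩
      rintro _ ⟨i, rfl⟩
      exact (div_le_iff₀ (hw i)).2 (h i)
    refine Real.iSup_le (fun i => ?_) (add_nonneg
      (Real.iSup_nonneg fun i => div_nonneg (norm_nonneg _) (hw i).le)
      (Real.iSup_nonneg fun i => div_nonneg (norm_nonneg _) (hw i).le))
    calc ‖(u + u') i‖ / w i ≤ (‖u i‖ + ‖u' i‖) / w i :=
          div_le_div_of_nonneg_right (norm_add_le _ _) (hw i).le
      _ = ‖u i‖ / w i + ‖u' i‖ / w i := add_div _ _ _
      _ ≤ _ := add_le_add (le_ciSup (hb u C hC) i) (le_ciSup (hb u' C' hC') i)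
  norm_smul a u _ := by
    rw [Real.mul_iSup_of_nonneg (norm_nonneg _)]
    congr 1
    ext i
    rw [Pi.smul_apply, norm_smul, mul_div_assoc]
  eq_zero_of_norm := by
    rintro u ⟨C, hC⟩ h0
    ext i
    have hb : BddAbove (range fun i => ‖u i‖ / w i) := by
      refine ⟨C, ?_⟩
      rintro _ ⟨i, rfl⟩
      exact (div_le_iff₀ (hw i)).2 (hC i)
    have h1 := le_ciSup hb i
    rw [h0, div_le_iff₀ (hw i), zero_mul] at h1
    simpa using h1
  mono := by
    rintro u ⟨C, hC⟩ v hv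
    refine ⟨⟨C, fun i => (hv i).trans (hC i)⟩, ?_⟩
    have hb : BddAbove (range fun i => ‖u i‖ / w i) := by
      refine ⟨C, ?_⟩
      rintro _ ⟨i, rfl⟩
      exact (div_le_iff₀ (hw i)).2 (hC i)
    refine Real.iSup_le (fun i => ?_)
      (Real.iSup_nonneg fun i => div_nonneg (norm_nonneg _) (hw i).le)
    exact (div_le_div_of_nonneg_right (hv i) (hw i).le).trans (le_ciSup hb i)

section SupNorm

variable {ι : Type*} {w : ι → ℝ} (hw : ∀ i, 0 < w i)

theorem supNorm_mem {u : ι → ℂ} {C : ℝ} (h : ∀ i, ‖u i‖ ≤ C * w i) : u ∈ (supNorm w hw).space :=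
  ⟨C, h⟩

theorem supNorm_le {u : ι → ℂ} {C : ℝ} (hC : 0 ≤ C) (h : ∀ i, ‖u i‖ ≤ C * w i) :
    (supNorm w hw).norm u ≤ C :=
  Real.iSup_le (fun i => (div_le_iff₀ (hw i)).2 (h i)) hC

theorem le_supNorm {u : ι → ℂ} (hu : u ∈ (supNorm w hw).space) (i : ι) :
    ‖u i‖ ≤ (supNorm w hw).norm u * w i := by
  obtain ⟨C, hC⟩ := hu
  rw [← div_le_iff₀ (hw i)]
  refine le_ciSup (f := fun i => ‖u i‖ / w i) ⟨C, ?_⟩ i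
  rintro _ ⟨i, rfl⟩
  exact (div_le_iff₀ (hw i)).2 (hC i)

variable {Y : ι → Type*} [∀ i, NormedAddCommGroup (Y i)] [∀ i, NormedSpace ℂ (Y i)]

theorem supNorm_fam_apply_le (y : (supNorm w hw).Fam Y) (i : ι) : ‖y i‖ ≤ ‖y‖ * w i := by
  have := le_supNorm hw y.2 i
  rw [MonotoneNorm.fam_norm_def]
  simpa using this

theorem supNorm_fam_norm_le {y : (supNorm w hw).Fam Y} {C : ℝ} (hC : 0 ≤ C)
    (h : ∀ i, ‖y i‖ ≤ C * w i) : ‖y‖ ≤ C :=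
  supNorm_le hw hC fun i => by simpa using h i

theorem supNorm_fam_mem {y : ∀ i, Y i} {C : ℝ} (h : ∀ i, ‖y i‖ ≤ C * w i) :
    y ∈ (supNorm w hw).famSubmodule Y :=
  ⟨C, fun i => by simpa using h i⟩

theorem supNorm_boundedBy {L : ℝ} (hL : ∀ i, w i ≤ L) : (supNorm w hw).BoundedBy L :=
  fun u hu i => by
    have h1 := le_supNorm hw hu i
    have h2 := (supNorm w hw).norm_nonneg hu
    nlinarith [hL i]

/-- Evaluation at `i` is bounded with constant `w i`, which is enough to sum a series index by
index; no upper bound on the weights is required. -/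
theorem supNorm_completeSpace [∀ i, CompleteSpace (Y i)] :
    CompleteSpace ((supNorm w hw).Fam Y) := by
  refine NormedAddCommGroup.completeSpace_of_summable_imp_tendsto fun u hu => ?_
  have hs : ∀ i, Summable fun k => ‖u k i‖ := fun i =>
    Summable.of_nonneg_of_le (fun k => _root_.norm_nonneg _)
      (fun k => supNorm_fam_apply_le hw (u k) i) (hu.mul_right (w i))
  set y : ∀ i, Y i := fun i => ∑' k, u k i with hy
  have hb : ∀ n i, ‖y i - ∑ k ∈ Finset.range n, u k i‖ ≤ (∑' k, ‖u (k + n)‖) * w i := by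
    intro n i
    have h1 : y i - ∑ k ∈ Finset.range n, u k i = ∑' k, u (k + n) i := by
      have h0 := (Summable.of_norm (hs i)).sum_add_tsum_nat_add n
      rw [sub_eq_iff_eq_add', h0]
    have h2 : Summable fun k => ‖u (k + n) i‖ :=
      (summable_nat_add_iff (f := fun k => ‖u k i‖) n).2 (hs i)
    have h3 : Summable fun k => ‖u (k + n)‖ :=
      (summable_nat_add_iff (f := fun k => ‖u k‖) n).2 hu
    rw [h1, ← tsum_mul_right]
    exact (norm_tsum_le_tsum_norm h2).trans
      (h2.tsum_le_tsum (fun k => supNorm_fam_apply_le hw (u (k + n)) i) (h3.mul_right _))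
  have hmem : y ∈ (supNorm w hw).famSubmodule Y :=
    supNorm_fam_mem hw fun i => by simpa using hb 0 i
  refine ⟨(supNorm w hw).famMk y hmem, ?_⟩
  rw [tendsto_iff_norm_sub_tendsto_zero]
  refine squeeze_zero (fun n => _root_.norm_nonneg _) (fun n => ?_) (tendsto_sum_nat_add fun k => ‖u k‖)
  rw [norm_sub_rev]
  refine supNorm_fam_norm_le hw (tsum_nonneg fun k => _root_.norm_nonneg _) fun i => ?_
  rw [MonotoneNorm.fam_sub_apply, MonotoneNorm.fam_sum_apply]
  exact hb n i

end SupNorm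

/-! ### Holomorphic maps into spaces of families -/

section Superposition

/-- A locally bounded map to a space of bounded continuous functions is holomorphic as soon as its
values at the points are. -/
theorem differentiableAt_boundedContinuousFunction {S Y : Type*} [TopologicalSpace S]
    [NormedAddCommGroup Y] [NormedSpace ℂ Y] {f : Y → (S →ᵇ ℂ)} {y : Y} {R K : ℝ} (hR : 0 < R)
    (hf : ∀ s, DifferentiableOn ℂ (fun z => f z s) (ball y R))
    (hK : ∀ z ∈ ball y R, ‖f z‖ ≤ K) : DifferentiableAt ℂ f y := by
  have hK' : ∀ s, ∀ z ∈ ball y R, ‖f z s‖ ≤ K := fun s z hz =>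
    ((f z).norm_coe_le_norm s).trans (hK z hz)
  have hK0 : 0 ≤ K := (norm_nonneg _).trans (hK y (mem_ball_self hR))
  have hda : ∀ s, DifferentiableAt ℂ (fun z => f z s) y := fun s =>
    (hf s).differentiableAt (ball_mem_nhds _ hR)
  have hb : ∀ s h, ‖fderiv ℂ (fun z => f z s) y h‖ ≤ 2 * K / R * ‖h‖ := fun s h =>
    ((fderiv ℂ (fun z => f z s) y).le_opNorm h).trans (by
      gcongr
      exact norm_fderiv_le_of_norm_le hR (hf s) (hK' s))
  -- The pointwise derivatives must form a continuous function of `s`. They are uniform limits of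
  -- difference quotients, which are continuous in `s` because the values of `f` are.
  have hcont : ∀ h, Continuous fun s => fderiv ℂ (fun z => f z s) y h := by
    intro h
    refine continuous_of_uniform_approx_of_continuous fun U hU => ?_
    obtain ⟨ε, hε, hεU⟩ := Metric.mem_uniformity_dist.1 hU
    obtain ⟨τ, hτ0, hτ1, hτ2⟩ : ∃ τ : ℝ, 0 < τ ∧ τ * ‖h‖ < R ∧ 4 * K * (‖h‖ / R) ^ 2 * τ < ε := by
      have h1 : Tendsto (fun τ : ℝ => τ * ‖h‖) (𝓝 0) (𝓝 0) := by
        have : Continuous fun τ : ℝ => τ * ‖h‖ := by fun_prop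
        simpa using this.tendsto 0
      have h2 : Tendsto (fun τ : ℝ => 4 * K * (‖h‖ / R) ^ 2 * τ) (𝓝 0) (𝓝 0) := by
        have : Continuous fun τ : ℝ => 4 * K * (‖h‖ / R) ^ 2 * τ := by fun_prop
        simpa using this.tendsto 0
      have h3 := (h1.eventually_lt_const hR).and (h2.eventually_lt_const hε)
      have h4 : ∀ᶠ τ in 𝓝[>] (0:ℝ), τ * ‖h‖ < R ∧ 4 * K * (‖h‖ / R) ^ 2 * τ < ε :=
        h3.filter_mono nhdsWithin_le_nhds
      obtain ⟨τ, hτ, hτ'⟩ := (h4.and self_mem_nhdsWithin).exists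
      exact ⟨τ, hτ', hτ.1, hτ.2⟩
    refine ⟨fun s => (τ : ℂ)⁻¹ • (f (y + (τ : ℂ) • h) s - f y s), by fun_prop, fun s => hεU ?_⟩
    have hτn : ‖(τ : ℂ) • h‖ = τ * ‖h‖ := by
      rw [norm_smul, Complex.norm_real, Real.norm_of_nonneg hτ0.le]
    have hτc : (τ : ℂ) ≠ 0 := by exact_mod_cast hτ0.ne'
    have h1 := norm_taylor_le_of_norm_le (h := (τ : ℂ) • h) hR (hf s) (hK' s) (by rwa [hτn])
    have e : fderiv ℂ (fun z => f z s) y h - (τ : ℂ)⁻¹ • (f (y + (τ : ℂ) • h) s - f y s) =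
        -((τ : ℂ)⁻¹ • (f (y + (τ : ℂ) • h) s - f y s - fderiv ℂ (fun z => f z s) y ((τ : ℂ) • h))) := by
      rw [map_smul, smul_sub _ (f _ s - f y s), smul_smul, inv_mul_cancel₀ hτc, one_smul]
      abel
    rw [dist_eq_norm, e, norm_neg, norm_smul, norm_inv, Complex.norm_real,
      Real.norm_of_nonneg hτ0.le]
    refine lt_of_le_of_lt ?_ hτ2
    rw [hτn] at h1
    calc τ⁻¹ * _ ≤ τ⁻¹ * (4 * K * (τ * ‖h‖ / R) ^ 2) := by gcongr
      _ = 4 * K * (‖h‖ / R) ^ 2 * τ := by field_simp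
  let L : Y →L[ℂ] (S →ᵇ ℂ) := LinearMap.mkContinuous
    { toFun := fun h => BoundedContinuousFunction.ofNormedAddCommGroup
        (fun s => fderiv ℂ (fun z => f z s) y h) (hcont h) (2 * K / R * ‖h‖) fun s => hb s h
      map_add' := fun h h' => by ext s; exact (fderiv ℂ (fun z => f z s) y).map_add h h'
      map_smul' := fun c h => by ext s; exact (fderiv ℂ (fun z => f z s) y).map_smul c h } (2 * K / R) fun h =>
    BoundedContinuousFunction.norm_ofNormedAddCommGroup_le _ (by positivity) fun s => hb s h
  have hL : ∀ h s, L h s = fderiv ℂ (fun z => f z s) y h := fun h s => rfl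
  have hO : (fun z => f z - f y - L (z - y)) =O[𝓝 y] fun z => ‖z - y‖ ^ 2 := by
    refine Asymptotics.IsBigO.of_bound (4 * K / R ^ 2) ?_
    filter_upwards [ball_mem_nhds y hR] with z hz
    rw [norm_pow, norm_norm, BoundedContinuousFunction.norm_le (by positivity)]
    intro s
    have h1 := norm_taylor_le_of_norm_le (h := z - y) hR (hf s) (hK' s)
      (by rwa [mem_ball, dist_eq_norm] at hz)
    rw [add_sub_cancel] at h1
    simp only [BoundedContinuousFunction.coe_sub, Pi.sub_apply, hL]
    refine h1.trans (le_of_eq ?_)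
    field_simp
  have h1 : HasFDerivAt (fun z => f z - f y - L (z - y)) (0 : Y →L[ℂ] (S →ᵇ ℂ)) y :=
    hO.hasFDerivAt one_lt_two
  have h2 : HasFDerivAt (fun z => L (z - y) + f y) L y := by
    have h3 : HasFDerivAt (fun z => z - y) (ContinuousLinearMap.id ℂ Y) y :=
      (hasFDerivAt_id y).sub_const y
    have := HasFDerivAt.comp (g := L) (f := fun z => z - y) y L.hasFDerivAt h3
    exact (this.add_const _).congr_fderiv (by ext; rfl)
  refine ((h1.add h2).congr_of_eventuallyEq (Eventually.of_forall fun z => ?_)).differentiableAt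
  simp only [Pi.add_apply]
  abel

/-- Superposition operators between spaces of families are holomorphic. -/
theorem MonotoneNorm.BoundedBy.exists_superposition {ι : Type*} {N : MonotoneNorm ι} {C : ℝ}
    (hC : N.BoundedBy C) (hC0 : 0 ≤ C) {Y W : ι → Type*} [∀ i, NormedAddCommGroup (Y i)]
    [∀ i, NormedSpace ℂ (Y i)] [∀ i, NormedAddCommGroup (W i)] [∀ i, NormedSpace ℂ (W i)]
    {F : ∀ i, Y i → W i} {R K δ : ℝ} (hR : 0 < R) (hK0 : 0 ≤ K)
    (hF : ∀ i, DifferentiableOn ℂ (F i) (ball 0 R)) (hK : ∀ i, ∀ z ∈ ball 0 R, ‖F i z‖ ≤ K)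
    (hδ : C * δ ≤ R / 2) :
    ∃ Φ : N.Fam Y → N.Fam W, DifferentiableOn ℂ Φ (ball 0 δ) ∧
      ∀ y ∈ ball 0 δ, ∀ i, Φ y i = F i (y i) - F i 0 := by
  classical
  have hR2 : 0 < R / 2 := by positivity
  have hy : ∀ y : N.Fam Y, ‖y‖ < δ → ∀ i, ‖y i‖ ≤ R / 2 := fun y hy i =>
    (hC.norm_apply_le y i).trans ((mul_le_mul_of_nonneg_left hy.le hC0).trans hδ)
  -- The constant `F i 0` need not be in the space, only its differences are. Monotonicity turns
  -- this uniform Lipschitz bound, with `6 = 4 + 2` from the quadratic and linear terms, into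
  -- membership.
  have hlip : ∀ i, ∀ z ∈ ball (0 : Y i) R, ‖F i z - F i 0‖ ≤ 6 * K / R * ‖z‖ := by
    intro i z hz
    rw [mem_ball_zero_iff] at hz
    have h1 := norm_taylor_le_of_norm_le hR (hF i) (hK i) hz
    have h2 := (fderiv ℂ (F i) 0).le_of_opNorm_le (norm_fderiv_le_of_norm_le hR (hF i) (hK i)) z
    rw [zero_add] at h1
    have h3 : 4 * K * (‖z‖ / R) ^ 2 ≤ 4 * K / R * ‖z‖ := by
      have : (‖z‖ / R) ^ 2 ≤ ‖z‖ / R := by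
        have h4 : ‖z‖ / R ≤ 1 := (div_le_one hR).2 hz.le
        have h5 : 0 ≤ ‖z‖ / R := by positivity
        nlinarith
      calc 4 * K * (‖z‖ / R) ^ 2 ≤ 4 * K * (‖z‖ / R) := by gcongr
        _ = _ := by ring
    have h6 := _root_.norm_add_le (F i z - F i 0 - fderiv ℂ (F i) 0 z) (fderiv ℂ (F i) 0 z)
    rw [sub_add_cancel] at h6
    calc _ ≤ 4 * K / R * ‖z‖ + 2 * K / R * ‖z‖ := by linarith
      _ = _ := by ring
  have hmem : ∀ y : N.Fam Y, ‖y‖ < δ → (fun i => F i (y i) - F i 0) ∈ N.famSubmodule W :=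
    fun y hyδ => (MonotoneNorm.fam_mem_of_le_mul y (C := 6 * K / R) (by positivity) fun i =>
      hlip i _ (by rw [mem_ball_zero_iff]; linarith [hy y hyδ i])).1
  set Φ : N.Fam Y → N.Fam W := fun y =>
    if h : (fun i => F i (y i) - F i 0) ∈ N.famSubmodule W then N.famMk _ h else 0 with hΦ
  have hΦa : ∀ y : N.Fam Y, ‖y‖ < δ → ∀ i, Φ y i = F i (y i) - F i 0 := by
    intro y hyδ i
    simp only [hΦ]
    rw [dif_pos (hmem y hyδ)]
    rfl
  refine ⟨Φ, fun y hyb => DifferentiableAt.differentiableWithinAt ?_, fun y hyb =>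
    hΦa y (by simpa using hyb)⟩
  rw [mem_ball_zero_iff] at hyb
  have hsub : ∀ i, ball (y i) (R / 2) ⊆ ball 0 R := fun i => ball_subset_ball' (by
    rw [dist_zero_right]; linarith [hy y hyb i])
  have hFi : ∀ i, DifferentiableOn ℂ (F i) (ball (y i) (R / 2)) := fun i => (hF i).mono (hsub i)
  have hKi : ∀ i, ∀ z ∈ ball (y i) (R / 2), ‖F i z‖ ≤ K := fun i z hz => hK i z (hsub i hz)
  set L := MonotoneNorm.famDiag N (fun i => fderiv ℂ (F i) (y i)) (C := 2 * K / (R / 2))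
    (by positivity) (fun i => norm_fderiv_le_of_norm_le hR2 (hFi i) (hKi i)) with hL
  have hO : (fun z => Φ z - Φ y - L (z - y)) =O[𝓝 y] fun z => ‖z - y‖ ^ 2 := by
    refine Asymptotics.IsBigO.of_bound (4 * K / (R / 2) ^ 2 * C) ?_
    have h1 : ∀ᶠ z in 𝓝 y, ‖z‖ < δ :=
      (continuous_norm.tendsto y).eventually_lt_const hyb
    have h2 : ∀ᶠ z in 𝓝 y, C * ‖z - y‖ < R / 2 := by
      have : Continuous fun z : N.Fam Y => C * ‖z - y‖ := by fun_prop
      have h3 := this.tendsto y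
      rw [sub_self, _root_.norm_zero, mul_zero] at h3
      exact h3.eventually_lt_const hR2
    filter_upwards [h1, h2] with z hz1 hz2
    rw [norm_pow, norm_norm]
    -- In the quadratic remainder one factor `‖(z - y) i‖` is bounded by `C * ‖z - y‖` through the
    -- embedding in bounded families. The other is kept, so that the norm `N` controls the family of
    -- remainders.
    have hpt : ∀ i, ‖(Φ z - Φ y - L (z - y)) i‖ ≤
        4 * K / (R / 2) ^ 2 * C * ‖z - y‖ * ‖(z - y) i‖ := by
      intro i
      have h4 := hC.norm_apply_le (z - y) i
      have h5 := norm_taylor_le_of_norm_le (h := (z - y) i) hR2 (hFi i) (hKi i) (by linarith)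
      have e : y i + (z - y) i = z i := by
        rw [MonotoneNorm.fam_sub_apply]; abel
      rw [e] at h5
      have e2 : (Φ z - Φ y - L (z - y)) i =
          F i (z i) - F i (y i) - fderiv ℂ (F i) (y i) ((z - y) i) := by
        rw [MonotoneNorm.fam_sub_apply, MonotoneNorm.fam_sub_apply, hΦa z hz1, hΦa y hyb]
        rw [hL, MonotoneNorm.famDiag_apply]
        abel
      rw [e2]
      refine h5.trans ?_
      calc 4 * K * (‖(z - y) i‖ / (R / 2)) ^ 2
          = 4 * K / (R / 2) ^ 2 * ‖(z - y) i‖ * ‖(z - y) i‖ := by field_simp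
        _ ≤ 4 * K / (R / 2) ^ 2 * (C * ‖z - y‖) * ‖(z - y) i‖ := by gcongr
        _ = _ := by ring
    have h6 := (MonotoneNorm.fam_mem_of_le_mul (z - y) (by positivity) hpt).2
    calc ‖Φ z - Φ y - L (z - y)‖ ≤ 4 * K / (R / 2) ^ 2 * C * ‖z - y‖ * ‖z - y‖ := h6
      _ = _ := by ring
  have h1 : HasFDerivAt (fun z => Φ z - Φ y - L (z - y)) (0 : N.Fam Y →L[ℂ] N.Fam W) y :=
    hO.hasFDerivAt one_lt_two
  have h2 : HasFDerivAt (fun z => L (z - y) + Φ y) L y := by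
    have h3 : HasFDerivAt (fun z => z - y) (ContinuousLinearMap.id ℂ (N.Fam Y)) y :=
      (hasFDerivAt_id y).sub_const y
    have := HasFDerivAt.comp (g := L) (f := fun z => z - y) y L.hasFDerivAt h3
    exact (this.add_const _).congr_fderiv (by ext; rfl)
  refine ((h1.add h2).congr_of_eventuallyEq (Eventually.of_forall fun z => ?_)).differentiableAt
  simp only [Pi.add_apply]
  abel

end Superposition

/-- The supremum norm. -/
abbrev boundedNorm (ι : Type*) : MonotoneNorm ι := supNorm (fun _ => 1) fun _ => one_pos

/-! ### Bounded families, bilinear actions and the linear fixed-point equation -/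

section Bilinear

variable {ι : Type*}

theorem boundedNorm_apply_le {Y : ι → Type*} [∀ i, NormedAddCommGroup (Y i)]
    [∀ i, NormedSpace ℂ (Y i)] (y : (boundedNorm ι).Fam Y) (i : ι) : ‖y i‖ ≤ ‖y‖ := by
  simpa using supNorm_fam_apply_le (fun _ => one_pos) y i

theorem boundedNorm_norm_le {Y : ι → Type*} [∀ i, NormedAddCommGroup (Y i)]
    [∀ i, NormedSpace ℂ (Y i)] {y : (boundedNorm ι).Fam Y} {C : ℝ} (hC : 0 ≤ C)
    (h : ∀ i, ‖y i‖ ≤ C) : ‖y‖ ≤ C :=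
  supNorm_fam_norm_le (fun _ => one_pos) hC fun i => by simpa using h i

theorem boundedNorm_mem {Y : ι → Type*} [∀ i, NormedAddCommGroup (Y i)]
    [∀ i, NormedSpace ℂ (Y i)] {y : ∀ i, Y i} {C : ℝ} (h : ∀ i, ‖y i‖ ≤ C) :
    y ∈ (boundedNorm ι).famSubmodule Y :=
  supNorm_fam_mem (fun _ => one_pos) (C := C) fun i => by simpa using h i

variable (N : MonotoneNorm ι) {P Q R : ι → Type*} [∀ i, NormedAddCommGroup (P i)]
  [∀ i, NormedSpace ℂ (P i)] [∀ i, NormedAddCommGroup (Q i)] [∀ i, NormedSpace ℂ (Q i)]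
  [∀ i, NormedAddCommGroup (R i)] [∀ i, NormedSpace ℂ (R i)]

theorem fam_bilinear_bound (b : ∀ i, P i →L[ℂ] Q i →L[ℂ] R i) {C : ℝ} (hC : 0 ≤ C)
    (hb : ∀ i, ‖b i‖ ≤ C) (p : N.Fam P) (q : (boundedNorm ι).Fam Q) (i : ι) :
    ‖b i (p i) (q i)‖ ≤ C * ‖q‖ * ‖p i‖ := by
  refine ((b i).le_opNorm₂ _ _).trans ?_
  have h1 := boundedNorm_apply_le q i
  have h2 := hb i
  calc ‖b i‖ * ‖p i‖ * ‖q i‖ ≤ C * ‖p i‖ * ‖q‖ := by gcongr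
    _ = _ := by ring

/-- Pointwise bilinear maps act on families, the second one being bounded only. -/
def famBilinear (b : ∀ i, P i →L[ℂ] Q i →L[ℂ] R i) {C : ℝ} (hC : 0 ≤ C)
    (hb : ∀ i, ‖b i‖ ≤ C) : N.Fam P →L[ℂ] (boundedNorm ι).Fam Q →L[ℂ] N.Fam R :=
  LinearMap.mkContinuous₂
    (LinearMap.mk₂ ℂ (fun p q => N.famMk (fun i => b i (p i) (q i))
        (MonotoneNorm.fam_mem_of_le_mul p (by positivity) (fam_bilinear_bound N b hC hb p q)).1)
      (fun p p' q => MonotoneNorm.fam_ext fun i => by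
        simp only [MonotoneNorm.famMk_apply, MonotoneNorm.fam_add_apply, map_add, add_apply])
      (fun c p q => MonotoneNorm.fam_ext fun i => by
        simp only [MonotoneNorm.famMk_apply, MonotoneNorm.fam_smul_apply, map_smul, smul_apply])
      (fun p q q' => MonotoneNorm.fam_ext fun i => by
        simp only [MonotoneNorm.famMk_apply, MonotoneNorm.fam_add_apply, map_add])
      (fun c p q => MonotoneNorm.fam_ext fun i => by
        simp only [MonotoneNorm.famMk_apply, MonotoneNorm.fam_smul_apply, map_smul]))
    C fun p q => by
      have h := (MonotoneNorm.fam_mem_of_le_mul p (by positivity) (fam_bilinear_bound N b hC hb p q)).2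
      calc _ ≤ C * ‖q‖ * ‖p‖ := h
        _ = _ := by ring

variable {N} in
/-- The inclusion in the space of bounded families. -/
def MonotoneNorm.BoundedBy.toBounded {C : ℝ} (hC : N.BoundedBy C) (hC0 : 0 ≤ C) (P : ι → Type*)
    [∀ i, NormedAddCommGroup (P i)] [∀ i, NormedSpace ℂ (P i)] :
    N.Fam P →L[ℂ] (boundedNorm ι).Fam P :=
  MonotoneNorm.famMap N (boundedNorm ι) LinearMap.id C fun y =>
    ⟨boundedNorm_mem fun i => hC.norm_apply_le y i,
      supNorm_le _ (by positivity) fun i => by simpa using hC.norm_apply_le y i⟩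

end Bilinear

/-- If `‖A y‖ < 1` then the solution of `d = A y d + R y α` is a smooth function of `(y, α)`. -/
theorem contDiffOn_inverse_one_sub {𝒴 𝒜 𝓑 : Type*} [NormedAddCommGroup 𝒴] [NormedSpace ℂ 𝒴]
    [NormedAddCommGroup 𝒜] [NormedSpace ℂ 𝒜] [NormedAddCommGroup 𝓑] [NormedSpace ℂ 𝓑]
    [CompleteSpace 𝓑] {A : 𝒴 → 𝓑 →L[ℂ] 𝓑} {R : 𝒴 → 𝒜 →L[ℂ] 𝓑} {U : Set 𝒴} (hU : IsOpen U)
    (hA : DifferentiableOn ℂ A U) (hR : DifferentiableOn ℂ R U) (hA1 : ∀ y ∈ U, ‖A y‖ < 1) :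
    ∃ D : 𝒴 × 𝒜 → 𝓑, ContDiffOn ℂ ((⊤ : ℕ∞) : WithTop ℕ∞) D (U ×ˢ univ) ∧
      ∀ y ∈ U, ∀ α, D (y, α) = A y (D (y, α)) + R y α := by
  refine ⟨fun x => Ring.inverse (1 - A x.1) (R x.1 x.2),
    contDiffOn_of_differentiableOn (hU.prod isOpen_univ) ?_, ?_⟩
  · rintro ⟨y, α⟩ ⟨hy, -⟩
    refine DifferentiableAt.differentiableWithinAt ?_
    have h1 : DifferentiableAt ℂ (fun x : 𝒴 × 𝒜 => A x.1) (y, α) :=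
      (hA.differentiableAt (hU.mem_nhds hy)).comp (y, α) differentiableAt_fst
    have h2 : DifferentiableAt ℂ (fun x : 𝒴 × 𝒜 => R x.1) (y, α) :=
      (hR.differentiableAt (hU.mem_nhds hy)).comp (y, α) differentiableAt_fst
    have h3 : DifferentiableAt ℂ (fun x : 𝒴 × 𝒜 => 1 - A x.1) (y, α) :=
      (differentiableAt_const _).sub h1
    have h4 : DifferentiableAt ℂ Ring.inverse (1 - A y) :=
      differentiableAt_inverse (Units.oneSub (A y) (hA1 y hy)).isUnit
    have h5 : DifferentiableAt ℂ (fun x : 𝒴 × 𝒜 => Ring.inverse (1 - A x.1)) (y, α) :=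
      DifferentiableAt.comp (g := Ring.inverse) (y, α) h4 h3
    exact h5.clm_apply (h2.clm_apply differentiableAt_snd)
  · intro y hy α
    have h1 : IsUnit (1 - A y) := (Units.oneSub (A y) (hA1 y hy)).isUnit
    have h2 := congrArg (fun T : 𝓑 →L[ℂ] 𝓑 => T (R y α)) (Ring.mul_inverse_cancel _ h1)
    simp only [mul_apply_eq_comp, one_apply_eq_self, sub_apply] at h2
    rw [sub_eq_iff_eq_add'] at h2
    exact h2

/-- The solution of a fixed point equation given by a kernel `k` and a source `b` that depend
holomorphically on a parameter. -/
theorem MonotoneNorm.BoundedBy.exists_smooth_solution {E 𝒴 B P : Type*} {N : MonotoneNorm E} {C : ℝ}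
    (hC : N.BoundedBy C) (hC0 : 0 ≤ C) [CompleteSpace (N.Fam fun _ => ℂ)]
    [NormedAddCommGroup 𝒴] [NormedSpace ℂ 𝒴] [NormedAddCommGroup B] [NormedSpace ℂ B]
    [CompleteSpace B] [NormedAddCommGroup P] [NormedSpace ℂ P]
    (J : P →L[ℂ] B →L[ℂ] B) (Q : (E → B) →ₗ[ℂ] (E → B))
    (QN : N.Fam (fun _ => B) →L[ℂ] N.Fam (fun _ => B)) (hQN : ∀ ψ e, QN ψ e = Q ψ.1 e)
    (Qi : (boundedNorm E).Fam (fun _ => B) →L[ℂ] (boundedNorm E).Fam (fun _ => B))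
    (hQi : ∀ ψ e, Qi ψ e = Q ψ.1 e)
    (X : (boundedNorm E).Fam (fun _ => ℂ) →L[ℂ] (boundedNorm E).Fam (fun _ => B))
    {k : E → P} {b : E → B} {M : ℝ} (hb : ∀ e, ‖b e‖ ≤ M)
    {DK : 𝒴 → N.Fam (fun _ => P)} {Db : 𝒴 → N.Fam (fun _ => B)} {U : Set 𝒴} (hU : IsOpen U)
    (hDK : DifferentiableOn ℂ DK U) (hDb : DifferentiableOn ℂ Db U) {q : ℝ} (hq : 0 ≤ q)
    (hk : ∀ e, ‖J (k e)‖ ≤ q) (hkD : ∀ y ∈ U, ∀ e, ‖J (k e + DK y e)‖ ≤ q)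
    (hqN : q * ‖QN‖ < 1) (hqi : q * ‖Qi‖ < 1) :
    ∃ (Ψ : (boundedNorm E).Fam (fun _ => ℂ) → (boundedNorm E).Fam (fun _ => B))
      (D : 𝒴 × (boundedNorm E).Fam (fun _ => ℂ) → N.Fam (fun _ => B)),
      ContDiffOn ℂ ((⊤ : ℕ∞) : WithTop ℕ∞) D (U ×ˢ univ) ∧
      (∀ α e, Ψ α e = α e • b e + J (k e) (Q (Ψ α).1 e + X α e)) ∧
      ∀ y ∈ U, ∀ α e, Ψ α e + D (y, α) e = α e • (b e + Db y e) +
        J (k e + DK y e) (Q (fun e => Ψ α e + D (y, α) e) e + X α e) := by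
  have : CompleteSpace (N.Fam fun _ => B) := hC.completeSpace_fam
  have : CompleteSpace ((boundedNorm E).Fam fun _ => B) := supNorm_completeSpace _
  set Ai := MonotoneNorm.famDiag (boundedNorm E) (fun e => J (k e)) hq hk with hAi
  set bi : (boundedNorm E).Fam (fun _ => B) := (boundedNorm E).famMk b (boundedNorm_mem hb) with hbi
  set sm := famBilinear N (Q := fun _ => ℂ) (fun _ : E => (ContinuousLinearMap.lsmul ℂ ℂ :
    ℂ →L[ℂ] B →L[ℂ] B).flip) zero_le_one (fun _ => by
      rw [ContinuousLinearMap.opNorm_flip]; exact ContinuousLinearMap.opNorm_lsmul_le) with hsm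
  set smi := famBilinear (boundedNorm E) (Q := fun _ => ℂ) (fun _ : E => (ContinuousLinearMap.lsmul ℂ ℂ :
    ℂ →L[ℂ] B →L[ℂ] B).flip) zero_le_one (fun _ => by
      rw [ContinuousLinearMap.opNorm_flip]; exact ContinuousLinearMap.opNorm_lsmul_le) with hsmi
  set act := famBilinear N (fun _ : E => J) (_root_.norm_nonneg J) (fun _ => le_rfl) with hact
  have hAiQ : ‖Ai ∘L Qi‖ < 1 := by
    refine lt_of_le_of_lt ((ContinuousLinearMap.opNorm_comp_le _ _).trans ?_) hqi
    gcongr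
    exact MonotoneNorm.norm_famDiag_le _ _ hq hk
  -- The central solution lives among bounded families only, because the source `α` is just bounded;
  -- it is obtained by a Neumann series.
  set Ψ : (boundedNorm E).Fam (fun _ => ℂ) →L[ℂ] (boundedNorm E).Fam (fun _ => B) :=
    Ring.inverse (1 - Ai ∘L Qi) ∘L (smi bi + Ai ∘L X) with hΨ
  have hΨeq : ∀ α, Ψ α = smi bi α + Ai (X α) + Ai (Qi (Ψ α)) := by
    intro α
    have h1 : IsUnit (1 - Ai ∘L Qi) := (Units.oneSub (Ai ∘L Qi) hAiQ).isUnit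
    have h2 := congrArg (fun T : (boundedNorm E).Fam (fun _ => B) →L[ℂ]
      (boundedNorm E).Fam (fun _ => B) => T ((smi bi + Ai ∘L X) α)) (Ring.mul_inverse_cancel _ h1)
    simp only [mul_apply_eq_comp, one_apply_eq_self, sub_apply] at h2
    rw [sub_eq_iff_eq_add] at h2
    exact h2
  have hΨe : ∀ α e, Ψ α e = α e • b e + J (k e) (Q (Ψ α).1 e + X α e) := by
    intro α e
    have h1 : Ψ α e = α e • b e + J (k e) (X α e) + J (k e) (Qi (Ψ α) e) :=
      congrArg (fun ψ : (boundedNorm E).Fam (fun _ => B) => ψ e) (hΨeq α)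
    rw [h1, hQi, map_add]
    abel
  set A : 𝒴 → N.Fam (fun _ => B) →L[ℂ] N.Fam (fun _ => B) := fun y =>
    (MonotoneNorm.famDiag N (fun e => J (k e)) hq hk + act (DK y) ∘L hC.toBounded hC0 _) ∘L QN
    with hA
  -- Subtracting the central equation leaves this source for the difference. `Db y` and `DK y` are
  -- in `N` and are paired with the bounded families `α` and `Q Ψ + X α`, so the product is in `N`.
  set R : 𝒴 → (boundedNorm E).Fam (fun _ => ℂ) →L[ℂ] N.Fam (fun _ => B) := fun y =>
    sm (Db y) + act (DK y) ∘L (Qi ∘L Ψ + X) with hR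
  have hAd : DifferentiableOn ℂ A U := by
    have h1 : DifferentiableOn ℂ (fun y => act (DK y)) U :=
      act.differentiable.comp_differentiableOn hDK
    exact ((differentiableOn_const _).add (h1.clm_comp (differentiableOn_const _))).clm_comp
      (differentiableOn_const _)
  have hRd : DifferentiableOn ℂ R U := by
    have h1 : DifferentiableOn ℂ (fun y => act (DK y)) U :=
      act.differentiable.comp_differentiableOn hDK
    have h2 : DifferentiableOn ℂ (fun y => sm (Db y)) U :=
      sm.differentiable.comp_differentiableOn hDb
    exact h2.add (h1.clm_comp (differentiableOn_const _))
  have hA1 : ∀ y ∈ U, ‖A y‖ < 1 := by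
    intro y hy
    refine lt_of_le_of_lt ((ContinuousLinearMap.opNorm_comp_le _ _).trans ?_) hqN
    gcongr
    -- The central operator plus its perturbation is diagonal with the perturbed kernels, so its
    -- norm is bounded by `q` rather than by a sum of two norms.
    have : MonotoneNorm.famDiag N (fun e => J (k e)) hq hk + act (DK y) ∘L hC.toBounded hC0 _ =
        MonotoneNorm.famDiag N (fun e => J (k e + DK y e)) hq (hkD y hy) := by
      ext1 ψ
      refine MonotoneNorm.fam_ext fun e => ?_
      change J (k e) (ψ e) + J (DK y e) (ψ e) = J (k e + DK y e) (ψ e)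
      rw [map_add]
      rfl
    rw [this]
    exact MonotoneNorm.norm_famDiag_le _ _ hq _
  obtain ⟨D, hD1, hD2⟩ := contDiffOn_inverse_one_sub hU hAd hRd hA1
  refine ⟨Ψ, D, hD1, hΨe, fun y hy α e => ?_⟩
  have h1 : D (y, α) e = (J (k e) (QN (D (y, α)) e) + J (DK y e) (QN (D (y, α)) e)) +
      (α e • Db y e + J (DK y e) (Qi (Ψ α) e + X α e)) :=
    congrArg (fun ψ : N.Fam (fun _ => B) => ψ e) (hD2 y hy α)
  have h2 : Q (fun e => Ψ α e + D (y, α) e) e = Q (Ψ α).1 e + Q (D (y, α)).1 e :=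
    congrFun (Q.map_add (Ψ α).1 (D (y, α)).1) e
  rw [hQN, hQi] at h1
  rw [h2, h1, hΨe α e, smul_add]
  have h3 : Ψ α e = α e • b e + J (k e) (Q (Ψ α).1 e + X α e) := hΨe α e
  simp only [map_add, add_apply]
  abel

end Traizet

namespace Traizet

open Metric Set Filter
open Complex (I)

/-! ### Contributions of the edges to a differential -/

/-- The residue of the Cauchy integral of `ψ`. -/
def layerResidue (r : ℝ) (ψ : ℝ → ℂ) : ℂ :=
  (2 * Real.pi * I)⁻¹ * ∫ θ in (0:ℝ)..(2 * Real.pi), circleMap 0 r θ * I * ψ θ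

/-- The Cauchy integral of `ψ` minus its principal part at infinity. -/
def regPart (a : ℂ) (r : ℝ) (ψ : ℝ → ℂ) (z : ℂ) : ℂ :=
  (z - a)⁻¹ * cauchyExt a r (fun θ => circleMap 0 r θ * ψ θ) z

section RegPart

variable {a : ℂ} {r M : ℝ} {ψ ψ' : ℝ → ℂ}

theorem continuous_cauchy_integrand (hψ : Continuous ψ) {z : ℂ} (hz : ‖z - a‖ ≠ |r|) :
    Continuous fun θ => (circleMap 0 r θ * I * ψ θ) * (z - circleMap a r θ)⁻¹ := by
  have h0 : ∀ θ, z - circleMap a r θ ≠ 0 := by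
    intro θ h
    have h1 := norm_circleMap_sub_ge (a := a) (z := z) (r := r) θ
    rw [h, norm_zero] at h1
    exact hz (sub_eq_zero.1 (abs_eq_zero.1 (le_antisymm h1 (abs_nonneg _))))
  have h1 : Continuous fun θ => z - circleMap a r θ := by fun_prop
  have h2 : Continuous fun θ => circleMap 0 r θ * I * ψ θ := by fun_prop
  exact h2.mul (h1.inv₀ h0)

/-- From `1/(z - w) = 1/(z - a) + (w - a)/((z - a)(z - w))` under the integral sign. -/
theorem cauchyExt_eq (hψ : Continuous ψ) {z : ℂ} (hr : 0 < r) (hz : r < ‖z - a‖) :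
    cauchyExt a r ψ z = regPart a r ψ z + layerResidue r ψ * (z - a)⁻¹ := by
  have hz' : ‖z - a‖ ≠ |r| := by rw [abs_of_pos hr]; exact hz.ne'
  have hza : z - a ≠ 0 := norm_pos_iff.1 (hr.trans hz)
  unfold regPart layerResidue cauchyExt
  have h1 := continuous_cauchy_integrand (ψ := fun θ => circleMap 0 r θ * ψ θ) (by fun_prop) hz'
  have h2 : Continuous fun θ => circleMap 0 r θ * I * ψ θ := by fun_prop
  have h3 : Continuous fun θ => circleMap 0 r θ * I * (circleMap 0 r θ * ψ θ) *
      (z - circleMap a r θ)⁻¹ * (z - a)⁻¹ := h1.mul continuous_const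
  have h4 : Continuous fun θ => circleMap 0 r θ * I * ψ θ * (z - a)⁻¹ := h2.mul continuous_const
  rw [mul_left_comm (z - a)⁻¹, mul_comm (z - a)⁻¹, mul_assoc (2 * Real.pi * I : ℂ)⁻¹ _ (z - a)⁻¹,
    ← mul_add, ← intervalIntegral.integral_mul_const,
    ← intervalIntegral.integral_mul_const, ← intervalIntegral.integral_add
(h3.intervalIntegrable _ _)
      (h4.intervalIntegrable _ _)]
  congr 1
  refine intervalIntegral.integral_congr fun θ _ => ?_
  have h0 : z - circleMap a r θ ≠ 0 := by
    intro h
    have h1 := norm_circleMap_sub_ge (a := a) (z := z) (r := r) θ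
    rw [h, norm_zero] at h1
    exact hz' (sub_eq_zero.1 (abs_eq_zero.1 (le_antisymm h1 (abs_nonneg _))))
  have e : circleMap a r θ = a + circleMap 0 r θ := by simp [circleMap]
  rw [e] at h0 ⊢
  field_simp
  ring

theorem cauchyExt_add (hψ : Continuous ψ) (hψ' : Continuous ψ') {z : ℂ} (hz : ‖z - a‖ ≠ |r|) :
    cauchyExt a r (fun θ => ψ θ + ψ' θ) z = cauchyExt a r ψ z + cauchyExt a r ψ' z := by
  unfold cauchyExt
  rw [← mul_add, ← intervalIntegral.integral_add
    ((continuous_cauchy_integrand hψ hz).intervalIntegrable _ _)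
    ((continuous_cauchy_integrand hψ' hz).intervalIntegrable _ _)]
  congr 2
  ext θ
  ring

theorem cauchyExt_const_mul (c z : ℂ) :
    cauchyExt a r (fun θ => c * ψ θ) z = c * cauchyExt a r ψ z := by
  unfold cauchyExt
  rw [mul_left_comm c]
  congr 1
  rw [← intervalIntegral.integral_const_mul]
  congr 1
  funext θ
  ring

theorem regPart_add (hψ : Continuous ψ) (hψ' : Continuous ψ') {z : ℂ} (hr : 0 < r)
    (hz : r < ‖z - a‖) :
    regPart a r (fun θ => ψ θ + ψ' θ) z = regPart a r ψ z + regPart a r ψ' z := by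
  have hz' : ‖z - a‖ ≠ |r| := by rw [abs_of_pos hr]; exact hz.ne'
  unfold regPart
  rw [← mul_add, ← cauchyExt_add (by fun_prop) (by fun_prop) hz']
  congr 2
  funext θ
  ring

theorem regPart_const_mul (c z : ℂ) :
    regPart a r (fun θ => c * ψ θ) z = c * regPart a r ψ z := by
  unfold regPart
  rw [mul_left_comm c, ← cauchyExt_const_mul (ψ := fun θ => circleMap 0 r θ * ψ θ) c z]
  congr 2
  funext θ
  simp only
  ring

theorem differentiableAt_regPart (hψ : Continuous ψ) (hr : 0 < r) {z : ℂ} (hz : r < ‖z - a‖) :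
    DifferentiableAt ℂ (regPart a r ψ) z := by
  have hz' : ‖z - a‖ ≠ |r| := by rw [abs_of_pos hr]; exact hz.ne'
  have hza : z - a ≠ 0 := norm_pos_iff.1 (hr.trans hz)
  exact ((differentiableAt_id.sub_const a).inv hza).mul
    (differentiableAt_cauchyExt (by fun_prop) hz')

/-- One factor `‖z - a‖⁻¹` is explicit; the Cauchy integral gives another, the distance from `z` to
the circle being at least `‖z - a‖ / 2`. The resulting quadratic decay makes the form holomorphic at
infinity for every `ψ`. -/
theorem norm_regPart_le (hr : 0 < r) (hM : ∀ θ, ‖ψ θ‖ ≤ M) {z : ℂ} (hz : 2 * r ≤ ‖z - a‖) :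
    ‖regPart a r ψ z‖ ≤ 2 * r ^ 2 * M / ‖z - a‖ ^ 2 := by
  have hza : 0 < ‖z - a‖ := by linarith
  have h1 := norm_cauchyExt_le (ψ := fun θ => circleMap 0 r θ * ψ θ) (M := r * M)
    (d := ‖z - a‖ / 2) hr.le (fun θ => by
      rw [norm_mul, norm_circleMap_zero, abs_of_pos hr]
      exact mul_le_mul_of_nonneg_left (hM θ) hr.le) (by positivity) (by linarith : _ ≤ ‖z - a‖)
  unfold regPart
  rw [norm_mul, norm_inv]
  calc ‖z - a‖⁻¹ * _ ≤ ‖z - a‖⁻¹ * (r * (r * M) / (‖z - a‖ / 2)) := by gcongr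
    _ = _ := by field_simp

theorem norm_regPart_le' (hr : 0 < r) (hM : ∀ θ, ‖ψ θ‖ ≤ M) {z : ℂ} (hz : 2 * r ≤ ‖z - a‖) :
    ‖regPart a r ψ z‖ ≤ M := by
  have hM0 : 0 ≤ M := (norm_nonneg _).trans (hM 0)
  refine (norm_regPart_le hr hM hz).trans ?_
  have hza : 0 < ‖z - a‖ := by linarith
  rw [div_le_iff₀ (by positivity)]
  have : 2 * r ^ 2 ≤ ‖z - a‖ ^ 2 := by nlinarith
  nlinarith

theorem holomorphicAtInfty_regPart (hψ : Continuous ψ) (hr : 0 < r) (hM : ∀ θ, ‖ψ θ‖ ≤ M) :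
    HolomorphicAtInfty (regPart a r ψ) := by
  have hM0 : 0 ≤ M := (norm_nonneg _).trans (hM 0)
  have hb : ∀ z, 2 * ‖a‖ + 4 * r < ‖z‖ → ‖z‖ / 2 ≤ ‖z - a‖ ∧ 2 * r < ‖z - a‖ := by
    intro z hz
    have h1 := norm_sub_norm_le z a
    have := norm_nonneg a
    constructor <;> linarith
  refine holomorphicAtInfty_of_norm_le (R := 2 * ‖a‖ + 4 * r) (C := 8 * r ^ 2 * M) (by positivity)
    (fun z hz => differentiableAt_regPart hψ hr (by linarith [(hb z hz).2])) fun z hz => ?_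
  refine (norm_regPart_le hr hM (hb z hz).2.le).trans ?_
  have h0 : 0 < ‖z‖ := by have := norm_nonneg a; linarith
  have h2 : (‖z‖ / 2) ^ 2 ≤ ‖z - a‖ ^ 2 := by
    gcongr
    exact (hb z hz).1
  calc 2 * r ^ 2 * M / ‖z - a‖ ^ 2 ≤ 2 * r ^ 2 * M / (‖z‖ / 2) ^ 2 := by gcongr
    _ = _ := by field_simp; ring

end RegPart

theorem HolomorphicAtInfty.zero : HolomorphicAtInfty 0 := ⟨0, analyticAt_const, by simp⟩

theorem HolomorphicAtInfty.sum {ι : Type*} {f : ι → ℂ → ℂ} {s : Finset ι}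
    (h : ∀ i ∈ s, HolomorphicAtInfty (f i)) : HolomorphicAtInfty fun z => ∑ i ∈ s, f i z := by
  classical
  induction s using Finset.induction_on with
  | empty =>
    simp only [Finset.sum_empty]
    exact HolomorphicAtInfty.zero
  | insert i s hi ih =>
    simp only [Finset.sum_insert hi]
    exact (h i (Finset.mem_insert_self _ _)).add
      (ih fun j hj => h j (Finset.mem_insert_of_mem hj))

/-! ### Half-edges -/

namespace Graph

variable {V E : Type*} (G : Graph V E)

theorem finite_halfEdges (v : V) : {h : E × Bool | G.endpt h.1 h.2 = v}.Finite := by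
  refine ((G.finite_edges v).prod (finite_univ (α := Bool))).subset ?_
  rintro ⟨e, s⟩ h
  cases s
  · exact ⟨Or.inl h, mem_univ _⟩
  · exact ⟨Or.inr h, mem_univ _⟩

/-- The ends of edges that are attached to a vertex. -/
def halfEdges (v : V) : Finset (E × Bool) := (G.finite_halfEdges v).toFinset

variable {G} in
@[simp] theorem mem_halfEdges {v : V} {h : E × Bool} :
    h ∈ G.halfEdges v ↔ G.endpt h.1 h.2 = v := by simp [halfEdges]

/-- The factor `2` is for loops, both of whose ends are attached to the vertex. -/
theorem sum_halfEdges_le (v : V) {u : E → ℝ} (hu : ∀ e, 0 ≤ u e) :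
    ∑ h ∈ G.halfEdges v, u h.1 ≤ 2 * ∑ᶠ e ∈ G.edgesAt v, u e := by
  have hfin : (G.edgesAt v).Finite := G.finite_edges v
  rw [finsum_mem_eq_finite_toFinset_sum _ hfin]
  calc ∑ h ∈ G.halfEdges v, u h.1 ≤ ∑ h ∈ hfin.toFinset ×ˢ (Finset.univ : Finset Bool), u h.1 := by
        refine Finset.sum_le_sum_of_subset_of_nonneg ?_ fun h _ _ => hu h.1
        rintro ⟨e, s⟩ h
        rw [mem_halfEdges] at h
        rw [Finset.mem_product, Finite.mem_toFinset]
        cases s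
        · exact ⟨Or.inl h, Finset.mem_univ _⟩
        · exact ⟨Or.inr h, Finset.mem_univ _⟩
    _ = _ := by
        rw [Finset.sum_product]
        simp [Finset.mul_sum, two_mul]

theorem _root_.Traizet.finsum_mem_norm_nonneg {ι Y : Type*} [SeminormedAddCommGroup Y] (s : Set ι)
    (u : ι → Y) : 0 ≤ ∑ᶠ i ∈ s, ‖u i‖ :=
  finsum_nonneg fun _ => finsum_nonneg fun _ => norm_nonneg _

/-- The two incidence operators are bounded by `K`. -/
structure Incidence (NE : MonotoneNorm E) (NV : MonotoneNorm V) (K : ℝ) : Prop where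
  nonneg : 0 ≤ K
  edges_to_vertices : ∀ α ∈ NE.space,
    (fun v => ((∑ᶠ e ∈ G.edgesAt v, ‖α e‖ : ℝ) : ℂ)) ∈ NV.space ∧
      NV.norm (fun v => ((∑ᶠ e ∈ G.edgesAt v, ‖α e‖ : ℝ) : ℂ)) ≤ K * NE.norm α
  vertices_to_edges : ∀ u ∈ NV.space,
    (fun e => ((‖u (G.src e)‖ + ‖u (G.tgt e)‖ : ℝ) : ℂ)) ∈ NE.space ∧
      NE.norm (fun e => ((‖u (G.src e)‖ + ‖u (G.tgt e)‖ : ℝ) : ℂ)) ≤ K * NV.norm u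

variable {G} in
theorem AdmissibleNorms.exists_incidence {NE : MonotoneNorm E} {NV : MonotoneNorm V}
    (h : G.AdmissibleNorms NE NV) : ∃ K, G.Incidence NE NV K := by
  obtain ⟨K, hK⟩ := h.edges_to_vertices
  obtain ⟨K', hK'⟩ := h.vertices_to_edges
  refine ⟨max 0 (max K K'), le_max_left _ _, fun α hα => ⟨(hK α hα).1, (hK α hα).2.trans ?_⟩,
    fun u hu => ⟨(hK' u hu).1, (hK' u hu).2.trans ?_⟩⟩
  · exact mul_le_mul_of_nonneg_right ((le_max_left _ _).trans (le_max_right _ _))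
      (NE.norm_nonneg hα)
  · exact mul_le_mul_of_nonneg_right ((le_max_right _ _).trans (le_max_right _ _))
      (NV.norm_nonneg hu)

theorem finsum_edgesAt_le {k : ℕ} (hk : ∀ v, (G.edgesAt v).encard ≤ k) (v : V) {u : E → ℝ} {c : ℝ}
    (hc : 0 ≤ c) (hu : ∀ e ∈ G.edgesAt v, u e ≤ c) : ∑ᶠ e ∈ G.edgesAt v, u e ≤ k * c := by
  have hfin : (G.edgesAt v).Finite := G.finite_edges v
  rw [finsum_mem_eq_finite_toFinset_sum _ hfin]
  refine (Finset.sum_le_card_nsmul _ _ c fun e he => hu e (by simpa using he)).trans ?_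
  rw [nsmul_eq_mul]
  gcongr
  have h1 := hk v
  rw [hfin.encard_eq_coe_toFinset_card] at h1
  exact_mod_cast h1

/-- Weighted supremum norms satisfy the incidence bounds if the weights of neighbours are
comparable. -/
theorem supNorm_incidence {k : ℕ} (hk : ∀ v, (G.edgesAt v).encard ≤ k) {w : E → ℝ} {w' : V → ℝ}
    (hw : ∀ e, 0 < w e) (hw' : ∀ v, 0 < w' v) {L : ℝ} (hL : 0 ≤ L)
    (h1 : ∀ e s, w e ≤ L * w' (G.endpt e s)) (h2 : ∀ e s, w' (G.endpt e s) ≤ L * w e) :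
    G.Incidence (supNorm w hw) (supNorm w' hw') ((k + 2) * L) := by
  -- One constant serves both operators: at most `k` edges meet at a vertex, and an edge has two
  -- endpoints.
  have hE : ∀ α ∈ (supNorm w hw).space, ∀ v, ‖((∑ᶠ e ∈ G.edgesAt v, ‖α e‖ : ℝ) : ℂ)‖ ≤
      (k + 2) * L * (supNorm w hw).norm α * w' v := by
    intro α hα v
    have h0 := (supNorm w hw).norm_nonneg hα
    rw [Complex.norm_real, Real.norm_of_nonneg
      (finsum_mem_norm_nonneg _ _)]
    refine (G.finsum_edgesAt_le hk v (c := (supNorm w hw).norm α * (L * w' v))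
      (by have := (hw' v).le; positivity) fun e he => ?_).trans ?_
    · refine (le_supNorm hw hα e).trans (mul_le_mul_of_nonneg_left ?_ h0)
      rcases he with he | he
      · have := h1 e false
        simpa [endpt, he] using this
      · have := h1 e true
        simpa [endpt, he] using this
    · have : 0 ≤ (supNorm w hw).norm α * (L * w' v) := by have := (hw' v).le; positivity
      nlinarith
  have hV : ∀ u ∈ (supNorm w' hw').space, ∀ e, ‖((‖u (G.src e)‖ + ‖u (G.tgt e)‖ : ℝ) : ℂ)‖ ≤
      (k + 2) * L * (supNorm w' hw').norm u * w e := by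
    intro u hu e
    have h0 := (supNorm w' hw').norm_nonneg hu
    rw [Complex.norm_real, Real.norm_of_nonneg (by positivity)]
    have h3 := le_supNorm hw' hu (G.src e)
    have h4 := le_supNorm hw' hu (G.tgt e)
    have h5 : (supNorm w' hw').norm u * w' (G.src e) ≤ (supNorm w' hw').norm u * (L * w e) :=
      mul_le_mul_of_nonneg_left (h2 e false) h0
    have h6 : (supNorm w' hw').norm u * w' (G.tgt e) ≤ (supNorm w' hw').norm u * (L * w e) :=
      mul_le_mul_of_nonneg_left (h2 e true) h0
    have h7 : 0 ≤ (k : ℝ) * ((supNorm w' hw').norm u * (L * w e)) := by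
      have := (hw e).le; positivity
    nlinarith
  refine ⟨by positivity, fun α hα => ⟨supNorm_mem hw' (hE α hα), supNorm_le hw' ?_ (hE α hα)⟩,
    fun u hu => ⟨supNorm_mem hw (hV u hu), supNorm_le hw ?_ (hV u hu)⟩⟩
  · have := (supNorm w hw).norm_nonneg hα
    positivity
  · have := (supNorm w' hw').norm_nonneg hu
    positivity

variable {G}

theorem Incidence.vertex_bound {NE : MonotoneNorm E} {NV : MonotoneNorm V} {K : ℝ}
    (hK : G.Incidence NE NV K) {Y : E → Type*} [∀ e, NormedAddCommGroup (Y e)]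
    [∀ e, NormedSpace ℂ (Y e)] {W : V → Type*} [∀ v, NormedAddCommGroup (W v)]
    [∀ v, NormedSpace ℂ (W v)] (y : NE.Fam Y) {f : ∀ v, W v} {C : ℝ} (hC : 0 ≤ C)
    (h : ∀ v, ‖f v‖ ≤ C * ∑ i ∈ G.halfEdges v, ‖y i.1‖) :
    f ∈ NV.famSubmodule W ∧ NV.norm (fun v => ((‖f v‖ : ℝ) : ℂ)) ≤ 2 * C * K * ‖y‖ := by
  obtain ⟨h1, h2⟩ := hK.edges_to_vertices _ y.2
  simp only [Complex.norm_real, norm_norm] at h1 h2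
  have h3 := MonotoneNorm.fam_mem_of_le (NV.space.smul_mem ((2 * C : ℝ) : ℂ) h1) (z := f)
    fun v => by
      rw [Pi.smul_apply, smul_eq_mul, ← Complex.ofReal_mul, Complex.norm_real,
        Real.norm_of_nonneg (mul_nonneg (by positivity)
          (finsum_nonneg fun _ => finsum_nonneg fun _ => norm_nonneg _))]
      refine (h v).trans ?_
      have := G.sum_halfEdges_le v (u := fun e => ‖y e‖) fun e => norm_nonneg _
      nlinarith
  refine ⟨h3.1, h3.2.trans ?_⟩
  rw [NV.norm_smul _ _ h1, Complex.norm_real, Real.norm_of_nonneg (by positivity), mul_assoc (2 * C)]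
  gcongr
  exact h2

/-- The incidence operators are applied in succession, from edges to vertices and back, so a
dependence on the adjacent edges stays bounded in the edge norm. -/
theorem Incidence.edge_bound {NE : MonotoneNorm E} {NV : MonotoneNorm V} {K : ℝ}
    (hK : G.Incidence NE NV K) {Y : E → Type*} [∀ e, NormedAddCommGroup (Y e)]
    [∀ e, NormedSpace ℂ (Y e)] {W : E → Type*} [∀ e, NormedAddCommGroup (W e)]
    [∀ e, NormedSpace ℂ (W e)] (y : NE.Fam Y) {x : ∀ e, W e} {C : ℝ} (hC : 0 ≤ C)
    (h : ∀ e, ‖x e‖ ≤ C * (∑ i ∈ G.halfEdges (G.src e), ‖y i.1‖ +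
      ∑ i ∈ G.halfEdges (G.tgt e), ‖y i.1‖)) :
    x ∈ NE.famSubmodule W ∧ NE.norm (fun e => ((‖x e‖ : ℝ) : ℂ)) ≤ K * (2 * C * K * ‖y‖) := by
  have hS : ∀ v, 0 ≤ C * ∑ i ∈ G.halfEdges v, ‖y i.1‖ := fun v =>
    mul_nonneg hC (Finset.sum_nonneg fun i _ => norm_nonneg _)
  obtain ⟨h1, h2⟩ := hK.vertex_bound y (W := fun _ => ℂ) hC
    (f := fun v => ((C * ∑ i ∈ G.halfEdges v, ‖y i.1‖ : ℝ) : ℂ)) fun v => by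
      rw [Complex.norm_real, Real.norm_of_nonneg (hS v)]
  obtain ⟨h3, h4⟩ := hK.vertices_to_edges _ h1
  have h5 := MonotoneNorm.fam_mem_of_le h3 (z := x) fun e => by
    refine (h e).trans (le_of_eq ?_)
    simp only [Complex.norm_real, norm_norm]
    rw [Real.norm_of_nonneg (hS _), Real.norm_of_nonneg (hS _), Real.norm_of_nonneg
      (add_nonneg (hS _) (hS _))]
    ring
  exact ⟨h5.1, h5.2.trans (h4.trans (mul_le_mul_of_nonneg_left h2 hK.nonneg))⟩

end Graph

/-! ### Layers -/

/-- Pairs of bounded continuous functions on the two circles attached to an edge. -/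
abbrev Layer : Type := (Bool × ℝ) →ᵇ ℂ

/-- Kernels of integral operators acting on layers. -/
abbrev LayerKernel : Type := (Bool × ℝ × ℝ) →ᵇ ℂ

theorem Layer.continuous_side (ψ : Layer) (s : Bool) : Continuous fun θ => ψ (s, θ) := by fun_prop

theorem Layer.norm_side_le (ψ : Layer) (s : Bool) (θ : ℝ) : ‖ψ (s, θ)‖ ≤ ‖ψ‖ :=
  ψ.norm_coe_le_norm _

theorem continuous_kernel_integral (k : LayerKernel) (x : Layer) :
    Continuous fun y : Bool × ℝ =>
      ∫ θ' in (0:ℝ)..(2 * Real.pi), k (y.1, y.2, θ') * x (!y.1, θ') := by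
  rw [continuous_prod_of_discrete_left]
  intro s
  exact intervalIntegral.continuous_parametric_intervalIntegral_of_continuous' (by fun_prop) _ _

theorem norm_kernel_integral_le (k : LayerKernel) (x : Layer) (y : Bool × ℝ) :
    ‖∫ θ' in (0:ℝ)..(2 * Real.pi), k (y.1, y.2, θ') * x (!y.1, θ')‖ ≤
      2 * Real.pi * ‖k‖ * ‖x‖ := by
  have h := intervalIntegral.norm_integral_le_of_norm_le_const (a := (0:ℝ)) (b := 2 * Real.pi)
    (f := fun θ' => k (y.1, y.2, θ') * x (!y.1, θ')) (C := ‖k‖ * ‖x‖) fun θ _ => by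
      rw [norm_mul]
      gcongr
      · exact k.norm_coe_le_norm _
      · exact x.norm_coe_le_norm _
  rw [sub_zero, abs_of_pos Real.two_pi_pos] at h
  linarith

/-- The integral operator with a given kernel. -/
def kernelAct : LayerKernel →L[ℂ] Layer →L[ℂ] Layer :=
  LinearMap.mkContinuous₂
    (LinearMap.mk₂ ℂ (fun k x => BoundedContinuousFunction.ofNormedAddCommGroup _
        (continuous_kernel_integral k x) _ (norm_kernel_integral_le k x))
      (fun k k' x => by
        ext y
        simp only [BoundedContinuousFunction.coe_ofNormedAddCommGroup,
          BoundedContinuousFunction.coe_add, Pi.add_apply, add_mul]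
        exact intervalIntegral.integral_add (Continuous.intervalIntegrable (by fun_prop) _ _)
          (Continuous.intervalIntegrable (by fun_prop) _ _))
      (fun c k x => by
        ext y
        simp only [BoundedContinuousFunction.coe_ofNormedAddCommGroup,
          BoundedContinuousFunction.coe_smul, smul_eq_mul, mul_assoc,
          intervalIntegral.integral_const_mul])
      (fun k x x' => by
        ext y
        simp only [BoundedContinuousFunction.coe_ofNormedAddCommGroup,
          BoundedContinuousFunction.coe_add, Pi.add_apply, mul_add]
        exact intervalIntegral.integral_add (Continuous.intervalIntegrable (by fun_prop) _ _)
          (Continuous.intervalIntegrable (by fun_prop) _ _))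
      (fun c k x => by
        ext y
        simp only [BoundedContinuousFunction.coe_ofNormedAddCommGroup,
          BoundedContinuousFunction.coe_smul, smul_eq_mul, mul_left_comm _ c,
          intervalIntegral.integral_const_mul]))
    (2 * Real.pi) fun k x => BoundedContinuousFunction.norm_ofNormedAddCommGroup_le _
      (by have := Real.pi_pos; positivity) (norm_kernel_integral_le k x)

@[simp] theorem kernelAct_apply (k : LayerKernel) (x : Layer) (s : Bool) (θ : ℝ) :
    kernelAct k x (s, θ) = ∫ θ' in (0:ℝ)..(2 * Real.pi), k (s, θ, θ') * x (!s, θ') := rfl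

theorem norm_kernelAct_le (k : LayerKernel) : ‖kernelAct k‖ ≤ 2 * Real.pi * ‖k‖ :=
  ContinuousLinearMap.opNorm_le_bound _ (by have := Real.pi_pos; positivity) fun x =>
    BoundedContinuousFunction.norm_ofNormedAddCommGroup_le _
      (by have := Real.pi_pos; positivity) (norm_kernel_integral_le k x)

/-! ### Sums over the ends of edges at a vertex, and their traces on circles -/

section Sums

variable {V E : Type*} (G : Graph V E) (p₀ : E → Bool → ℂ) (ε : ℝ)

/-- The centres of the disks attached to a vertex are far from each other. -/
structure Graph.Separated : Prop where
  pos : 0 < ε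
  sep : ∀ h h' : E × Bool, G.endpt h.1 h.2 = G.endpt h'.1 h'.2 → h ≠ h' →
    2 * ε ≤ ‖p₀ h.1 h.2 - p₀ h'.1 h'.2‖

/-- The coefficient of the polar part of a differential with periods `α`. -/
def edgeCoeff (α : E → ℂ) (h : E × Bool) : ℂ :=
  (2 * Real.pi * I)⁻¹ * (if h.2 then α h.1 else -α h.1)

/-- The sum of the regular parts of the layers around a vertex. -/
def regSum (ψ : E → Layer) (v : V) (z : ℂ) : ℂ :=
  ∑ h ∈ G.halfEdges v, regPart (p₀ h.1 h.2) (ε / 4) (fun θ => ψ h.1 (h.2, θ)) z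

/-- The sum of the polar parts around a vertex. -/
def polSum (α : E → ℂ) (v : V) (z : ℂ) : ℂ :=
  ∑ h ∈ G.halfEdges v, edgeCoeff α h * (z - p₀ h.1 h.2)⁻¹

theorem norm_edgeCoeff_le (α : E → ℂ) (h : E × Bool) : ‖edgeCoeff α h‖ ≤ ‖α h.1‖ := by
  have h1 : ‖(2 * Real.pi * I : ℂ)‖⁻¹ ≤ 1 := by
    have : ‖(2 * Real.pi * I : ℂ)‖ = 2 * Real.pi := by simp [abs_of_pos Real.pi_pos]
    rw [this]
    exact inv_le_one_of_one_le₀ (by linarith [Real.pi_gt_three])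
  have h2 : ‖(if h.2 then α h.1 else -α h.1)‖ = ‖α h.1‖ := by split <;> simp
  rw [edgeCoeff, norm_mul, norm_inv, h2]
  exact mul_le_of_le_one_left (norm_nonneg _) h1

variable {G p₀ ε}

theorem regSum_add {ψ ψ' : E → Layer} {v : V} {z : ℂ} (hε : 0 < ε)
    (hz : ∀ h ∈ G.halfEdges v, ε / 4 < ‖z - p₀ h.1 h.2‖) :
    regSum G p₀ ε (ψ + ψ') v z = regSum G p₀ ε ψ v z + regSum G p₀ ε ψ' v z := by
  unfold regSum
  rw [← Finset.sum_add_distrib]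
  exact Finset.sum_congr rfl fun h hh =>
    regPart_add ((ψ h.1).continuous_side _) ((ψ' h.1).continuous_side _) (by positivity) (hz h hh)

theorem regSum_smul (c : ℂ) (ψ : E → Layer) (v : V) (z : ℂ) :
    regSum G p₀ ε (c • ψ) v z = c * regSum G p₀ ε ψ v z := by
  unfold regSum
  rw [Finset.mul_sum]
  exact Finset.sum_congr rfl fun h _ => regPart_const_mul c z

theorem norm_regSum_le (ψ : E → Layer) {v : V} {z : ℂ} (hε : 0 < ε)
    (hz : ∀ h ∈ G.halfEdges v, ε / 2 ≤ ‖z - p₀ h.1 h.2‖) :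
    ‖regSum G p₀ ε ψ v z‖ ≤ ∑ h ∈ G.halfEdges v, ‖ψ h.1‖ :=
  (norm_sum_le _ _).trans (Finset.sum_le_sum fun h hh =>
    norm_regPart_le' (by positivity) ((ψ h.1).norm_side_le _) (by linarith [hz h hh]))

theorem differentiableAt_regSum (ψ : E → Layer) {v : V} {z : ℂ} (hε : 0 < ε)
    (hz : ∀ h ∈ G.halfEdges v, ε / 4 < ‖z - p₀ h.1 h.2‖) :
    DifferentiableAt ℂ (regSum G p₀ ε ψ v) z :=
  DifferentiableAt.fun_sum fun h hh =>
    differentiableAt_regPart ((ψ h.1).continuous_side _) (by positivity) (hz h hh)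

theorem holomorphicAtInfty_regSum (ψ : E → Layer) (v : V) (hε : 0 < ε) :
    HolomorphicAtInfty (regSum G p₀ ε ψ v) :=
  HolomorphicAtInfty.sum fun h _ =>
    holomorphicAtInfty_regPart ((ψ h.1).continuous_side _) (by positivity) ((ψ h.1).norm_side_le _)

theorem polSum_add (α α' : E → ℂ) (v : V) (z : ℂ) :
    polSum G p₀ (α + α') v z = polSum G p₀ α v z + polSum G p₀ α' v z := by
  unfold polSum
  rw [← Finset.sum_add_distrib]
  refine Finset.sum_congr rfl fun h _ => ?_
  simp only [edgeCoeff, Pi.add_apply]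
  split <;> ring

theorem polSum_smul (c : ℂ) (α : E → ℂ) (v : V) (z : ℂ) :
    polSum G p₀ (c • α) v z = c * polSum G p₀ α v z := by
  unfold polSum
  rw [Finset.mul_sum]
  refine Finset.sum_congr rfl fun h _ => ?_
  simp only [edgeCoeff, Pi.smul_apply, smul_eq_mul]
  split <;> ring

theorem norm_polSum_le (α : E → ℂ) {v : V} {z : ℂ} (hε : 0 < ε)
    (hz : ∀ h ∈ G.halfEdges v, ε / 2 ≤ ‖z - p₀ h.1 h.2‖) :
    ‖polSum G p₀ α v z‖ ≤ 2 / ε * ∑ h ∈ G.halfEdges v, ‖α h.1‖ := by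
  rw [Finset.mul_sum]
  refine (norm_sum_le _ _).trans (Finset.sum_le_sum fun h hh => ?_)
  rw [norm_mul, norm_inv, mul_comm]
  have h1 : ‖z - p₀ h.1 h.2‖⁻¹ ≤ 2 / ε := by
    rw [← inv_div]
    exact inv_anti₀ (by positivity) (hz h hh)
  gcongr
  exact norm_edgeCoeff_le α h

theorem differentiableAt_polSum (α : E → ℂ) {v : V} {z : ℂ}
    (hz : ∀ h ∈ G.halfEdges v, z ≠ p₀ h.1 h.2) :
    DifferentiableAt ℂ (polSum G p₀ α v) z :=
  DifferentiableAt.fun_sum fun h hh =>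
    (differentiableAt_const _).mul ((differentiableAt_id.sub_const _).inv (sub_ne_zero.2 (hz h hh)))

/-- A point at distance `d ≤ ε` from one centre is at distance at least `2 * ε - d ≥ d` from every
other centre at that vertex. -/
theorem Graph.Separated.le_norm_sub (hG : G.Separated p₀ ε) {h : E × Bool} {z : ℂ} {d : ℝ}
    (hd : d ≤ ε) (hz : ‖z - p₀ h.1 h.2‖ = d) {h' : E × Bool}
    (hh' : h' ∈ G.halfEdges (G.endpt h.1 h.2)) : d ≤ ‖z - p₀ h'.1 h'.2‖ := by
  by_cases hhh : h' = h
  · rw [hhh, hz]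
  · have h1 := hG.sep h' h (Graph.mem_halfEdges.1 hh') hhh
    have h2 : ‖p₀ h'.1 h'.2 - p₀ h.1 h.2‖ ≤ ‖z - p₀ h.1 h.2‖ + ‖z - p₀ h'.1 h'.2‖ := by
      have := norm_sub_le (z - p₀ h.1 h.2) (z - p₀ h'.1 h'.2)
      rwa [sub_sub_sub_cancel_left] at this
    linarith

theorem Graph.Separated.le_norm_circleMap_sub (hG : G.Separated p₀ ε) (e : E) (s : Bool) (θ : ℝ)
    {h : E × Bool} (hh : h ∈ G.halfEdges (G.endpt e s)) :
    ε / 2 ≤ ‖circleMap (p₀ e s) (ε / 2) θ - p₀ h.1 h.2‖ :=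
  hG.le_norm_sub (h := (e, s)) (by linarith [hG.pos])
    (by simp [circleMap, abs_of_pos hG.pos]) hh

theorem continuous_circle_trace {f : V → ℂ → ℂ} {r : ℝ}
    (hf : ∀ e s θ, ContinuousAt (f (G.endpt e s)) (circleMap (p₀ e s) r θ)) (e : E) :
    Continuous fun x : Bool × ℝ => f (G.endpt e x.1) (circleMap (p₀ e x.1) r x.2) := by
  rw [continuous_prod_of_discrete_left]
  intro s
  refine continuous_iff_continuousAt.2 fun θ => ?_
  exact ContinuousAt.comp (g := f (G.endpt e s)) (f := fun θ => circleMap (p₀ e s) r θ) (hf e s θ)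
    (by fun_prop)

theorem sum_endpt_le (u : V → ℝ) (hu : ∀ v, 0 ≤ u v) (e : E) (s : Bool) :
    u (G.endpt e s) ≤ u (G.src e) + u (G.tgt e) := by
  cases s
  · exact le_add_of_nonneg_right (hu _)
  · exact le_add_of_nonneg_left (hu _)

theorem norm_traceReg_le (hG : G.Separated p₀ ε) (ψ : E → Layer) (e : E) (x : Bool × ℝ) :
    ‖regSum G p₀ ε ψ (G.endpt e x.1) (circleMap (p₀ e x.1) (ε / 2) x.2)‖ ≤
      1 * (∑ h ∈ G.halfEdges (G.src e), ‖ψ h.1‖ + ∑ h ∈ G.halfEdges (G.tgt e), ‖ψ h.1‖) := by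
  rw [one_mul]
  exact (norm_regSum_le ψ hG.pos fun h hh => hG.le_norm_circleMap_sub e x.1 x.2 hh).trans
    (sum_endpt_le (fun v => ∑ h ∈ G.halfEdges v, ‖ψ h.1‖)
      (fun v => Finset.sum_nonneg fun _ _ => norm_nonneg _) e x.1)

/-- The traces of the sums of regular parts on the circles of radius `ε / 2`. -/
def traceReg (hG : G.Separated p₀ ε) : (E → Layer) →ₗ[ℂ] (E → Layer) where
  toFun ψ e := BoundedContinuousFunction.ofNormedAddCommGroup
    (fun x => regSum G p₀ ε ψ (G.endpt e x.1) (circleMap (p₀ e x.1) (ε / 2) x.2))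
    (continuous_circle_trace (fun e s θ => (differentiableAt_regSum ψ hG.pos fun h hh => by
      have := hG.le_norm_circleMap_sub e s θ hh
      have := hG.pos
      linarith).continuousAt) e) _ (norm_traceReg_le hG ψ e)
  map_add' ψ ψ' := by
    funext e
    ext x
    exact regSum_add hG.pos fun h hh => by
      have := hG.le_norm_circleMap_sub e x.1 x.2 hh
      have := hG.pos
      linarith
  map_smul' c ψ := by
    funext e
    ext x
    exact regSum_smul c ψ _ _

theorem norm_tracePol_le (hG : G.Separated p₀ ε) (α : E → ℂ) (e : E) (x : Bool × ℝ) :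
    ‖polSum G p₀ α (G.endpt e x.1) (circleMap (p₀ e x.1) (ε / 2) x.2)‖ ≤
      2 / ε * (∑ h ∈ G.halfEdges (G.src e), ‖α h.1‖ + ∑ h ∈ G.halfEdges (G.tgt e), ‖α h.1‖) := by
  have h1 : 0 ≤ 2 / ε := by have := hG.pos; positivity
  refine (norm_polSum_le α hG.pos fun h hh => hG.le_norm_circleMap_sub e x.1 x.2 hh).trans
    (mul_le_mul_of_nonneg_left ?_ h1)
  exact sum_endpt_le (fun v => ∑ h ∈ G.halfEdges v, ‖α h.1‖)
      (fun v => Finset.sum_nonneg fun _ _ => norm_nonneg _) e x.1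

/-- The traces of the sums of polar parts on the circles of radius `ε / 2`. -/
def tracePol (hG : G.Separated p₀ ε) : (E → ℂ) →ₗ[ℂ] (E → Layer) where
  toFun α e := BoundedContinuousFunction.ofNormedAddCommGroup
    (fun x => polSum G p₀ α (G.endpt e x.1) (circleMap (p₀ e x.1) (ε / 2) x.2))
    (continuous_circle_trace (fun e s θ => (differentiableAt_polSum α fun h hh h0 => by
      have := hG.le_norm_circleMap_sub e s θ hh
      rw [h0, sub_self, norm_zero] at this
      have := hG.pos
      linarith).continuousAt) e) _ (norm_tracePol_le hG α e)
  map_add' ψ ψ' := by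
    funext e
    ext x
    exact polSum_add _ _ _ _
  map_smul' c ψ := by
    funext e
    ext x
    exact polSum_smul _ _ _ _

theorem lt_norm_of_mem_Omega {v : V} (z : Omega G p₀ ε v) {h : E × Bool}
    (hh : h ∈ G.halfEdges v) : ε < ‖(z : ℂ) - p₀ h.1 h.2‖ :=
  z.2 h.1 h.2 (Graph.mem_halfEdges.1 hh)

/-- The regular parts of the layers as bounded differentials. -/
def formReg (hε : 0 < ε) : (E → Layer) →ₗ[ℂ] ∀ v, ↥(boundedForms (Omega G p₀ ε v)) where
  toFun ψ v := ⟨BoundedContinuousFunction.ofNormedAddCommGroup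
      (fun z : Omega G p₀ ε v => regSum G p₀ ε ψ v z)
      (continuous_iff_continuousAt.2 fun z => ContinuousAt.comp (g := regSum G p₀ ε ψ v)
        (differentiableAt_regSum ψ hε fun h hh => by
          have := lt_norm_of_mem_Omega z hh
          linarith).continuousAt continuousAt_subtype_val)
      (∑ h ∈ G.halfEdges v, ‖ψ h.1‖) (fun z => norm_regSum_le ψ hε fun h hh => by
          have := lt_norm_of_mem_Omega z hh
          linarith),
    regSum G p₀ ε ψ v, fun z hz => (differentiableAt_regSum ψ hε fun h hh => by
      have := lt_norm_of_mem_Omega ⟨z, hz⟩ hh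
      simp only at this
      linarith).differentiableWithinAt, holomorphicAtInfty_regSum ψ v hε, fun z => rfl⟩
  map_add' ψ ψ' := by
    funext v
    apply Subtype.ext
    ext z
    exact regSum_add hε fun h hh => by
      have := lt_norm_of_mem_Omega z hh
      linarith
  map_smul' c ψ := by
    funext v
    apply Subtype.ext
    ext z
    exact regSum_smul c ψ _ _

theorem norm_formReg_le (hε : 0 < ε) (ψ : E → Layer) (v : V) :
    ‖(formReg hε ψ v : ↥(boundedForms (Omega G p₀ ε v)))‖ ≤ 1 * ∑ h ∈ G.halfEdges v, ‖ψ h.1‖ := by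
  rw [one_mul]
  exact BoundedContinuousFunction.norm_ofNormedAddCommGroup_le _
    (Finset.sum_nonneg fun _ _ => norm_nonneg _) fun z => norm_regSum_le ψ hε fun h hh => by
      have := lt_norm_of_mem_Omega z hh
      linarith

variable {NE : MonotoneNorm E} {NV : MonotoneNorm V} {K : ℝ}

/-- `traceReg` as a bounded operator. -/
def traceRegFam (hG : G.Separated p₀ ε) (hK : G.Incidence NE NV K) :
    NE.Fam (fun _ => Layer) →L[ℂ] NE.Fam (fun _ => Layer) :=
  MonotoneNorm.famMap NE NE (traceReg hG) (K * (2 * 1 * K)) fun ψ => by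
    have h := hK.edge_bound ψ (x := traceReg hG ψ.1) zero_le_one fun e =>
      BoundedContinuousFunction.norm_ofNormedAddCommGroup_le _ (mul_nonneg zero_le_one (add_nonneg
        (Finset.sum_nonneg fun _ _ => norm_nonneg _)
        (Finset.sum_nonneg fun _ _ => norm_nonneg _))) (norm_traceReg_le hG ψ.1 e)
    rwa [← mul_assoc] at h

/-- `tracePol` as a bounded operator. -/
def tracePolFam (hG : G.Separated p₀ ε) (hK : G.Incidence NE NV K) :
    NE.Fam (fun _ => ℂ) →L[ℂ] NE.Fam (fun _ => Layer) :=
  MonotoneNorm.famMap NE NE (tracePol hG) (K * (2 * (2 / ε) * K)) fun α => by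
    have h0 : 0 ≤ 2 / ε := by have := hG.pos; positivity
    have h := hK.edge_bound α (x := tracePol hG α.1) h0 fun e =>
      BoundedContinuousFunction.norm_ofNormedAddCommGroup_le _ (mul_nonneg h0 (add_nonneg
        (Finset.sum_nonneg fun _ _ => norm_nonneg _)
        (Finset.sum_nonneg fun _ _ => norm_nonneg _))) (norm_tracePol_le hG α.1 e)
    rwa [← mul_assoc] at h

/-- `formReg` as a bounded operator. -/
def formRegFam (hε : 0 < ε) (hK : G.Incidence NE NV K) :
    NE.Fam (fun _ => Layer) →L[ℂ] HolForms G NV p₀ ε :=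
  MonotoneNorm.famMap NE NV (formReg hε) (2 * 1 * K) fun ψ =>
    hK.vertex_bound ψ zero_le_one (norm_formReg_le hε ψ.1)

end Sums

/-! ### Charts centred at a point -/

/-- A chart centred at `q` and comparable with `z - q`. -/
structure CentredChart (φ : ℂ → ℂ) (D : Set ℂ) (ρ c₁ c₂ : ℝ) (q : ℂ) : Prop extends
    IsChart φ D ρ where
  center_mem : q ∈ D
  center : φ q = 0
  lower : ∀ z ∈ D, c₁ * ‖φ z‖ ≤ ‖z - q‖
  upper : ∀ z ∈ D, ‖z - q‖ ≤ c₂ * ‖φ z‖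

namespace CentredChart

variable {φ : ℂ → ℂ} {D : Set ℂ} {ρ c₁ c₂ ε : ℝ} {q a : ℂ} (h : CentredChart φ D ρ c₁ c₂ q)
include h

/-- For `R < ρ c₁` the lower bound on `‖z - q‖` puts `D ∩ closedBall q R` inside the image of a
compact disk under the inverse chart, so it is compact. Hence `D` is relatively closed as well as
open in the connected ball of radius `R`. -/
theorem ball_subset (hc₁ : 0 < c₁) : ball q (ρ * c₁) ⊆ D := by
  obtain ⟨g, hg, hg1, hg2⟩ := h.toIsChart.exists_inverse
  intro z hz
  obtain ⟨R, hR1, hR2⟩ := exists_between (mem_ball.1 hz)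
  have hR0 : 0 < R := dist_nonneg.trans_lt hR1
  have hcomp : IsCompact (D ∩ closedBall q R) := by
    have h1 : closedBall (0:ℂ) (R / c₁) ⊆ ball 0 ρ :=
      closedBall_subset_ball ((div_lt_iff₀ hc₁).2 hR2)
    have h2 : D ∩ closedBall q R = g '' (closedBall 0 (R / c₁)) ∩ closedBall q R := by
      ext w
      constructor
      · rintro ⟨hw, hw'⟩
        refine ⟨⟨φ w, ?_, hg2 w hw⟩, hw'⟩
        rw [mem_closedBall_zero_iff, le_div_iff₀ hc₁, mul_comm]
        refine (h.lower w hw).trans ?_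
        rwa [mem_closedBall, dist_eq_norm] at hw'
      · rintro ⟨⟨ζ, hζ, rfl⟩, hw'⟩
        exact ⟨(hg1 ζ (h1 hζ)).1, hw'⟩
    rw [h2]
    exact ((isCompact_closedBall _ _).image_of_continuousOn
      (hg.continuousOn.mono h1)).inter_right isClosed_closedBall
  have hsub : ball q R ⊆ D := by
    refine IsPreconnected.subset_of_closure_inter_subset (convex_ball q R).isPreconnected
      h.isOpen ⟨q, mem_ball_self hR0, h.center_mem⟩ ?_
    intro w hw
    have h1 : w ∈ closure (D ∩ ball q R) := by
      rw [mem_closure_iff_nhds]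
      intro U hU
      obtain ⟨y, hy⟩ := mem_closure_iff_nhds.1 hw.1 _ (inter_mem hU (isOpen_ball.mem_nhds hw.2))
      exact ⟨y, hy.1.1, hy.2, hy.1.2⟩
    exact (hcomp.isClosed.closure_subset_iff.2
      (inter_subset_inter_right _ ball_subset_closedBall) h1).1
  exact hsub hR1

theorem eq_center {z : ℂ} (hz : z ∈ D) (h0 : φ z = 0) : z = q := by
  have := h.upper z hz
  rw [h0, norm_zero, mul_zero] at this
  exact sub_eq_zero.1 (norm_le_zero_iff.1 this)

theorem closedBall_subset (hc₁ : 0 < c₁) (hε : ε ≤ ρ * c₁) (hε0 : 0 < ε) (hq : ‖q - a‖ < ε / 8)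
    {r : ℝ} (hr : r ≤ 3 * ε / 4) : closedBall a r ⊆ D := by
  refine fun z hz => h.ball_subset hc₁ ?_
  rw [mem_closedBall, dist_eq_norm] at hz
  rw [mem_ball, dist_eq_norm]
  have := norm_sub_le (z - a) (q - a)
  rw [sub_sub_sub_cancel_right] at this
  linarith

/-- A centre displaced by less than `ε / 8` is still farther than `ε / 8` from points at distance `ε
/ 4` of `a`; the comparison with `c₂` gives `coordBound`. -/
theorem lt_norm (hc₂ : 0 < c₂) (hq : ‖q - a‖ < ε / 8) {z : ℂ} (hz : z ∈ D)
    (hza : ε / 4 ≤ ‖z - a‖) : ε / (8 * c₂) < ‖φ z‖ := by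
  have h1 := h.upper z hz
  have h2 := norm_add_le (z - q) (q - a)
  rw [sub_add_sub_cancel] at h2
  rw [div_lt_iff₀ (by positivity)]
  linarith

theorem norm_sub_lt (hc₂ : 0 < c₂) (hq : ‖q - a‖ < ε / 8) {z : ℂ} (hz : z ∈ D)
    (hφ : ‖φ z‖ ≤ ε / (8 * c₂)) : ‖z - a‖ < ε / 4 := by
  by_contra! h'
  exact absurd (h.lt_norm hc₂ hq hz h') (not_lt.2 hφ)

/-- Cauchy estimate on a disk of radius `ε / 8`, which stays within `5 * ε / 8` of `a` and hence in
the chart. -/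
theorem norm_deriv_le (hc₁ : 0 < c₁) (hε : ε ≤ ρ * c₁) (hε0 : 0 < ε) (hq : ‖q - a‖ < ε / 8)
    {z : ℂ} (hz : ‖z - a‖ ≤ ε / 2) : ‖deriv φ z‖ ≤ 8 * ρ / ε := by
  have hsub : closedBall z (ε / 8) ⊆ D := by
    refine Subset.trans ?_ (h.closedBall_subset hc₁ hε hε0 hq (r := 5 * ε / 8) (by linarith))
    refine closedBall_subset_closedBall' ?_
    rw [dist_eq_norm]
    linarith
  have h1 : DifferentiableOn ℂ φ (closedBall z (ε / 8)) := h.differentiableOn.mono hsub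
  have h2 := Complex.norm_deriv_le_of_forall_mem_sphere_norm_le (C := ρ) (R := ε / 8) (by positivity)
    (DifferentiableOn.diffContOnCl (f := φ) (s := ball z (ε / 8))
      (by rwa [closure_ball _ (by positivity)]))
    (fun w hw => (h.norm_lt (hsub (sphere_subset_closedBall hw))).le)
  refine h2.trans (le_of_eq ?_)
  field_simp

end CentredChart

/-! ### Kernels attached to an edge -/

/-- A bounded continuous function with a given underlying function, if there is one. -/
def bddCont {S : Type*} [TopologicalSpace S] (f : S → ℂ) : S →ᵇ ℂ := by
  classical exact if h : Continuous f ∧ ∃ C, ∀ x, ‖f x‖ ≤ C then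
    BoundedContinuousFunction.ofNormedAddCommGroup f h.1 h.2.choose h.2.choose_spec else 0

theorem bddCont_apply {S : Type*} [TopologicalSpace S] {f : S → ℂ} (hf : Continuous f) {C : ℝ}
    (hC : ∀ x, ‖f x‖ ≤ C) (x : S) : bddCont f x = f x := by
  unfold bddCont
  rw [dif_pos ⟨hf, C, hC⟩]
  rfl

theorem norm_bddCont_le {S : Type*} [TopologicalSpace S] {f : S → ℂ} (hf : Continuous f) {C : ℝ}
    (hC : ∀ x, ‖f x‖ ≤ C) (hC0 : 0 ≤ C) : ‖bddCont f‖ ≤ C :=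
  (BoundedContinuousFunction.norm_le hC0).2 fun x => by rw [bddCont_apply hf hC]; exact hC x

/-- The kernel of the operator that sends the trace of a differential on the circle of radius
`ε / 2` around one end of an edge to the singular part at the other end. -/
def edgeKernel (a : Bool → ℂ) (ε : ℝ) (φ : Bool → ℂ → ℂ) (t : ℂ) (x : Bool × ℝ × ℝ) : ℂ :=
  -(deriv (φ x.1) (circleMap (a x.1) (ε / 4) x.2.1) * t /
      φ x.1 (circleMap (a x.1) (ε / 4) x.2.1) ^ 2) *
    ((2 * Real.pi * I)⁻¹ * (circleMap 0 (ε / 2) x.2.2 * I) *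
      (φ (!x.1) (circleMap (a (!x.1)) (ε / 2) x.2.2) -
        t / φ x.1 (circleMap (a x.1) (ε / 4) x.2.1))⁻¹)

/-- The singular part at the ends of an edge of a differential with period `1`. -/
def edgeSource (a : Bool → ℂ) (ε : ℝ) (φ : Bool → ℂ → ℂ) (x : Bool × ℝ) : ℂ :=
  (if x.1 then (2 * Real.pi * I)⁻¹ else -(2 * Real.pi * I)⁻¹) *
    (deriv (φ x.1) (circleMap (a x.1) (ε / 4) x.2) / φ x.1 (circleMap (a x.1) (ε / 4) x.2))

theorem norm_two_pi_I_inv_le : ‖(2 * Real.pi * I : ℂ)⁻¹‖ ≤ 1 := by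
  have : ‖(2 * Real.pi * I : ℂ)‖ = 2 * Real.pi := by simp [abs_of_pos Real.pi_pos]
  rw [norm_inv, this]
  exact inv_le_one_of_one_le₀ (by linarith [Real.pi_gt_three])

/-- The constants are as in the definition of admissible coordinates. -/
structure Constants (ρ c₁ c₂ ε : ℝ) : Prop where
  rho_pos : 0 < ρ
  c₁_pos : 0 < c₁
  c₂_pos : 0 < c₂
  eps_pos : 0 < ε
  eps_le : ε ≤ ρ * c₁

/-- A lower bound for the coordinates on the circles of radius at least `ε / 4`. -/
def coordBound (c₂ ε : ℝ) : ℝ := ε / (8 * c₂)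

theorem Constants.coordBound_pos {ρ c₁ c₂ ε : ℝ} (hc : Constants ρ c₁ c₂ ε) :
    0 < coordBound c₂ ε := by
  have := hc.eps_pos
  have := hc.c₂_pos
  unfold coordBound
  positivity

section EdgeKernel

variable {ρ c₁ c₂ ε : ℝ} (hc : Constants ρ c₁ c₂ ε) {φ : Bool → ℂ → ℂ} {D : Bool → Set ℂ}
  {q a : Bool → ℂ} (h : ∀ s, CentredChart (φ s) (D s) ρ c₁ c₂ (q s))
  (hq : ∀ s, ‖q s - a s‖ < ε / 8) {t : ℂ} (ht : ‖t‖ ≤ coordBound c₂ ε ^ 2 / 2)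
include hc h hq

theorem circleMap_mem_chart {r : ℝ} (hr0 : 0 ≤ r) (hr : r ≤ 3 * ε / 4) (s : Bool) (θ : ℝ) :
    circleMap (a s) r θ ∈ D s :=
  (h s).closedBall_subset hc.c₁_pos hc.eps_le hc.eps_pos (hq s) hr
    (circleMap_mem_closedBall _ hr0 _)

theorem coordBound_lt_norm_circleMap {r : ℝ} (hr0 : ε / 4 ≤ r) (hr : r ≤ 3 * ε / 4) (s : Bool)
    (θ : ℝ) : coordBound c₂ ε < ‖φ s (circleMap (a s) r θ)‖ := by
  have h0 : 0 ≤ r := by have := hc.eps_pos; linarith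
  exact (h s).lt_norm hc.c₂_pos (hq s) (circleMap_mem_chart hc h hq h0 hr s θ)
    (by simpa [circleMap, abs_of_nonneg h0] using hr0)

theorem continuous_coord_circleMap {r : ℝ} (hr0 : 0 ≤ r) (hr : r ≤ 3 * ε / 4) (s : Bool) :
    Continuous fun θ => φ s (circleMap (a s) r θ) :=
  continuous_iff_continuousAt.2 fun θ => ContinuousAt.comp (g := φ s)
    (f := fun θ => circleMap (a s) r θ)
    ((h s).differentiableAt (circleMap_mem_chart hc h hq hr0 hr s θ)).continuousAt (by fun_prop)

theorem continuous_deriv_coord_circleMap {r : ℝ} (hr0 : 0 ≤ r) (hr : r ≤ 3 * ε / 4) (s : Bool) :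
    Continuous fun θ => deriv (φ s) (circleMap (a s) r θ) :=
  continuous_iff_continuousAt.2 fun θ => ContinuousAt.comp (g := deriv (φ s))
    (f := fun θ => circleMap (a s) r θ)
    (((h s).deriv_differentiableOn.differentiableAt ((h s).isOpen.mem_nhds
      (circleMap_mem_chart hc h hq hr0 hr s θ))).continuousAt) (by fun_prop)

theorem continuous_edgeSource : Continuous (edgeSource a ε φ) := by
  have h0 := hc.eps_pos
  rw [continuous_prod_of_discrete_left]
  intro s
  have c1 := continuous_deriv_coord_circleMap hc h hq (r := ε / 4) (by linarith) (by linarith) s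
  have c2 := continuous_coord_circleMap hc h hq (r := ε / 4) (by linarith) (by linarith) s
  have n2 : ∀ θ, φ s (circleMap (a s) (ε / 4) θ) ≠ 0 := fun θ h1 => by
    have h2 := coordBound_lt_norm_circleMap hc h hq (r := ε / 4) (by linarith) (by linarith) s θ
    rw [h1, norm_zero] at h2
    exact absurd h2 (not_lt.2 hc.coordBound_pos.le)
  exact (continuous_const (y := if s then (2 * Real.pi * I)⁻¹ else -(2 * Real.pi * I)⁻¹)).mul
    (c1.div c2 n2)

theorem norm_edgeSource_le (x : Bool × ℝ) :
    ‖edgeSource a ε φ x‖ ≤ 8 * ρ / ε / coordBound c₂ ε := by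
  have h0 := hc.eps_pos
  have hm := hc.coordBound_pos
  obtain ⟨s, θ⟩ := x
  have h2 := coordBound_lt_norm_circleMap hc h hq (r := ε / 4) (by linarith) (by linarith) s θ
  have h3 := (h s).norm_deriv_le hc.c₁_pos hc.eps_le hc.eps_pos (hq s)
    (z := circleMap (a s) (ε / 4) θ) (by simp [circleMap, abs_of_pos h0]; linarith)
  have h4 : ‖(if s then (2 * Real.pi * I)⁻¹ else -(2 * Real.pi * I)⁻¹ : ℂ)‖ ≤ 1 := by
    split
    · exact norm_two_pi_I_inv_le
    · rw [norm_neg]; exact norm_two_pi_I_inv_le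
  unfold edgeSource
  rw [norm_mul, norm_div]
  have h5 : ‖deriv (φ s) (circleMap (a s) (ε / 4) θ)‖ / ‖φ s (circleMap (a s) (ε / 4) θ)‖ ≤
      8 * ρ / ε / coordBound c₂ ε := div_le_div₀ (h3.trans' (norm_nonneg _)) h3 hm h2.le
  calc _ ≤ 1 * (8 * ρ / ε / coordBound c₂ ε) := by
        gcongr
    _ = _ := one_mul _

include ht

/-- On the circle of radius `ε / 4` the point `t/φ` is at most half of `coordBound`, while the
opposite coordinate exceeds `coordBound` on the circle of radius `ε / 2`. So the denominator of the
kernel stays away from zero. -/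
theorem coordBound_le_norm_sub (s : Bool) (θ θ' : ℝ) :
    coordBound c₂ ε / 2 ≤ ‖φ (!s) (circleMap (a (!s)) (ε / 2) θ') -
        t / φ s (circleMap (a s) (ε / 4) θ)‖ := by
  have h0 := hc.eps_pos
  have hm := hc.coordBound_pos
  have h1 := coordBound_lt_norm_circleMap hc h hq (r := ε / 4) (by linarith) (by linarith) s θ
  have h2 := coordBound_lt_norm_circleMap hc h hq (r := ε / 2) (by linarith) (by linarith) (!s) θ'
  have h3 : ‖t / φ s (circleMap (a s) (ε / 4) θ)‖ ≤ coordBound c₂ ε / 2 := by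
    rw [norm_div, div_le_iff₀ (hm.trans h1)]
    refine ht.trans ?_
    nlinarith
  have := norm_sub_norm_le (φ (!s) (circleMap (a (!s)) (ε / 2) θ'))
    (t / φ s (circleMap (a s) (ε / 4) θ))
  linarith

theorem continuous_edgeKernel : Continuous (edgeKernel a ε φ t) := by
  have h0 := hc.eps_pos
  have hm := hc.coordBound_pos
  rw [continuous_prod_of_discrete_left]
  intro s
  have c1 := continuous_deriv_coord_circleMap hc h hq (r := ε / 4) (by linarith) (by linarith) s
  have c2 := continuous_coord_circleMap hc h hq (r := ε / 4) (by linarith) (by linarith) s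
  have c3 := continuous_coord_circleMap hc h hq (r := ε / 2) (by linarith) (by linarith) (!s)
  have n2 : ∀ θ, φ s (circleMap (a s) (ε / 4) θ) ≠ 0 := fun θ h1 => by
    have h2 := coordBound_lt_norm_circleMap hc h hq (r := ε / 4) (by linarith) (by linarith) s θ
    rw [h1, norm_zero] at h2
    exact absurd h2 (not_lt.2 hm.le)
  have n3 : ∀ θ θ', φ (!s) (circleMap (a (!s)) (ε / 2) θ') -
        t / φ s (circleMap (a s) (ε / 4) θ) ≠ 0 := fun θ θ' h1 => by
    have h2 := coordBound_le_norm_sub hc h hq ht s θ θ'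
    rw [h1, norm_zero] at h2
    linarith
  have d1 : Continuous fun x : ℝ × ℝ => deriv (φ s) (circleMap (a s) (ε / 4) x.1) :=
    c1.comp continuous_fst
  have d2 : Continuous fun x : ℝ × ℝ => φ s (circleMap (a s) (ε / 4) x.1) :=
    c2.comp continuous_fst
  have d3 : Continuous fun x : ℝ × ℝ => φ (!s) (circleMap (a (!s)) (ε / 2) x.2) :=
    c3.comp continuous_snd
  have d4 : Continuous fun x : ℝ × ℝ => circleMap 0 (ε / 2) x.2 :=
    (continuous_circleMap _ _).comp continuous_snd
  exact (((d1.mul continuous_const).div (d2.pow 2) fun x => pow_ne_zero 2 (n2 x.1)).neg).mul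
    ((continuous_const.mul (d4.mul continuous_const)).mul
      ((d3.sub (continuous_const.div d2 fun x => n2 x.1)).inv₀ fun x => n3 x.1 x.2))

/-- The factor `‖t‖`, uniform over the edges, makes the layer equation a contraction when the necks
are thin. -/
theorem norm_edgeKernel_le (x : Bool × ℝ × ℝ) :
    ‖edgeKernel a ε φ t x‖ ≤ 8 * ρ / coordBound c₂ ε ^ 3 * ‖t‖ := by
  have h0 := hc.eps_pos
  have hm := hc.coordBound_pos
  obtain ⟨s, θ, θ'⟩ := x
  have h1 := coordBound_lt_norm_circleMap hc h hq (r := ε / 4) (by linarith) (by linarith) s θ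
  have h2 := coordBound_le_norm_sub hc h hq ht s θ θ'
  have h3 := (h s).norm_deriv_le hc.c₁_pos hc.eps_le hc.eps_pos (hq s)
    (z := circleMap (a s) (ε / 4) θ) (by simp [circleMap, abs_of_pos h0]; linarith)
  have hρ : 0 ≤ 8 * ρ / ε := h3.trans' (norm_nonneg _)
  have h4 : ‖circleMap 0 (ε / 2) θ' * I‖ = ε / 2 := by
    rw [norm_mul, norm_circleMap_zero, Complex.norm_I, mul_one, abs_of_pos (by positivity)]
  unfold edgeKernel
  simp only [norm_mul, norm_neg, norm_div, norm_pow] at h4 ⊢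
  rw [h4, norm_inv (_ - _)]
  have h5 : ‖deriv (φ s) (circleMap (a s) (ε / 4) θ)‖ * ‖t‖ /
      ‖φ s (circleMap (a s) (ε / 4) θ)‖ ^ 2 ≤ 8 * ρ / ε * ‖t‖ / coordBound c₂ ε ^ 2 := by
    gcongr
  have h6 : ‖φ (!s) (circleMap (a (!s)) (ε / 2) θ') -
        t / φ s (circleMap (a s) (ε / 4) θ)‖⁻¹ ≤ (coordBound c₂ ε / 2)⁻¹ :=
    inv_anti₀ (by positivity) h2
  have h7 := norm_two_pi_I_inv_le
  simp only [norm_mul, norm_inv] at h7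
  calc _ ≤ 8 * ρ / ε * ‖t‖ / coordBound c₂ ε ^ 2 * (1 * (ε / 2) * (coordBound c₂ ε / 2)⁻¹) := by
        gcongr
        simpa using h7
    _ = _ := by
        field_simp

end EdgeKernel

theorem differentiableOn_fun_div {Y : Type*} [NormedAddCommGroup Y] [NormedSpace ℂ Y] {f g : Y → ℂ}
    {s : Set Y} (hf : DifferentiableOn ℂ f s) (hg : DifferentiableOn ℂ g s)
    (h : ∀ y ∈ s, g y ≠ 0) : DifferentiableOn ℂ (fun y => f y / g y) s := by
  simp only [div_eq_mul_inv]
  exact hf.mul (hg.inv h)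

/-! ### Holomorphic dependence of the edge data on the parameters at that edge -/

section Parameters

variable {V E : Type*} {X : E → Bool → Type*}
  [∀ e s, NormedAddCommGroup (X e s)] [∀ e s, NormedSpace ℂ (X e s)]

theorem AdmissibleCoordinates.centredChart {G : Graph V E} {Z : CoordinateFamily E X}
    {ρ c₁ c₂ : ℝ} {p : E → Bool → ℂ} {ξ : ∀ e s, X e s}
    (h : AdmissibleCoordinates G Z ρ c₁ c₂ p ξ) (e : E) (s : Bool) :
    CentredChart (Z.coord p ξ e s) (Z.disk p ξ e s) ρ c₁ c₂ (p e s) where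
  isOpen := (Z.isOpen_dom e s).preimage (by fun_prop : Continuous fun z : ℂ => (z - p e s, ξ e s))
  differentiableOn := (Z.differentiableOn e s).comp
    (by fun_prop : DifferentiableOn ℂ (fun z : ℂ => (z - p e s, ξ e s)) _) fun _ hz => hz
  bijOn := h.bijOn e s
  center_mem := h.center_mem e s
  center := h.coord_center e s
  lower z hz := (h.bounds e s z hz).1
  upper z hz := (h.bounds e s z hz).2

/-- The coordinates are admissible in a neighbourhood of the central values of the parameters. -/
structure UniformCoordinates (G : Graph V E) (Z : CoordinateFamily E X) (p₀ : E → Bool → ℂ)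
    (ξ₀ : ∀ e s, X e s) (ρ c₁ c₂ η ε : ℝ) : Prop extends Constants ρ c₁ c₂ ε where
  eta_pos : 0 < η
  admissible : ∀ (p : E → Bool → ℂ) (ξ : ∀ e s, X e s), (∀ e s, ‖p e s - p₀ e s‖ < η) →
    (∀ e s, ‖ξ e s - ξ₀ e s‖ < η) → AdmissibleCoordinates G Z ρ c₁ c₂ p ξ

/-- The parameters at an edge. -/
abbrev EdgeParam (X : E → Bool → Type*) [∀ e s, NormedAddCommGroup (X e s)] (e : E) : Type _ :=
  (Bool → ℂ) × ℂ × ∀ s, X e s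

/-- The coordinates at the ends of an edge as functions of the parameters. -/
def edgeCoord (Z : CoordinateFamily E X) (p₀ : E → Bool → ℂ) (ξ₀ : ∀ e s, X e s) (e : E)
    (y : EdgeParam X e) (s : Bool) (z : ℂ) : ℂ :=
  Z.zeta e s (z - (p₀ e s + y.1 s), ξ₀ e s + y.2.2 s)

omit [∀ e s, NormedSpace ℂ (X e s)] in
theorem norm_point_le {e : E} (y : EdgeParam X e) (s : Bool) : ‖y.1 s‖ ≤ ‖y‖ :=
  (norm_le_pi_norm y.1 s).trans (norm_fst_le y)

omit [∀ e s, NormedSpace ℂ (X e s)] in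
theorem norm_neck_le {e : E} (y : EdgeParam X e) : ‖y.2.1‖ ≤ ‖y‖ :=
  (norm_fst_le y.2).trans (norm_snd_le y)

omit [∀ e s, NormedSpace ℂ (X e s)] in
theorem norm_coord_le {e : E} (y : EdgeParam X e) (s : Bool) : ‖y.2.2 s‖ ≤ ‖y‖ :=
  (norm_le_pi_norm y.2.2 s).trans ((norm_snd_le y.2).trans (norm_snd_le y))

variable {G : Graph V E} {Z : CoordinateFamily E X} {p₀ : E → Bool → ℂ}
  {ξ₀ : ∀ e s, X e s} {ρ c₁ c₂ η ε : ℝ} (hU : UniformCoordinates G Z p₀ ξ₀ ρ c₁ c₂ η ε)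
include hU

theorem UniformCoordinates.separated : G.Separated p₀ ε := by
  refine ⟨hU.eps_pos, fun h h' hv hne => ?_⟩
  have hA := hU.admissible p₀ ξ₀ (fun e s => by simpa using hU.eta_pos)
    (fun e s => by simpa using hU.eta_pos)
  have hd := hA.disjoint h.1 h.2 h'.1 h'.2 hv (by simpa using hne)
  have h1 := (hA.centredChart h.1 h.2).ball_subset hU.c₁_pos
  have h2 := (hA.centredChart h'.1 h'.2).ball_subset hU.c₁_pos
  by_contra! hlt
  have hε := hU.eps_le
  set a := p₀ h.1 h.2
  set b := p₀ h'.1 h'.2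
  have e1 : (a + b) / 2 - a = -((a - b) / 2) := by ring
  have e2 : (a + b) / 2 - b = (a - b) / 2 := by ring
  have e3 : ‖(a - b) / 2‖ < ρ * c₁ := by
    rw [norm_div, Complex.norm_ofNat]
    linarith
  -- If the centres were closer than `2 * ε ≤ 2 * ρ * c₁`, their midpoint would lie in both of the
  -- disjoint disks.
  refine Set.disjoint_left.1 hd (h1 (a := (a + b) / 2) ?_) (h2 ?_)
  · rw [mem_ball, dist_eq_norm, e1, norm_neg]
    exact e3
  · rw [mem_ball, dist_eq_norm, e2]
    exact e3

theorem UniformCoordinates.centredChart_edgeCoord {e : E} {y : EdgeParam X e} (hy : ‖y‖ < η)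
    (s : Bool) : CentredChart (edgeCoord Z p₀ ξ₀ e y s)
      {z | (z - (p₀ e s + y.1 s), ξ₀ e s + y.2.2 s) ∈ Z.dom e s} ρ c₁ c₂ (p₀ e s + y.1 s) := by
  classical
  -- Admissibility concerns all edges at once, so it is applied to the family that is perturbed at
  -- `e` only.
  have hA := hU.admissible (fun e' s' => if h : e' = e then p₀ e' s' + y.1 s' else p₀ e' s')
    (Function.update ξ₀ e (fun s => ξ₀ e s + y.2.2 s)) (fun e' s' => by
      by_cases he : e' = e
      · subst he
        simpa using (norm_point_le y s').trans_lt hy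
      · simpa [he] using hU.eta_pos) (fun e' s' => by
      by_cases he : e' = e
      · subst he
        simpa using (norm_coord_le y s').trans_lt hy
      · simpa [he] using hU.eta_pos)
  have h := hA.centredChart e s
  unfold CoordinateFamily.coord CoordinateFamily.disk at h
  simp only [dif_pos, Function.update_self] at h
  exact h

omit hU in
-- The evaluation point `w` is fixed and the parameters move. The derivative of the coordinate is
-- the derivative of `ζ` in the direction `(1, 0)`, which is holomorphic in all variables by
-- `differentiableOn_fderiv`.
theorem differentiableOn_edgeCoord {e : E} {s : Bool} {w : ℂ} {R : ℝ}
    (hw : ∀ y ∈ ball (0 : EdgeParam X e) R,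
      (w - (p₀ e s + y.1 s), ξ₀ e s + y.2.2 s) ∈ Z.dom e s) :
    DifferentiableOn ℂ (fun y : EdgeParam X e => edgeCoord Z p₀ ξ₀ e y s w) (ball 0 R) ∧
    DifferentiableOn ℂ (fun y : EdgeParam X e => deriv (edgeCoord Z p₀ ξ₀ e y s) w) (ball 0 R) := by
  have hm : DifferentiableOn ℂ (fun y : EdgeParam X e =>
      (w - (p₀ e s + y.1 s), ξ₀ e s + y.2.2 s)) (ball 0 R) := by
    have h1 : Differentiable ℂ fun y : EdgeParam X e => y.1 s :=
      (ContinuousLinearMap.proj (R := ℂ) (φ := fun _ : Bool => ℂ) s).differentiable.comp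
        differentiable_fst
    have h2 : Differentiable ℂ fun y : EdgeParam X e => y.2.2 s :=
      (ContinuousLinearMap.proj (R := ℂ) (φ := fun s : Bool => X e s) s ∘L
        ContinuousLinearMap.snd ℂ ℂ (∀ s, X e s) ∘L
          ContinuousLinearMap.snd ℂ (Bool → ℂ) (ℂ × ∀ s, X e s)).differentiable
    exact (((h1.const_add _).const_sub w).prodMk (h2.const_add _)).differentiableOn
  refine ⟨(Z.differentiableOn e s).comp hm hw, ?_⟩
  have h1 : DifferentiableOn ℂ (fun y : EdgeParam X e =>
      fderiv ℂ (Z.zeta e s) (w - (p₀ e s + y.1 s), ξ₀ e s + y.2.2 s) (1, 0)) (ball 0 R) :=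
    ((differentiableOn_fderiv (Z.isOpen_dom e s) (Z.differentiableOn e s)).comp hm hw).clm_apply
      (differentiableOn_const _)
  refine h1.congr fun y hy => ?_
  have h2 : HasFDerivAt (Z.zeta e s) (fderiv ℂ (Z.zeta e s)
      (w - (p₀ e s + y.1 s), ξ₀ e s + y.2.2 s)) (w - (p₀ e s + y.1 s), ξ₀ e s + y.2.2 s) :=
    ((Z.differentiableOn e s).differentiableAt ((Z.isOpen_dom e s).mem_nhds (hw y hy))).hasFDerivAt
  have h3 : HasDerivAt (fun z : ℂ => (z - (p₀ e s + y.1 s), ξ₀ e s + y.2.2 s)) ((1 : ℂ), (0 : X e s))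
      w := ((hasDerivAt_id w).sub_const _).prodMk (hasDerivAt_const _ _)
  exact (h2.comp_hasDerivAt w h3).deriv

variable {τ : ℝ} (hτ : τ ≤ coordBound c₂ ε ^ 2 / 2) {t₀ : E → ℂ} (ht₀ : ∀ e, ‖t₀ e‖ ≤ τ / 2)
  {R : ℝ} (hRη : R ≤ η) (hRε : R ≤ ε / 8) (hRτ : R ≤ τ / 2)
include hτ ht₀ hRη hRε hRτ

theorem UniformCoordinates.edge_facts {e : E} {y : EdgeParam X e} (hy : y ∈ ball 0 R) :
    (∀ s, CentredChart (edgeCoord Z p₀ ξ₀ e y s)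
      {z | (z - (p₀ e s + y.1 s), ξ₀ e s + y.2.2 s) ∈ Z.dom e s} ρ c₁ c₂ (p₀ e s + y.1 s)) ∧
    (∀ s, ‖p₀ e s + y.1 s - p₀ e s‖ < ε / 8) ∧
    ‖t₀ e + y.2.1‖ ≤ τ ∧ ‖t₀ e + y.2.1‖ ≤ coordBound c₂ ε ^ 2 / 2 := by
  rw [mem_ball_zero_iff] at hy
  have h1 : ‖t₀ e + y.2.1‖ ≤ τ := by
    have := norm_add_le (t₀ e) y.2.1
    have := norm_neck_le y
    have := ht₀ e
    linarith
  refine ⟨hU.centredChart_edgeCoord (hy.trans_le hRη), fun s => ?_, h1, h1.trans hτ⟩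
  rw [add_sub_cancel_left]
  exact ((norm_point_le y s).trans_lt hy).trans_le hRε

/-- The circles are centred at the central points and do not move with the parameters, so each value
is holomorphic in the parameters; the uniform bound upgrades this to the supremum norm. -/
theorem UniformCoordinates.differentiableOn_bddCont_edgeSource (e : E) :
    DifferentiableOn ℂ (fun y : EdgeParam X e =>
      bddCont (edgeSource (p₀ e) ε (edgeCoord Z p₀ ξ₀ e y))) (ball 0 R) := by
  have h0 := hU.eps_pos
  have hm := hU.coordBound_pos
  have hF : ∀ x, DifferentiableOn ℂ (fun y : EdgeParam X e =>
      edgeSource (p₀ e) ε (edgeCoord Z p₀ ξ₀ e y) x) (ball 0 R) := by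
    rintro ⟨s, θ⟩
    obtain ⟨h1, h2⟩ := differentiableOn_edgeCoord (Z := Z) (p₀ := p₀) (ξ₀ := ξ₀) (e := e) (s := s) (R := R)
      (w := circleMap (p₀ e s) (ε / 4) θ) fun y hy => by
        obtain ⟨hc, hq, -, -⟩ := hU.edge_facts hτ ht₀ hRη hRε hRτ hy
        exact circleMap_mem_chart hU.toConstants hc hq (by positivity) (by linarith) s θ
    have n1 : ∀ y ∈ ball (0 : EdgeParam X e) R,
        edgeCoord Z p₀ ξ₀ e y s (circleMap (p₀ e s) (ε / 4) θ) ≠ 0 := fun y hy h3 => by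
      obtain ⟨hc, hq, -, -⟩ := hU.edge_facts hτ ht₀ hRη hRε hRτ hy
      have h4 := coordBound_lt_norm_circleMap hU.toConstants hc hq (r := ε / 4) (by linarith)
        (by linarith) s θ
      rw [h3, norm_zero] at h4
      linarith
    have h3 := differentiableOn_fun_div h2 h1 n1
    exact (differentiableOn_const _).mul h3
  intro y hy
  have hyR : 0 < R - ‖y‖ := by rw [mem_ball_zero_iff] at hy; linarith
  have hsub : ball y (R - ‖y‖) ⊆ ball 0 R := ball_subset_ball' (by rw [dist_zero_right]; linarith)
  refine (differentiableAt_boundedContinuousFunction hyR (K := 8 * ρ / ε / coordBound c₂ ε)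
    (fun x => ((hF x).mono hsub).congr fun z hz => ?_) fun z hz => ?_).differentiableWithinAt
  · obtain ⟨hc, hq, -, -⟩ := hU.edge_facts hτ ht₀ hRη hRε hRτ (hsub hz)
    exact bddCont_apply (continuous_edgeSource hU.toConstants hc hq)
      (norm_edgeSource_le hU.toConstants hc hq) x
  · obtain ⟨hc, hq, -, -⟩ := hU.edge_facts hτ ht₀ hRη hRε hRτ (hsub hz)
    exact norm_bddCont_le (continuous_edgeSource hU.toConstants hc hq)
      (norm_edgeSource_le hU.toConstants hc hq)
      ((norm_nonneg _).trans (norm_edgeSource_le hU.toConstants hc hq (true, 0)))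

theorem UniformCoordinates.differentiableOn_bddCont_edgeKernel (e : E) :
    DifferentiableOn ℂ (fun y : EdgeParam X e =>
      bddCont (edgeKernel (p₀ e) ε (edgeCoord Z p₀ ξ₀ e y) (t₀ e + y.2.1))) (ball 0 R) := by
  have h0 := hU.eps_pos
  have hm := hU.coordBound_pos
  have hF : ∀ x, DifferentiableOn ℂ (fun y : EdgeParam X e =>
      edgeKernel (p₀ e) ε (edgeCoord Z p₀ ξ₀ e y) (t₀ e + y.2.1) x) (ball 0 R) := by
    rintro ⟨s, θ, θ'⟩
    obtain ⟨h1, h2⟩ := differentiableOn_edgeCoord (Z := Z) (p₀ := p₀) (ξ₀ := ξ₀) (e := e) (s := s) (R := R)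
      (w := circleMap (p₀ e s) (ε / 4) θ) fun y hy => by
        obtain ⟨hc, hq, -, -⟩ := hU.edge_facts hτ ht₀ hRη hRε hRτ hy
        exact circleMap_mem_chart hU.toConstants hc hq (by positivity) (by linarith) s θ
    obtain ⟨h3, -⟩ := differentiableOn_edgeCoord (Z := Z) (p₀ := p₀) (ξ₀ := ξ₀) (e := e) (s := !s) (R := R)
      (w := circleMap (p₀ e (!s)) (ε / 2) θ') fun y hy => by
        obtain ⟨hc, hq, -, -⟩ := hU.edge_facts hτ ht₀ hRη hRε hRτ hy
        exact circleMap_mem_chart hU.toConstants hc hq (by positivity) (by linarith) (!s) θ'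
    have h4 : DifferentiableOn ℂ (fun y : EdgeParam X e => t₀ e + y.2.1) (ball 0 R) := by fun_prop
    have n1 : ∀ y ∈ ball (0 : EdgeParam X e) R,
        edgeCoord Z p₀ ξ₀ e y s (circleMap (p₀ e s) (ε / 4) θ) ≠ 0 := fun y hy h5 => by
      obtain ⟨hc, hq, -, -⟩ := hU.edge_facts hτ ht₀ hRη hRε hRτ hy
      have h4 := coordBound_lt_norm_circleMap hU.toConstants hc hq (r := ε / 4) (by linarith)
        (by linarith) s θ
      rw [h5, norm_zero] at h4
      linarith
    have h5 := h3.sub (differentiableOn_fun_div h4 h1 n1)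
    have n5 : ∀ y ∈ ball (0 : EdgeParam X e) R,
        edgeCoord Z p₀ ξ₀ e y (!s) (circleMap (p₀ e (!s)) (ε / 2) θ') -
          (t₀ e + y.2.1) / edgeCoord Z p₀ ξ₀ e y s (circleMap (p₀ e s) (ε / 4) θ) ≠ 0 :=
      fun y hy h5 => by
        obtain ⟨hc, hq, -, ht⟩ := hU.edge_facts hτ ht₀ hRη hRε hRτ hy
        have h6 := coordBound_le_norm_sub hU.toConstants hc hq ht s θ θ'
        rw [h5, norm_zero] at h6
        linarith
    have h6 := (differentiableOn_fun_div (h2.mul h4) (h1.pow 2)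
      fun y hy => pow_ne_zero 2 (n1 y hy)).neg
    have h7 := (differentiableOn_const (𝕜 := ℂ) (s := ball (0 : EdgeParam X e) R)
      ((2 * Real.pi * I)⁻¹ * (circleMap 0 (ε / 2) θ' * I))).mul (h5.inv n5)
    exact h6.mul h7
  intro y hy
  have hyR : 0 < R - ‖y‖ := by rw [mem_ball_zero_iff] at hy; linarith
  have hsub : ball y (R - ‖y‖) ⊆ ball 0 R := ball_subset_ball' (by rw [dist_zero_right]; linarith)
  have hρ := hU.rho_pos
  have hτ0 : 0 ≤ τ := by
    obtain ⟨-, -, ht, -⟩ := hU.edge_facts hτ ht₀ hRη hRε hRτ hy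
    exact (norm_nonneg _).trans ht
  refine (differentiableAt_boundedContinuousFunction hyR
    (K := 8 * ρ / coordBound c₂ ε ^ 3 * τ)
    (fun x => ((hF x).mono hsub).congr fun z hz => ?_) fun z hz => ?_).differentiableWithinAt
  · obtain ⟨hc, hq, -, ht⟩ := hU.edge_facts hτ ht₀ hRη hRε hRτ (hsub hz)
    exact bddCont_apply (continuous_edgeKernel hU.toConstants hc hq ht)
      (norm_edgeKernel_le hU.toConstants hc hq ht) x
  · obtain ⟨hc, hq, ht', ht⟩ := hU.edge_facts hτ ht₀ hRη hRε hRτ (hsub hz)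
    refine norm_bddCont_le (continuous_edgeKernel hU.toConstants hc hq ht)
      (fun x => (norm_edgeKernel_le hU.toConstants hc hq ht x).trans ?_) (by positivity)
    gcongr

end Parameters

/-! ### The layer equation: uniqueness and smooth dependence of its solutions -/

section Layers

variable {V E : Type*} {X : E → Bool → Type*}
  [∀ e s, NormedAddCommGroup (X e s)] [∀ e s, NormedSpace ℂ (X e s)]
  {G : Graph V E} {Z : CoordinateFamily E X} {p₀ : E → Bool → ℂ}
  {ξ₀ : ∀ e s, X e s} {ρ c₁ c₂ η ε τ : ℝ}

/-- The parameters are close to the central values. -/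
structure NearCentral (G : Graph V E) (Z : CoordinateFamily E X) (p₀ : E → Bool → ℂ)
    (ρ c₁ c₂ ε τ : ℝ) (p : E → Bool → ℂ) (t : E → ℂ) (ξ : ∀ e s, X e s) : Prop where
  admissible : AdmissibleCoordinates G Z ρ c₁ c₂ p ξ
  near : ∀ e s, ‖p e s - p₀ e s‖ < ε / 8
  neck : ∀ e, ‖t e‖ ≤ τ

/-- The equation satisfied by the singular parts at the ends of the edges of a differential with
periods `α`, in terms of the coordinates `φ`. -/
def IsLayerSolution (hG : G.Separated p₀ ε) (φ : E → Bool → ℂ → ℂ) (t α : E → ℂ)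
    (ψ : E → Layer) : Prop :=
  ∀ e, ψ e = α e • bddCont (edgeSource (p₀ e) ε (φ e)) +
    kernelAct (bddCont (edgeKernel (p₀ e) ε (φ e) (t e))) (traceReg hG ψ e + tracePol hG α e)

/-- The norm of the kernel operators is at most `kernelConst ρ c₂ ε * ‖t‖`. -/
def kernelConst (ρ c₂ ε : ℝ) : ℝ := 2 * Real.pi * (8 * ρ / coordBound c₂ ε ^ 3)

theorem Constants.kernelConst_pos (hc : Constants ρ c₁ c₂ ε) : 0 < kernelConst ρ c₂ ε := by
  have := hc.rho_pos
  have := hc.coordBound_pos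
  have := Real.pi_pos
  unfold kernelConst
  positivity

theorem norm_kernelAct_edgeKernel_le (hc : Constants ρ c₁ c₂ ε) {φ : Bool → ℂ → ℂ}
    {D : Bool → Set ℂ} {q a : Bool → ℂ} (h : ∀ s, CentredChart (φ s) (D s) ρ c₁ c₂ (q s))
    (hq : ∀ s, ‖q s - a s‖ < ε / 8) (hτ : τ ≤ coordBound c₂ ε ^ 2 / 2) {t : ℂ} (ht : ‖t‖ ≤ τ) :
    ‖kernelAct (bddCont (edgeKernel a ε φ t))‖ ≤ kernelConst ρ c₂ ε * τ := by
  have h1 := hc.rho_pos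
  have h2 := hc.coordBound_pos
  have h3 := Real.pi_pos
  refine (norm_kernelAct_le _).trans ?_
  have h4 := norm_bddCont_le (continuous_edgeKernel hc h hq (ht.trans hτ))
    (norm_edgeKernel_le hc h hq (ht.trans hτ)) (by positivity)
  unfold kernelConst
  calc 2 * Real.pi * _ ≤ 2 * Real.pi * (8 * ρ / coordBound c₂ ε ^ 3 * ‖t‖) := by gcongr
    _ ≤ 2 * Real.pi * (8 * ρ / coordBound c₂ ε ^ 3 * τ) := by gcongr
    _ = _ := by ring

/-- The difference of two bounded solutions solves the homogeneous equation, whose operator has norm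
less than `1` on bounded families. -/
theorem IsLayerSolution.eq_of_bounded {hG : G.Separated p₀ ε} (hc : Constants ρ c₁ c₂ ε)
    {p : E → Bool → ℂ} {t : E → ℂ} {ξ : ∀ e s, X e s} {α : E → ℂ}
    (hn : NearCentral G Z p₀ ρ c₁ c₂ ε τ p t ξ) (hτ : τ ≤ coordBound c₂ ε ^ 2 / 2) (hτ0 : 0 ≤ τ)
    {K : ℝ} (hK : G.Incidence (boundedNorm E) (boundedNorm V) K)
    (hq : kernelConst ρ c₂ ε * τ * ‖traceRegFam hG hK‖ < 1)
    {ψ ψ' : E → Layer} {M : ℝ} (hM : ∀ e, ‖ψ e‖ ≤ M) (hM' : ∀ e, ‖ψ' e‖ ≤ M)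
    (h : IsLayerSolution hG (Z.coord p ξ) t α ψ) (h' : IsLayerSolution hG (Z.coord p ξ) t α ψ') :
    ψ = ψ' := by
  set d : (boundedNorm E).Fam (fun _ => Layer) := (boundedNorm E).famMk (fun e => ψ e - ψ' e)
    (boundedNorm_mem (C := M + M) fun e => (norm_sub_le _ _).trans (add_le_add (hM e) (hM' e)))
  have hd : ∀ e, d e = kernelAct (bddCont (edgeKernel (p₀ e) ε (Z.coord p ξ e) (t e)))
      (traceRegFam hG hK d e) := by
    intro e
    have h1 : traceReg hG (fun e => ψ e - ψ' e) e = traceReg hG ψ e - traceReg hG ψ' e :=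
      congrFun ((traceReg hG).map_sub ψ ψ') e
    change ψ e - ψ' e = kernelAct _ (traceReg hG (fun e => ψ e - ψ' e) e)
    rw [h1, h e, h' e, map_sub, map_add, map_add]
    abel
  have hle : ‖d‖ ≤ kernelConst ρ c₂ ε * τ * ‖traceRegFam hG hK‖ * ‖d‖ := by
    have h0 := hc.kernelConst_pos
    refine boundedNorm_norm_le (by positivity) fun e => ?_
    rw [hd]
    refine ((kernelAct _).le_of_opNorm_le (norm_kernelAct_edgeKernel_le hc
      (fun s => hn.admissible.centredChart e s) (hn.near e) hτ (hn.neck e)) _).trans ?_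
    rw [mul_assoc _ _ ‖d‖]
    gcongr
    exact (boundedNorm_apply_le _ e).trans (ContinuousLinearMap.le_opNorm _ _)
  have hd0 : ‖d‖ = 0 := by
    have := norm_nonneg d
    nlinarith
  funext e
  have h1 := boundedNorm_apply_le d e
  rw [hd0] at h1
  exact sub_eq_zero.1 (norm_le_zero_iff.1 h1)

variable (X) in
/-- Perturbations of all the parameters as families of perturbations at the edges. -/
def paramFam (N : MonotoneNorm E) :
    PointSpace N × NeckSpace N × CoordSpace N X →L[ℂ] N.Fam (EdgeParam X) :=
  MonotoneNorm.famDiag N (fun e => ContinuousLinearMap.inl ℂ (Bool → ℂ) (ℂ × ∀ s, X e s)) zero_le_one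
      (fun _ => ContinuousLinearMap.norm_inl_le_one _ _ _) ∘L ContinuousLinearMap.fst ℂ _ _ +
    MonotoneNorm.famDiag N (fun e => ContinuousLinearMap.inr ℂ (Bool → ℂ) (ℂ × ∀ s, X e s))
      zero_le_one (fun _ => ContinuousLinearMap.norm_inr_le_one _ _ _) ∘L
      (MonotoneNorm.famDiag N (fun e => ContinuousLinearMap.inl ℂ ℂ (∀ s, X e s)) zero_le_one
        (fun _ => ContinuousLinearMap.norm_inl_le_one _ _ _) ∘L ContinuousLinearMap.fst ℂ _ _ +
      MonotoneNorm.famDiag N (fun e => ContinuousLinearMap.inr ℂ ℂ (∀ s, X e s)) zero_le_one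
        (fun _ => ContinuousLinearMap.norm_inr_le_one _ _ _) ∘L ContinuousLinearMap.snd ℂ _ _) ∘L
      ContinuousLinearMap.snd ℂ _ _

theorem paramFam_apply (N : MonotoneNorm E) (x : PointSpace N × NeckSpace N × CoordSpace N X)
    (e : E) : paramFam X N x e = (x.1 e, x.2.1 e, x.2.2 e) := by
  change ((x.1 e, 0) + (0, ((x.2.1 e, 0) + (0, x.2.2 e))) : EdgeParam X e) = _
  simp

variable (hU : UniformCoordinates G Z p₀ ξ₀ ρ c₁ c₂ η ε)
include hU

/-- The solutions of the layer equation exist and depend smoothly on the parameters. -/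
theorem UniformCoordinates.exists_smooth_layers {N : MonotoneNorm E} {NV : MonotoneNorm V} {C : ℝ}
    (hC : N.BoundedBy C) (hC0 : 0 ≤ C) [CompleteSpace (N.Fam fun _ => ℂ)] {K K' : ℝ}
    (hK : G.Incidence N NV K) (hK' : G.Incidence (boundedNorm E) (boundedNorm V) K')
    (hτ0 : 0 < τ) (hτ : τ ≤ coordBound c₂ ε ^ 2 / 2)
    (hq : kernelConst ρ c₂ ε * τ * ‖traceRegFam hU.separated hK‖ < 1)
    (hq' : kernelConst ρ c₂ ε * τ * ‖traceRegFam hU.separated hK'‖ < 1)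
    {t₀ : E → ℂ} (ht₀ : ∀ e, ‖t₀ e‖ ≤ τ / 2) :
    ∃ δ > 0, ∃ (Ψ : (boundedNorm E).Fam (fun _ => ℂ) → (boundedNorm E).Fam (fun _ => Layer))
      (D : (PointSpace N × NeckSpace N × CoordSpace N X) × (boundedNorm E).Fam (fun _ => ℂ) →
        N.Fam (fun _ => Layer)),
      ContDiffOn ℂ ((⊤ : ℕ∞) : WithTop ℕ∞) D
        ({x | ‖x.1‖ < δ ∧ ‖x.2.1‖ < δ ∧ ‖x.2.2‖ < δ} ×ˢ univ) ∧
      (∀ α : (boundedNorm E).Fam (fun _ => ℂ), IsLayerSolution hU.separated (Z.coord p₀ ξ₀) t₀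
        (fun e => α e) (fun e => Ψ α e)) ∧
      ∀ (dp : PointSpace N) (dt : NeckSpace N) (dξ : CoordSpace N X), ‖dp‖ < δ → ‖dt‖ < δ →
        ‖dξ‖ < δ → NearCentral G Z p₀ ρ c₁ c₂ ε τ (fun e s => p₀ e s + dp e s)
          (fun e => t₀ e + dt e) (fun e s => ξ₀ e s + dξ e s) ∧
        ∀ α : (boundedNorm E).Fam (fun _ => ℂ), IsLayerSolution hU.separated
          (Z.coord (fun e s => p₀ e s + dp e s) (fun e s => ξ₀ e s + dξ e s))
          (fun e => t₀ e + dt e) (fun e => α e) (fun e => Ψ α e + D ((dp, dt, dξ), α) e) := by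
  have hε := hU.eps_pos
  have hη := hU.eta_pos
  have hρ := hU.rho_pos
  have hm := hU.coordBound_pos
  -- The three bounds keep the coordinates admissible, the centres within `ε / 8` of the central
  -- ones, and `‖t‖ ≤ τ` since half of `τ` is spent on the central value.
  obtain ⟨R, hR, hRη, hRε, hRτ⟩ : ∃ R, 0 < R ∧ R ≤ η ∧ R ≤ ε / 8 ∧ R ≤ τ / 2 :=
    ⟨min η (min (ε / 8) (τ / 2)), by positivity, min_le_left _ _,
      (min_le_right _ _).trans (min_le_left _ _), (min_le_right _ _).trans (min_le_right _ _)⟩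
  have facts := fun (e : E) (y : EdgeParam X e) (hy : y ∈ ball 0 R) =>
    hU.edge_facts hτ ht₀ hRη hRε hRτ hy
  set Fk : ∀ e, EdgeParam X e → LayerKernel := fun e y =>
    bddCont (edgeKernel (p₀ e) ε (edgeCoord Z p₀ ξ₀ e y) (t₀ e + y.2.1)) with hFk
  set Fs : ∀ e, EdgeParam X e → Layer := fun e y =>
    bddCont (edgeSource (p₀ e) ε (edgeCoord Z p₀ ξ₀ e y)) with hFs
  have bFs : ∀ e, ∀ y ∈ ball (0 : EdgeParam X e) R, ‖Fs e y‖ ≤ 8 * ρ / ε / coordBound c₂ ε := by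
    intro e y hy
    obtain ⟨h1, h2, -, -⟩ := facts e y hy
    exact norm_bddCont_le (continuous_edgeSource hU.toConstants h1 h2)
      (norm_edgeSource_le hU.toConstants h1 h2) (by positivity)
  have bFk : ∀ e, ∀ y ∈ ball (0 : EdgeParam X e) R,
      ‖Fk e y‖ ≤ 8 * ρ / coordBound c₂ ε ^ 3 * τ := by
    intro e y hy
    obtain ⟨h1, h2, h3, h4⟩ := facts e y hy
    refine norm_bddCont_le (continuous_edgeKernel hU.toConstants h1 h2 h4)
      (fun x => (norm_edgeKernel_le hU.toConstants h1 h2 h4 x).trans ?_) (by positivity)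
    gcongr
  have kFk : ∀ e, ∀ y ∈ ball (0 : EdgeParam X e) R,
      ‖kernelAct (Fk e y)‖ ≤ kernelConst ρ c₂ ε * τ := by
    intro e y hy
    obtain ⟨h1, h2, h3, h4⟩ := facts e y hy
    exact norm_kernelAct_edgeKernel_le hU.toConstants h1 h2 hτ h3
  -- Through the embedding, a perturbation of norm less than `δ'` stays in half of the uniform ball
  -- of holomorphy at every edge; `C + 1` avoids division by zero.
  set δ' : ℝ := R / (2 * (C + 1)) with hδ'
  have hδ'0 : 0 < δ' := by positivity
  have hδ'R : (C + 1) * δ' ≤ R / 2 := by rw [hδ']; apply le_of_eq; field_simp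
  have hCδ : C * δ' ≤ R / 2 := by nlinarith
  obtain ⟨ΦK, hΦK, hΦK'⟩ := hC.exists_superposition hC0 hR (by positivity)
    (fun e => hU.differentiableOn_bddCont_edgeKernel hτ ht₀ hRη hRε hRτ e) bFk hCδ
  obtain ⟨ΦS, hΦS, hΦS'⟩ := hC.exists_superposition hC0 hR (by positivity)
    (fun e => hU.differentiableOn_bddCont_edgeSource hτ ht₀ hRη hRε hRτ e) bFs hCδ
  set δ : ℝ := δ' / (‖paramFam X N‖ + 1) with hδ
  have hδ0 : 0 < δ := by positivity
  set U : Set (PointSpace N × NeckSpace N × CoordSpace N X) :=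
    {x | ‖x.1‖ < δ ∧ ‖x.2.1‖ < δ ∧ ‖x.2.2‖ < δ} with hUdef
  have hUo : IsOpen U :=
    (isOpen_lt continuous_fst.norm continuous_const).inter
      ((isOpen_lt continuous_snd.fst.norm continuous_const).inter
        (isOpen_lt continuous_snd.snd.norm continuous_const))
  have hUb : ∀ x ∈ U, paramFam X N x ∈ ball 0 δ' := by
    rintro x ⟨h1, h2, h3⟩
    rw [mem_ball_zero_iff]
    have h4 : ‖x‖ < δ := max_lt h1 (max_lt h2 h3)
    refine lt_of_le_of_lt (ContinuousLinearMap.le_opNorm _ _) ?_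
    rw [hδ, lt_div_iff₀ (by positivity)] at h4
    have := norm_nonneg x
    nlinarith [norm_nonneg (paramFam X N)]
  have hUe : ∀ x ∈ U, ∀ e, paramFam X N x e ∈ ball (0 : EdgeParam X e) R := by
    intro x hx e
    have h1 := hUb x hx
    rw [mem_ball_zero_iff] at h1 ⊢
    have h2 := hC.norm_apply_le (paramFam X N x) e
    have h3 : C * ‖paramFam X N x‖ ≤ C * δ' := by gcongr
    linarith
  have h0R : ∀ e, (0 : EdgeParam X e) ∈ ball (0 : EdgeParam X e) R := fun e => mem_ball_self hR
  have hFk0 : ∀ x ∈ U, ∀ e, Fk e 0 + ΦK (paramFam X N x) e = Fk e (paramFam X N x e) := by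
    intro x hx e
    rw [hΦK' _ (hUb x hx)]
    exact add_sub_cancel _ _
  have hFs0 : ∀ x ∈ U, ∀ e, Fs e 0 + ΦS (paramFam X N x) e = Fs e (paramFam X N x e) := by
    intro x hx e
    rw [hΦS' _ (hUb x hx)]
    exact add_sub_cancel _ _
  obtain ⟨Ψ, D, hD, hΨ, hΨD⟩ := hC.exists_smooth_solution hC0 kernelAct (traceReg hU.separated)
    (traceRegFam hU.separated hK) (fun _ _ => rfl) (traceRegFam hU.separated hK') (fun _ _ => rfl)
    (tracePolFam hU.separated hK') (k := fun e => Fk e 0) (b := fun e => Fs e 0)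
    (fun e => bFs e 0 (h0R e)) (DK := fun x => ΦK (paramFam X N x))
    (Db := fun x => ΦS (paramFam X N x)) hUo
    (hΦK.comp (paramFam X N).differentiable.differentiableOn hUb)
    (hΦS.comp (paramFam X N).differentiable.differentiableOn hUb)
    (by have := hU.kernelConst_pos; positivity) (fun e => kFk e 0 (h0R e))
    (fun x hx e => by rw [hFk0 x hx e]; exact kFk e _ (hUe x hx e)) hq hq'
  refine ⟨δ, hδ0, Ψ, D, hD, fun α e => ?_, fun dp dt dξ h1 h2 h3 => ?_⟩
  · have h := hΨ α e
    have h1 : edgeCoord Z p₀ ξ₀ e 0 = Z.coord p₀ ξ₀ e := by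
      funext s z
      simp [edgeCoord, CoordinateFamily.coord]
    have h2 : t₀ e + (0 : EdgeParam X e).2.1 = t₀ e := add_zero _
    simp only [hFs, hFk, h1, h2] at h
    exact h
  · have hx : (dp, dt, dξ) ∈ U := ⟨h1, h2, h3⟩
    have he := fun e => paramFam_apply N (dp, dt, dξ) e
    have hb := hUe _ hx
    simp only [he] at hb
    refine ⟨⟨hU.admissible _ _ (fun e s => ?_) (fun e s => ?_), fun e s => ?_, fun e => ?_⟩,
      fun α e => ?_⟩
    · rw [add_sub_cancel_left]
      exact (norm_point_le (X := X) _ s).trans_lt ((mem_ball_zero_iff.1 (hb e)).trans_le hRη)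
    · rw [add_sub_cancel_left]
      exact (norm_coord_le (X := X) _ s).trans_lt ((mem_ball_zero_iff.1 (hb e)).trans_le hRη)
    · rw [add_sub_cancel_left]
      exact (norm_point_le (X := X) _ s).trans_lt ((mem_ball_zero_iff.1 (hb e)).trans_le hRε)
    · exact (facts e _ (hb e)).2.2.1
    · have h := hΨD _ hx α e
      rw [hFk0 _ hx, hFs0 _ hx, he] at h
      exact h

end Layers

/-! ### The layer equation in terms of the forms on the necks -/

section OneNeck

variable {φ : ℂ → ℂ} {D : Set ℂ} {ρ c₁ c₂ ε : ℝ} {q a : ℂ}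

/-- A point of the chart with `‖φ z‖ = ρ / 2` shows `c₁ ≤ c₂`, so `ε ≤ ρ * c₁ ≤ ρ * c₂`. -/
theorem CentredChart.coordBound_le (h : CentredChart φ D ρ c₁ c₂ q) (hc : Constants ρ c₁ c₂ ε) :
    coordBound c₂ ε ≤ ρ / 8 := by
  have hρ := hc.rho_pos
  have h2 := hc.c₂_pos
  obtain ⟨z, hz, hφ⟩ := h.bijOn.surjOn (show ((ρ / 2 : ℝ) : ℂ) ∈ ball (0:ℂ) ρ by
    rw [mem_ball_zero_iff, Complex.norm_real, Real.norm_of_nonneg (by positivity)]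
    linarith)
  have h3 := (h.lower z hz).trans (h.upper z hz)
  rw [hφ, Complex.norm_real, Real.norm_of_nonneg (by positivity)] at h3
  have h4 : c₁ ≤ c₂ := le_of_mul_le_mul_right h3 (by positivity)
  have h5 := hc.eps_le
  unfold coordBound
  rw [div_le_iff₀ (by positivity)]
  nlinarith

/-- The third bound applies when the opposite part `Q'` is holomorphic on the full disk of radius
`ρ`, the fourth when it is known only on the disk of radius `coordBound`, as happens before gluing.
-/
theorem CentredChart.neck_bounds (h : CentredChart φ D ρ c₁ c₂ q) (hc : Constants ρ c₁ c₂ ε)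
    {t : ℂ} (ht : ‖t‖ ≤ coordBound c₂ ε ^ 2 / 2) :
    ‖t‖ < ρ ^ 2 ∧ ‖t‖ / ρ ≤ coordBound c₂ ε / 16 ∧ ‖t‖ ≤ ρ * coordBound c₂ ε ∧
      ‖t‖ ≤ coordBound c₂ ε * coordBound c₂ ε := by
  have hρ := hc.rho_pos
  have hm := hc.coordBound_pos
  have h1 := h.coordBound_le hc
  refine ⟨by nlinarith, ?_, by nlinarith, by nlinarith⟩
  rw [div_le_iff₀ hρ]
  nlinarith

theorem IsChart.differentiableAt_neckForm (h : IsChart φ D ρ) {β t : ℂ} {Q Q' : ℂ → ℂ} {ρ' : ℝ}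
    (hQ : DifferentiableOn ℂ Q (ball 0 ρ)) (hQ' : DifferentiableOn ℂ Q' (ball 0 ρ')) {z : ℂ}
    (hz : z ∈ D) (h0 : φ z ≠ 0) (ht : ‖t‖ < ρ' * ‖φ z‖) :
    DifferentiableAt ℂ (neckForm φ β t Q Q') z := by
  have h1 : DifferentiableAt ℂ φ z := h.differentiableAt hz
  have h2 : DifferentiableAt ℂ (deriv φ) z :=
    h.deriv_differentiableOn.differentiableAt (h.isOpen.mem_nhds hz)
  have h3 : DifferentiableAt ℂ (fun z => Q (φ z)) z := by
    refine DifferentiableAt.comp z (hQ.differentiableAt (isOpen_ball.mem_nhds ?_)) h1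
    rw [mem_ball_zero_iff]
    exact h.norm_lt hz
  have h4 : DifferentiableAt ℂ (fun z => t / φ z) z := (differentiableAt_const t).div h1 h0
  have h5 : DifferentiableAt ℂ (fun z => Q' (t / φ z)) z := by
    refine DifferentiableAt.comp z (hQ'.differentiableAt (isOpen_ball.mem_nhds ?_)) h4
    rw [mem_ball_zero_iff, norm_div, div_lt_iff₀ (norm_pos_iff.2 h0)]
    exact ht
  exact h2.mul ((h3.add ((differentiableAt_const β).div h1 h0)).sub
    (((differentiableAt_const t).div (h1.pow 2) (pow_ne_zero 2 h0)).mul h5))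

theorem neckForm_eq_add (β t : ℂ) (Q Q' : ℂ → ℂ) (z : ℂ) :
    neckForm φ β t Q Q' z = deriv φ z * Q (φ z) + neckForm φ β t 0 Q' z := by
  simp only [neckForm, Pi.zero_apply]
  ring

/-- The Cauchy integral that recovers the regular part `Q` of a form on a neck. -/
def innerCoeff (φ : ℂ → ℂ) (a : ℂ) (ε : ℝ) (F : ℂ → ℂ) (η : ℂ) : ℂ :=
  (2 * Real.pi * I)⁻¹ * ∮ w in C(a, ε / 2), (φ w - η)⁻¹ * F w

variable (h : CentredChart φ D ρ c₁ c₂ q) (hc : Constants ρ c₁ c₂ ε) (hq : ‖q - a‖ < ε / 8)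
include h hc hq

theorem CentredChart.lt_norm_sphere {r : ℝ} (hr0 : ε / 4 ≤ r) (hr : r ≤ 3 * ε / 4) {w : ℂ}
    (hw : w ∈ sphere a r) : coordBound c₂ ε < ‖φ w‖ :=
  h.lt_norm hc.c₂_pos hq (h.closedBall_subset hc.c₁_pos hc.eps_le hc.eps_pos hq hr
    (sphere_subset_closedBall hw)) (by rw [mem_sphere, dist_eq_norm] at hw; linarith)

theorem CentredChart.differentiableOn_innerCoeff {F : ℂ → ℂ}
    (hF : ∀ w ∈ sphere a (ε / 2), ContinuousAt F w) :
    DifferentiableOn ℂ (innerCoeff φ a ε F) (ball 0 (coordBound c₂ ε)) := by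
  have hε := hc.eps_pos
  intro η hη
  rw [mem_ball_zero_iff] at hη
  refine DifferentiableAt.differentiableWithinAt ?_
  have hcirc : ∀ θ, circleMap a (ε / 2) θ ∈ sphere a (ε / 2) := fun θ =>
    circleMap_mem_sphere _ (by positivity) _
  have hsub := h.closedBall_subset hc.c₁_pos hc.eps_le hε hq (r := ε / 2) (by linarith)
  have c1 : Continuous fun θ => φ (circleMap a (ε / 2) θ) :=
    continuous_comp_circleMap (by positivity) fun w hw => (h.differentiableAt (hsub (by
      rw [mem_closedBall, dist_eq_norm, hw]))).continuousAt
  have c2 : Continuous fun θ => F (circleMap a (ε / 2) θ) :=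
    continuous_comp_circleMap (by positivity) fun w hw => hF w (by
      rw [mem_sphere, dist_eq_norm, hw])
  have key := hasDerivAt_integral_mul_inv
    (ψ := fun θ => circleMap 0 (ε / 2) θ * I * F (circleMap a (ε / 2) θ))
    (c := fun θ => φ (circleMap a (ε / 2) θ)) (z₀ := η) (d := (coordBound c₂ ε - ‖η‖) / 2)
    (((continuous_circleMap 0 (ε / 2)).mul continuous_const).mul c2) c1 (by linarith) fun θ => by
      have h1 := h.lt_norm_sphere hc hq (r := ε / 2) (by linarith) (by linarith) (hcirc θ)
      have h2 := norm_sub_norm_le (φ (circleMap a (ε / 2) θ)) η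
      rw [norm_sub_rev] at h2
      linarith
  have e : innerCoeff φ a ε F = fun η => -((2 * Real.pi * I)⁻¹) *
      ∫ θ in (0:ℝ)..(2 * Real.pi), (circleMap 0 (ε / 2) θ * I * F (circleMap a (ε / 2) θ)) *
        (η - φ (circleMap a (ε / 2) θ))⁻¹ := by
    funext η
    unfold innerCoeff
    rw [circleIntegral_mul_eq a (ε / 2) F fun w => (φ w - η)⁻¹, neg_mul, ← mul_neg,
      ← intervalIntegral.integral_neg]
    congr 2
    funext θ
    rw [← mul_neg, ← inv_neg, neg_sub]
  rw [e]
  exact key.const_mul _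

/-- A small `η` is the coordinate of a point within `ε / 4` of `a`, so the circle of radius `ε / 2`
surrounds it and the Cauchy formula on the neck returns `Q η`. -/
theorem CentredChart.innerCoeff_neckForm {F Q Q' : ℂ → ℂ} {β t : ℂ} {ρ' : ℝ}
    (hQ : DifferentiableOn ℂ Q (ball 0 ρ)) (hQ' : DifferentiableOn ℂ Q' (ball 0 ρ')) (hρ' : 0 < ρ')
    (ht : ‖t‖ ≤ ρ' * coordBound c₂ ε)
    (hF : ∀ w ∈ sphere a (ε / 2), F w = neckForm φ β t Q Q' w) {η : ℂ}
    (hη : η ∈ ball (0:ℂ) (coordBound c₂ ε)) : innerCoeff φ a ε F η = Q η := by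
  have hε := hc.eps_pos
  rw [mem_ball_zero_iff] at hη
  obtain ⟨z, hz, rfl⟩ := h.bijOn.surjOn (show η ∈ ball (0:ℂ) ρ by
    rw [mem_ball_zero_iff]
    have := h.coordBound_le hc
    have := hc.rho_pos
    linarith)
  have h1 := h.norm_sub_lt hc.c₂_pos hq hz hη.le
  unfold innerCoeff
  have h2 : (∮ w in C(a, ε / 2), (φ w - φ z)⁻¹ * F w) =
      ∮ w in C(a, ε / 2), (φ w - φ z)⁻¹ * neckForm φ β t Q Q' w :=
    circleIntegral.integral_congr (by positivity) fun w hw => by simp only [hF w hw]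
  rw [h2, h.toIsChart.circleIntegral_neckForm hQ hQ' hρ' (by positivity)
    (h.closedBall_subset hc.c₁_pos hc.eps_le hε hq (by linarith))
    (by rw [mem_ball, dist_eq_norm]; linarith) hc.coordBound_pos
    (fun w hw => h.lt_norm_sphere hc hq (by linarith) (by linarith) hw) hη.le ht,
    inv_mul_cancel_left₀ two_pi_I_ne_zero']

theorem CentredChart.layerResidue_neckForm {Q' : ℂ → ℂ} {β t : ℂ} {ρ' : ℝ}
    (hQ' : DifferentiableOn ℂ Q' (ball 0 ρ')) (hρ' : 0 < ρ')
    (ht : ‖t‖ ≤ ρ' * coordBound c₂ ε) {ψ : ℝ → ℂ}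
    (hψ : ∀ θ, ψ θ = neckForm φ β t 0 Q' (circleMap a (ε / 4) θ)) :
    layerResidue (ε / 4) ψ = β := by
  have hε := hc.eps_pos
  have h1 := h.toIsChart.circleIntegral_neckForm_residue (Q := 0) (β := β) (m := coordBound c₂ ε)
    (differentiableOn_const 0) hQ' hρ' (r := ε / 4) (a := a) (z := q) (by positivity)
    (h.closedBall_subset hc.c₁_pos hc.eps_le hε hq (by linarith))
    (by rw [mem_ball, dist_eq_norm]; linarith) h.center hc.coordBound_pos
    (fun w hw => h.lt_norm_sphere hc hq (by linarith) (by linarith) hw) ht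
  unfold layerResidue
  have h2 := circleIntegral_mul_eq a (ε / 4) (neckForm φ β t 0 Q') fun _ => 1
  simp only [one_mul, mul_one] at h2
  simp only [hψ]
  rw [← h2, h1, inv_mul_cancel_left₀ two_pi_I_ne_zero']

end OneNeck

/-! ### The form outside the disks and the meaning of the layer equation -/

section Outer

variable {V E : Type*} {X : E → Bool → Type*}
  [∀ e s, NormedAddCommGroup (X e s)] [∀ e s, NormedSpace ℂ (X e s)]
  {G : Graph V E} {Z : CoordinateFamily E X} {p₀ : E → Bool → ℂ} {ρ c₁ c₂ ε τ : ℝ}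
  {p : E → Bool → ℂ} {t : E → ℂ} {ξ : ∀ e s, X e s} {α : E → ℂ} {ψ : E → Layer}

theorem edgeCoeff_not (α : E → ℂ) (e : E) (s : Bool) :
    edgeCoeff α (e, !s) = -edgeCoeff α (e, s) := by
  cases s <;> simp [edgeCoeff]

/-- The differential outside the disks of radius `ε / 4`. -/
def outerForm (G : Graph V E) (p₀ : E → Bool → ℂ) (ε : ℝ) (α : E → ℂ) (ψ : E → Layer) (v : V)
    (z : ℂ) : ℂ :=
  regSum G p₀ ε ψ v z + polSum G p₀ α v z

theorem differentiableAt_outerForm (hε : 0 < ε) {v : V} {z : ℂ}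
    (hz : ∀ h ∈ G.halfEdges v, ε / 4 < ‖z - p₀ h.1 h.2‖) :
    DifferentiableAt ℂ (outerForm G p₀ ε α ψ v) z :=
  (differentiableAt_regSum ψ hε hz).add (differentiableAt_polSum α fun h hh h0 => by
    have := hz h hh
    rw [h0, sub_self, norm_zero] at this
    linarith)

/-- When the residues of the layers are those prescribed by `α`, the polar sum restores exactly what
`regPart` discards. Building `outerForm` from `α` rather than from these residues makes its polar
part independent of `ψ`. -/
theorem outerForm_eq_sum_cauchyExt (hε : 0 < ε) {v : V} {z : ℂ}
    (hz : ∀ h ∈ G.halfEdges v, ε / 4 < ‖z - p₀ h.1 h.2‖)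
    (hres : ∀ h ∈ G.halfEdges v, layerResidue (ε / 4) (fun θ => ψ h.1 (h.2, θ)) = edgeCoeff α h) :
    outerForm G p₀ ε α ψ v z =
      ∑ h ∈ G.halfEdges v, cauchyExt (p₀ h.1 h.2) (ε / 4) (fun θ => ψ h.1 (h.2, θ)) z := by
  unfold outerForm regSum polSum
  rw [← Finset.sum_add_distrib]
  refine Finset.sum_congr rfl fun h hh => ?_
  rw [cauchyExt_eq ((ψ h.1).continuous_side h.2) (by positivity) (hz h hh), hres h hh]

variable (hG : G.Separated p₀ ε) (hc : Constants ρ c₁ c₂ ε)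
  (hn : NearCentral G Z p₀ ρ c₁ c₂ ε τ p t ξ) (hτ : τ ≤ coordBound c₂ ε ^ 2 / 2)
include hc hn hτ

omit hc in
theorem NearCentral.neck_le (e : E) : ‖t e‖ ≤ coordBound c₂ ε ^ 2 / 2 := (hn.neck e).trans hτ

/-- Inserting `t/φ(z)` in the Cauchy integral for the opposite holomorphic part turns `-φ' (t/φ²)
Q'(t/φ)` into the integral operator with kernel `edgeKernel`; the source is the term `φ' β/φ`. -/
theorem layer_rhs_apply (e : E) (s : Bool) (θ : ℝ) :
    (α e • bddCont (edgeSource (p₀ e) ε (Z.coord p ξ e)) +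
      kernelAct (bddCont (edgeKernel (p₀ e) ε (Z.coord p ξ e) (t e)))
        (traceReg hG ψ e + tracePol hG α e)) (s, θ) =
    neckForm (Z.coord p ξ e s) (edgeCoeff α (e, s)) (t e) 0
      (innerCoeff (Z.coord p ξ e (!s)) (p₀ e (!s)) ε (outerForm G p₀ ε α ψ (G.endpt e (!s))))
      (circleMap (p₀ e s) (ε / 4) θ) := by
  have hch := hn.admissible.centredChart e
  have ht := hn.neck_le hτ e
  have h1 : ∀ x, bddCont (edgeSource (p₀ e) ε (Z.coord p ξ e)) x = _ :=
    bddCont_apply (continuous_edgeSource hc hch (hn.near e)) (norm_edgeSource_le hc hch (hn.near e))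
  have h2 : ∀ x, bddCont (edgeKernel (p₀ e) ε (Z.coord p ξ e) (t e)) x = _ :=
    bddCont_apply (continuous_edgeKernel hc hch (hn.near e) ht)
      (norm_edgeKernel_le hc hch (hn.near e) ht)
  have h3 : ∀ θ', (traceReg hG ψ e + tracePol hG α e) (!s, θ') =
      outerForm G p₀ ε α ψ (G.endpt e (!s)) (circleMap (p₀ e (!s)) (ε / 2) θ') := fun θ' => rfl
  rw [BoundedContinuousFunction.coe_add, Pi.add_apply, BoundedContinuousFunction.coe_smul,
    kernelAct_apply]
  simp only [h1, h2, h3]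
  unfold edgeSource edgeKernel neckForm innerCoeff edgeCoeff
  simp only [Pi.zero_apply, zero_add, smul_eq_mul]
  rw [circleIntegral_mul_eq _ _ _ fun w => (Z.coord p ξ e (!s) w -
    t e / Z.coord p ξ e s (circleMap (p₀ e s) (ε / 4) θ))⁻¹, mul_sub, sub_eq_add_neg]
  congr 1
  · cases s <;> simp <;> ring
  · rw [← intervalIntegral.integral_const_mul, ← mul_assoc, ← intervalIntegral.integral_const_mul,
      ← intervalIntegral.integral_neg]
    congr 1
    funext θ'
    ring

/-- The layer equation says that the layers are the singular parts of forms on the necks. -/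
theorem isLayerSolution_iff : IsLayerSolution hG (Z.coord p ξ) t α ψ ↔ ∀ e s θ, ψ e (s, θ) =
    neckForm (Z.coord p ξ e s) (edgeCoeff α (e, s)) (t e) 0
      (innerCoeff (Z.coord p ξ e (!s)) (p₀ e (!s)) ε (outerForm G p₀ ε α ψ (G.endpt e (!s))))
      (circleMap (p₀ e s) (ε / 4) θ) := by
  constructor
  · intro h e s θ
    rw [← layer_rhs_apply hG hc hn hτ, ← h e]
  · intro h e
    ext ⟨s, θ⟩
    rw [layer_rhs_apply hG hc hn hτ, h e s θ]

end Outer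

/-! ### Regular differentials in terms of layers -/

section Decomposition

variable {V E : Type*} {X : E → Bool → Type*}
  [∀ e s, NormedAddCommGroup (X e s)] [∀ e s, NormedSpace ℂ (X e s)]
  {G : Graph V E} {Z : CoordinateFamily E X} {p₀ : E → Bool → ℂ} {ρ c₁ c₂ ε τ : ℝ}
  {p : E → Bool → ℂ} {t : E → ℂ} {ξ : ∀ e s, X e s} {α : E → ℂ} {f : V → ℂ → ℂ}

theorem lt_norm_coord_of_notMem_core {e : E} {s : Bool} {z : ℂ} (hz : z ∈ Z.disk p ξ e s)
    (h : z ∉ Z.core ρ p t ξ e s) : ‖t e‖ / ρ < ‖Z.coord p ξ e s z‖ :=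
  not_le.1 fun h' => h ⟨hz, h'⟩

theorem AdmissibleCoordinates.differentiableAt_of_mem_disk
    (hA : AdmissibleCoordinates G Z ρ c₁ c₂ p ξ) (hf : IsRegularDifferential G Z ρ p t ξ f)
    {e : E} {s : Bool} {z : ℂ} (hz : z ∈ Z.disk p ξ e s) (h : z ∉ Z.core ρ p t ξ e s) :
    DifferentiableAt ℂ (f (G.endpt e s)) z := by
  have hch := hA.centredChart e s
  refine (hf.holomorphic _).differentiableAt ?_
  filter_upwards [hch.isOpen.mem_nhds hz, (hch.differentiableAt hz).continuousAt.norm.eventually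
    (lt_mem_nhds (lt_norm_coord_of_notMem_core hz h))] with w hw hw' e' s' he hw''
  by_cases hee : (e', s') = (e, s)
  · obtain ⟨rfl, rfl⟩ := Prod.mk.inj hee
    exact absurd hw''.2 (not_le.2 hw')
  · exact Set.disjoint_left.1 (hA.disjoint _ _ _ _ he hee) hw''.1 hw

section Near

variable (hc : Constants ρ c₁ c₂ ε)
  (hn : NearCentral G Z p₀ ρ c₁ c₂ ε τ p t ξ) (hτ : τ ≤ coordBound c₂ ε ^ 2 / 2)
include hc hn hτ

/-- On the removed part `‖z - p‖ ≤ c₂ * coordBound / 16 = ε / 128`, to which the displacement of the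
centre adds less than `ε / 8`. So the removed parts lie strictly inside the circles of radius `ε /
4`. -/
theorem NearCentral.norm_sub_lt_of_mem_core {e : E} {s : Bool} {z : ℂ}
    (hz : z ∈ Z.core ρ p t ξ e s) : ‖z - p₀ e s‖ < 3 * ε / 16 := by
  have hch := hn.admissible.centredChart e s
  have hε := hc.eps_pos
  have h1 := hch.upper z hz.1
  have h2 := hz.2.trans (hch.neck_bounds hc (hn.neck_le hτ e)).2.1
  have h3 := hn.near e s
  have h4 := norm_add_le (z - p e s) (p e s - p₀ e s)
  rw [sub_add_sub_cancel] at h4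
  have h5 : c₂ * coordBound c₂ ε = ε / 8 := by
    have := hc.c₂_pos
    unfold coordBound
    field_simp
  have h6 : c₂ * ‖Z.coord p ξ e s z‖ ≤ c₂ * (coordBound c₂ ε / 16) := by
    have := hc.c₂_pos
    gcongr
  linarith

theorem NearCentral.mem_sphereDomain_of_far {v : V} {z : ℂ}
    (hz : ∀ h ∈ G.halfEdges v, 3 * ε / 16 ≤ ‖z - p₀ h.1 h.2‖) :
    z ∈ sphereDomain G Z ρ p t ξ v := fun e s he hmem =>
  not_lt.2 (hz (e, s) (G.mem_halfEdges.2 he)) (hn.norm_sub_lt_of_mem_core hc hτ hmem)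

theorem NearCentral.differentiableAt_of_far (hf : IsRegularDifferential G Z ρ p t ξ f) {v : V}
    {z : ℂ} (hz : ∀ h ∈ G.halfEdges v, 3 * ε / 16 < ‖z - p₀ h.1 h.2‖) :
    DifferentiableAt ℂ (f v) z := by
  refine (hf.holomorphic v).differentiableAt ?_
  have h1 : ∀ᶠ w in 𝓝 z, ∀ h ∈ G.halfEdges v, 3 * ε / 16 < ‖w - p₀ h.1 h.2‖ :=
    (Finset.eventually_all _).2 fun h hh =>
      (by fun_prop : ContinuousAt (fun w => ‖w - p₀ h.1 h.2‖) z).eventually (lt_mem_nhds (hz h hh))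
  filter_upwards [h1] with w hw
  exact hn.mem_sphereDomain_of_far hc hτ fun h hh => (hw h hh).le

omit hc hn hτ in
/-- A regular differential on one neck. -/
theorem AdmissibleCoordinates.exists_neckForm_edge (hρ : 0 < ρ)
    (hA : AdmissibleCoordinates G Z ρ c₁ c₂ p ξ) (hf : IsRegularDifferential G Z ρ p t ξ f)
    {e : E} (ht : ‖t e‖ < ρ ^ 2) :
    ∃ (Q : Bool → ℂ → ℂ) (b : ℂ), (∀ s, DifferentiableOn ℂ (Q s) (ball 0 ρ)) ∧
      ∀ s, ∀ z ∈ Z.disk p ξ e s, z ∉ Z.core ρ p t ξ e s → f (G.endpt e s) z =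
        neckForm (Z.coord p ξ e s) (if s then b else -b) (t e) (Q s) (Q (!s)) z := by
  have hch := hA.centredChart e
  have hd : ∀ s, ∀ z ∈ Z.disk p ξ e s, ‖t e‖ / ρ < ‖Z.coord p ξ e s z‖ →
      DifferentiableAt ℂ (f (G.endpt e s)) z := fun s z hz h =>
    hA.differentiableAt_of_mem_disk hf hz fun h' => not_le.2 h h'.2
  by_cases ht0 : t e = 0
  · obtain ⟨a, gm, gp, hgm, hgp, hm, hp⟩ := hf.node e ht0
    have key : ∀ s, ∃ Q, DifferentiableOn ℂ Q (ball 0 ρ) ∧ ∀ z ∈ Z.disk p ξ e s, z ≠ p e s →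
        f (G.endpt e s) z = deriv (Z.coord p ξ e s) z *
          (Q (Z.coord p ξ e s z) + (if s then a else -a) / Z.coord p ξ e s z) := by
      intro s
      have hd' : ∀ z ∈ Z.disk p ξ e s, z ≠ p e s → DifferentiableAt ℂ (f (G.endpt e s)) z :=
        fun z hz hne => hd s z hz (by
          rw [ht0, norm_zero, zero_div, norm_pos_iff]
          exact fun h0 => hne ((hch s).eq_center hz h0))
      cases s
      · exact (hch false).toIsChart.exists_neckForm_zero (hch false).center_mem (hch false).center
          hd' hgm hm
      · exact (hch true).toIsChart.exists_neckForm_zero (hch true).center_mem (hch true).center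
          hd' hgp hp
    choose Q hQ hQ' using key
    refine ⟨Q, a, hQ, fun s z hz hzc => ?_⟩
    rw [hQ' s z hz]
    · simp [neckForm, ht0]
    · rintro rfl
      exact hzc ⟨hz, by rw [(hch s).center, norm_zero]; positivity⟩
  · obtain ⟨Q, Q', β, hQ, hQ', h1, h2⟩ := exists_neckForm_of_ne_zero (hch false).toIsChart
      (hch true).toIsChart hρ ht0 ht (hd false) (hf.neck e ht0)
    -- The residue is counted at the `+` end, where it is `-β`.
    refine ⟨fun s => if s then Q' else Q, -β, fun s => by cases s <;> simpa, fun s z hz hzc => ?_⟩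
    have hlt := lt_norm_coord_of_notMem_core hz hzc
    cases s
    · simpa [Graph.endpt] using h1 z hz hlt
    · simpa [Graph.endpt] using h2 z hz hlt

omit hc hn hτ in
theorem HasPeriod.coeff_eq (hρ : 0 < ρ) (hA : AdmissibleCoordinates G Z ρ c₁ c₂ p ξ) {e : E} {a b : ℂ}
    (hper : HasPeriod G Z ρ p t ξ f e a) {Q Q' : ℂ → ℂ} (hQ : DifferentiableOn ℂ Q (ball 0 ρ))
    (hQ' : DifferentiableOn ℂ Q' (ball 0 ρ))
    (hfQ : ∀ z ∈ Z.disk p ξ e true, z ∉ Z.core ρ p t ξ e true → f (G.endpt e true) z =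
        neckForm (Z.coord p ξ e true) b (t e) Q Q' z) : a = 2 * Real.pi * I * b := by
  have hch := hA.centredChart e true
  obtain ⟨r, hr, hsub, hcore, rfl⟩ := hper
  have hnc : ∀ w ∈ sphere (p e true) r, w ∉ Z.core ρ p t ξ e true := fun w hw hw' => by
    have h1 := hcore hw'
    rw [mem_sphere] at hw
    rw [mem_ball, hw] at h1
    exact lt_irrefl _ h1
  have hcont : ContinuousOn (fun w => ‖Z.coord p ξ e true w‖) (sphere (p e true) r) :=
    (hch.differentiableOn.continuousOn.mono (sphere_subset_closedBall.trans hsub)).norm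
  -- The circle representing the period is arbitrary. By compactness the coordinate has a positive
  -- minimum on it, larger than `‖t‖ / ρ`, which provides the radius `m` separating the circle from
  -- the removed part.
  obtain ⟨w₀, hw₀, hmin⟩ := (isCompact_sphere (p e true) r).exists_isMinOn
    (NormedSpace.sphere_nonempty.2 hr.le) hcont
  have hlt := lt_norm_coord_of_notMem_core (hsub (sphere_subset_closedBall hw₀)) (hnc w₀ hw₀)
  obtain ⟨m, hm1, hm2⟩ := exists_between hlt
  have hm0 : 0 < m := lt_of_le_of_lt (by positivity) hm1
  have h1 : (∮ z in C(p e true, r), f (G.tgt e) z) =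
      ∮ z in C(p e true, r), neckForm (Z.coord p ξ e true) b (t e) Q Q' z :=
    circleIntegral.integral_congr hr.le fun w hw =>
      hfQ w (hsub (sphere_subset_closedBall hw)) (hnc w hw)
  rw [h1]
  refine hch.toIsChart.circleIntegral_neckForm_residue hQ hQ' hρ hr.le hsub
    (mem_ball_self hr) hch.center hm0 (fun w hw => hm2.trans_le (hmin hw)) ?_
  rw [div_lt_iff₀ hρ] at hm1
  linarith

/-- A regular differential on all the necks. -/
theorem NearCentral.exists_neckForm (hf : HasPeriods G Z ρ p₀ ε p t ξ α f) :
    ∃ Q : E → Bool → ℂ → ℂ, (∀ e s, DifferentiableOn ℂ (Q e s) (ball 0 ρ)) ∧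
      ∀ e s, ∀ z ∈ Z.disk p ξ e s, z ∉ Z.core ρ p t ξ e s → f (G.endpt e s) z =
        neckForm (Z.coord p ξ e s) (edgeCoeff α (e, s)) (t e) (Q e s) (Q e (!s)) z := by
  choose Q b hQ hfQ using fun e => hn.admissible.exists_neckForm_edge hc.rho_pos hf.regular
    ((hn.admissible.centredChart e true).neck_bounds hc (hn.neck_le hτ e)).1
  refine ⟨Q, hQ, fun e s z hz hzc => ?_⟩
  have h1 := (hf.periods e).coeff_eq hc.rho_pos hn.admissible (hQ e true) (hQ e false)
    (by simpa using hfQ e true)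
  have h2 : edgeCoeff α (e, s) = if s then b e else -b e := by
    unfold edgeCoeff
    cases s
    · simp only [h1, Bool.false_eq_true, if_false, mul_neg,
        inv_mul_cancel_left₀ two_pi_I_ne_zero']
    · simp only [h1, if_true, inv_mul_cancel_left₀ two_pi_I_ne_zero']
  rw [h2]
  exact hfQ e s z hz hzc

end Near

end Decomposition

/-! ### Cauchy integrals inside and outside a circle, and bounds up to the boundary -/

theorem norm_cauchyExt_le_of_inside {a : ℂ} {r : ℝ} {ψ : ℝ → ℂ} {z : ℂ} {M d : ℝ} (hr : 0 ≤ r)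
    (hM : ∀ θ, ‖ψ θ‖ ≤ M) (hd : 0 < d) (h : ‖z - a‖ + d ≤ r) :
    ‖cauchyExt a r ψ z‖ ≤ r * M / d := by
  have h1 : ‖∫ θ in (0:ℝ)..(2 * Real.pi), (circleMap 0 r θ * I * ψ θ) * (z - circleMap a r θ)⁻¹‖
      ≤ (r * M * d⁻¹) * |2 * Real.pi - 0| := by
    refine intervalIntegral.norm_integral_le_of_norm_le_const fun θ _ => ?_
    have h2 := norm_circleMap_sub_ge (a := a) (z := z) (r := r) θ
    have h3 : d ≤ ‖z - circleMap a r θ‖ := by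
      refine le_trans ?_ h2
      rw [abs_of_nonneg hr]
      exact le_trans (by linarith) (neg_le_abs _)
    rw [norm_mul, norm_mul, norm_mul, norm_inv, Complex.norm_I, mul_one, norm_circleMap_zero,
      abs_of_nonneg hr]
    have h5 := (norm_nonneg _).trans (hM θ)
    gcongr
    exact hM θ
  have h2 : ‖(2 * Real.pi * I : ℂ)‖ = 2 * Real.pi := by simp [abs_of_pos Real.pi_pos]
  have h3 := Real.pi_pos
  rw [cauchyExt, norm_mul, norm_inv, h2, inv_mul_le_iff₀ (by positivity)]
  refine h1.trans (le_of_eq ?_)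
  rw [sub_zero, abs_of_pos (by positivity)]
  ring

/-- The Cauchy integral of a function that is holomorphic in the disk vanishes outside the disk. -/
theorem cauchyExt_eq_zero {q : ℂ → ℂ} {a z : ℂ} {r : ℝ} (hr : 0 < r)
    (hq : ∀ w ∈ closedBall a r, DifferentiableAt ℂ q w) (hz : r < ‖z - a‖) :
    cauchyExt a r (fun θ => q (circleMap a r θ)) z = 0 := by
  have hne : ∀ w ∈ closedBall a r, z - w ≠ 0 := fun w hw h0 => by
    rw [sub_eq_zero.1 h0, ← dist_eq_norm] at hz
    exact not_le.2 hz hw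
  have hd : ∀ w ∈ closedBall a r, DifferentiableAt ℂ (fun w => (z - w)⁻¹ * q w) w := fun w hw =>
    ((differentiableAt_id.const_sub z).inv (hne w hw)).mul (hq w hw)
  rw [cauchyExt_comp, Complex.circleIntegral_eq_zero_of_differentiable_on_off_countable hr.le
    (s := ∅) countable_empty (fun w hw => (hd w hw).continuousAt.continuousWithinAt)
    (fun w hw => hd w (ball_subset_closedBall hw.1)), mul_zero]

section Trace

variable {V E : Type*} {G : Graph V E} {p₀ : E → Bool → ℂ} {ε : ℝ}

/-- For two touching disks: by the parallelogram law `u` and `u'` are opposite, so a step along `I *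
u` is tangent to both circles and increases both distances. -/
theorem lt_norm_of_norm_eq {u u' : ℂ} (hε : 0 < ε) (hu : ‖u‖ = ε) (hu' : ‖u'‖ = ε)
    (h : 2 * ε ≤ ‖u - u'‖) {l : ℝ} (hl : 0 < l) : ε < ‖u' + l * I * u‖ := by
  have h1 := parallelogram_law_with_norm ℝ u u'
  rw [hu, hu'] at h1
  have h2 : ‖u + u'‖ = 0 := by
    have := norm_nonneg (u + u')
    nlinarith
  have h3 : u' + l * I * u = (-1 + l * I) * u := by
    have := norm_eq_zero.1 h2
    linear_combination this
  rw [h3, norm_mul, hu]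
  have h4 : 1 < ‖(-1 + l * I : ℂ)‖ := by
    have : (-1 + l * I : ℂ) = ((-1 : ℝ) : ℂ) + (l : ℂ) * I := by push_cast; rfl
    rw [this, Complex.norm_add_mul_I, Real.lt_sqrt (by norm_num)]
    nlinarith
  nlinarith

/-- A bound on the domain extends to the circles of radius `ε` in its boundary. -/
theorem Graph.Separated.norm_le_of_norm_sub_eq (hG : G.Separated p₀ ε) {f : ℂ → ℂ} {M : ℝ}
    {h : E × Bool} (hf : ∀ z, (∀ h' ∈ G.halfEdges (G.endpt h.1 h.2), ε ≤ ‖z - p₀ h'.1 h'.2‖) →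
      ContinuousAt f z) (hM : ∀ z ∈ Omega G p₀ ε (G.endpt h.1 h.2), ‖f z‖ ≤ M) {z : ℂ}
    (hz : ‖z - p₀ h.1 h.2‖ = ε) : ‖f z‖ ≤ M := by
  set a := p₀ h.1 h.2 with ha
  have hε := hG.pos
  -- A boundary point is approached along the tangent. This path leaves all the closed disks at
  -- once, even where two of them touch and a radial path would enter the other disk.
  set γ : ℝ → ℂ := fun l => z + l * I * (z - a) with hγ
  have hγc : Continuous γ := by fun_prop
  have hγ0 : γ 0 = z := by simp [hγ]
  have hev : ∀ᶠ l in 𝓝[>] (0:ℝ), ∀ h' ∈ G.halfEdges (G.endpt h.1 h.2),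
      ε < ‖γ l - p₀ h'.1 h'.2‖ := by
    refine (Finset.eventually_all _).2 fun h' hh' => ?_
    have hle := hG.le_norm_sub le_rfl hz hh'
    rcases hle.lt_or_eq with hlt | heq
    · have hcont : ContinuousAt (fun l => ‖γ l - p₀ h'.1 h'.2‖) 0 :=
        (hγc.sub continuous_const).norm.continuousAt
      exact (hcont.eventually (lt_mem_nhds (by simpa only [hγ0] using hlt))).filter_mono nhdsWithin_le_nhds
    · filter_upwards [self_mem_nhdsWithin] with l hl
      have e1 : γ l - p₀ h'.1 h'.2 = (z - p₀ h'.1 h'.2) + l * I * (z - a) := by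
        simp only [hγ]; ring
      rw [e1]
      by_cases hhh : h' = h
      · rw [hhh, ← ha]
        have e2 : (z - a) + l * I * (z - a) = (1 + l * I) * (z - a) := by ring
        have h4 : 1 < ‖(1 + l * I : ℂ)‖ := by
          have : (1 + l * I : ℂ) = ((1 : ℝ) : ℂ) + (l : ℂ) * I := by push_cast; rfl
          rw [this, Complex.norm_add_mul_I, Real.lt_sqrt (by norm_num)]
          have : 0 < l := hl
          nlinarith
        rw [e2, norm_mul, hz]
        nlinarith
      · refine lt_norm_of_norm_eq hε hz heq.symm ?_ hl
        rw [sub_sub_sub_cancel_left]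
        exact hG.sep h' h (Graph.mem_halfEdges.1 hh') hhh
  have hlim : Tendsto (fun l => ‖f (γ l)‖) (𝓝[>] 0) (𝓝 ‖f z‖) := by
    have h1 : ContinuousAt f (γ 0) := by
      rw [hγ0]
      exact hf z fun h' hh' => hG.le_norm_sub le_rfl hz hh'
    have h2 : ContinuousAt (fun l => ‖f (γ l)‖) 0 :=
      (ContinuousAt.comp (f := γ) h1 hγc.continuousAt).norm
    have h3 := h2.tendsto
    simp only [hγ0] at h3
    exact h3.mono_left nhdsWithin_le_nhds
  refine le_of_tendsto hlim ?_
  filter_upwards [hev] with l hl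
  exact hM _ fun e s he => hl (e, s) (Graph.mem_halfEdges.2 he)

end Trace

/-! ### From regular differentials to layers -/

section Layers

variable {V E : Type*} {X : E → Bool → Type*}
  [∀ e s, NormedAddCommGroup (X e s)] [∀ e s, NormedSpace ℂ (X e s)]
  {G : Graph V E} {Z : CoordinateFamily E X} {p₀ : E → Bool → ℂ} {ρ c₁ c₂ ε τ : ℝ}
  {p : E → Bool → ℂ} {t : E → ℂ} {ξ : ∀ e s, X e s} {α : E → ℂ} {f f' : V → ℂ → ℂ}
  {ψ : E → Layer}

variable (hG : G.Separated p₀ ε) (hc : Constants ρ c₁ c₂ ε)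
  (hn : NearCentral G Z p₀ ρ c₁ c₂ ε τ p t ξ) (hτ : τ ≤ coordBound c₂ ε ^ 2 / 2)
include hG hc hn hτ

omit hc hn hτ in
omit [∀ e s, NormedSpace ℂ (X e s)] [∀ e s, NormedAddCommGroup (X e s)] in
theorem Graph.Separated.le_norm_sphere_sub {e : E} {s : Bool} {r : ℝ} (hr : r ≤ ε) {z : ℂ}
    (hz : z ∈ sphere (p₀ e s) r) {h : E × Bool} (hh : h ∈ G.halfEdges (G.endpt e s)) :
    r ≤ ‖z - p₀ h.1 h.2‖ := by
  rw [mem_sphere, dist_eq_norm] at hz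
  exact hG.le_norm_sub (h := (e, s)) hr hz hh

/-- The singular parts of a regular differential on the necks solve the layer equation. -/
theorem NearCentral.exists_layers (hf : HasPeriods G Z ρ p₀ ε p t ξ α f) :
    ∃ ψ, IsLayerSolution hG (Z.coord p ξ) t α ψ ∧
      (∀ e s z, ε / 4 < ‖z - p₀ e s‖ → cauchyExt (p₀ e s) (ε / 4)
        (fun θ => f (G.endpt e s) (circleMap (p₀ e s) (ε / 4) θ)) z =
          cauchyExt (p₀ e s) (ε / 4) (fun θ => ψ e (s, θ)) z) ∧
      ∀ v z, (∀ h ∈ G.halfEdges v, ε / 4 < ‖z - p₀ h.1 h.2‖) → f v z = outerForm G p₀ ε α ψ v z := by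
  have hε := hc.eps_pos
  have hρ := hc.rho_pos
  have hm := hc.coordBound_pos
  obtain ⟨Q, hQ, hfQ⟩ := hn.exists_neckForm hc hτ hf
  set N : E → Bool → ℂ → ℂ := fun e s =>
    neckForm (Z.coord p ξ e s) (edgeCoeff α (e, s)) (t e) 0 (Q e (!s)) with hN
  have hch := fun e s => hn.admissible.centredChart e s
  have hball := fun e s {r : ℝ} (hr : r ≤ 3 * ε / 4) =>
    (hch e s).closedBall_subset hc.c₁_pos hc.eps_le hε (hn.near e s) hr
  have htb := fun e => (hch e true).neck_bounds hc (hn.neck_le hτ e)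
  have hφ : ∀ e s w, ‖w - p₀ e s‖ = ε / 4 → coordBound c₂ ε < ‖Z.coord p ξ e s w‖ :=
    fun e s w hw => (hch e s).lt_norm_sphere hc (hn.near e s) le_rfl (by linarith)
      (by rwa [mem_sphere, dist_eq_norm])
  have hφ0 : ∀ e s w, ‖w - p₀ e s‖ = ε / 4 → Z.coord p ξ e s w ≠ 0 := fun e s w hw h0 => by
    have := hφ e s w hw
    rw [h0, norm_zero] at this
    linarith
  have hNd : ∀ e s w, ‖w - p₀ e s‖ = ε / 4 → DifferentiableAt ℂ (N e s) w := fun e s w hw =>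
    (hch e s).toIsChart.differentiableAt_neckForm (differentiableOn_const 0) (hQ e (!s))
      (hball e s (r := ε / 4) (by linarith) (by rw [mem_closedBall, dist_eq_norm, hw]))
      (hφ0 e s w hw) ((htb e).2.2.1.trans_lt (by have := hφ e s w hw; gcongr))
  set ψ : E → Layer := fun e => bddCont fun x : Bool × ℝ =>
    N e x.1 (circleMap (p₀ e x.1) (ε / 4) x.2) with hψ
  have hψa : ∀ e s θ, ψ e (s, θ) = N e s (circleMap (p₀ e s) (ε / 4) θ) := by
    intro e s θ
    choose M hM using fun s => exists_bound_circle (f := N e s) (a := p₀ e s) (r := ε / 4)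
      (by positivity) fun w hw => (hNd e s w hw).continuousAt
    refine bddCont_apply (C := max (M true) (M false)) ?_ ?_ _
    · rw [continuous_prod_of_discrete_left]
      exact fun s => continuous_comp_circleMap (by positivity) fun w hw =>
        (hNd e s w hw).continuousAt
    · rintro ⟨s, θ⟩
      cases s
      · exact (hM false θ).trans (le_max_right _ _)
      · exact (hM true θ).trans (le_max_left _ _)
  have hcauchy : ∀ e s z, ε / 4 < ‖z - p₀ e s‖ → cauchyExt (p₀ e s) (ε / 4)
      (fun θ => f (G.endpt e s) (circleMap (p₀ e s) (ε / 4) θ)) z =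
        cauchyExt (p₀ e s) (ε / 4) (fun θ => ψ e (s, θ)) z := by
    intro e s z hzz
    have hq : ∀ w ∈ closedBall (p₀ e s) (ε / 4), DifferentiableAt ℂ
        (fun w => deriv (Z.coord p ξ e s) w * Q e s (Z.coord p ξ e s w)) w := fun w hw => by
      have hw' := hball e s (r := ε / 4) (by linarith) hw
      -- The trace of `f` and the layer differ by the part of the neck form that is holomorphic in
      -- the disk, whose Cauchy integral vanishes outside.
      have hch' := (hch e s).toIsChart
      exact (hch'.deriv_differentiableOn.mul ((hQ e s).comp hch'.differentiableOn
        hch'.bijOn.mapsTo)).differentiableAt (hch'.isOpen.mem_nhds hw')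
    have e1 : (fun θ => f (G.endpt e s) (circleMap (p₀ e s) (ε / 4) θ)) = fun θ =>
        (fun w => deriv (Z.coord p ξ e s) w * Q e s (Z.coord p ξ e s w))
          (circleMap (p₀ e s) (ε / 4) θ) + ψ e (s, θ) := by
      funext θ
      have hw : ‖circleMap (p₀ e s) (ε / 4) θ - p₀ e s‖ = ε / 4 := by
        simp [circleMap, abs_of_pos hε]
      rw [hψa, hfQ e s _ (hball e s (r := ε / 4) (by linarith)
        (by rw [mem_closedBall, dist_eq_norm, hw])) fun hcore => ?_, neckForm_eq_add]
      have := hn.norm_sub_lt_of_mem_core hc hτ hcore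
      linarith
    rw [e1, cauchyExt_add (continuous_comp_circleMap (by positivity) fun w hw =>
        (hq w (by rw [mem_closedBall, dist_eq_norm, hw])).continuousAt)
        ((ψ e).continuous_side s) (by rw [abs_of_pos (by positivity)]; exact hzz.ne'),
      cauchyExt_eq_zero (by positivity) hq hzz, zero_add]
  have hout : ∀ v z, (∀ h ∈ G.halfEdges v, ε / 4 < ‖z - p₀ h.1 h.2‖) →
      f v z = outerForm G p₀ ε α ψ v z := by
    intro v z hz
    rw [outerForm_eq_sum_cauchyExt hε hz fun h _ => (hch h.1 h.2).layerResidue_neckForm hc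
        (hn.near _ _) (hQ h.1 (!h.2)) hρ (htb _).2.2.1 (hψa h.1 h.2),
      exterior_cauchy (G.halfEdges v) (fun h => p₀ h.1 h.2) (r := ε / 4) (R := ε) (by positivity)
        (by linarith) ?_ ?_ (hf.regular.holomorphic_infty v).tendsto hz]
    · refine Finset.sum_congr rfl fun h hh => ?_
      obtain ⟨e, s⟩ := h
      rw [Graph.mem_halfEdges] at hh
      subst hh
      exact hcauchy e s z (hz (e, s) (Graph.mem_halfEdges.2 rfl))
    · intro h hh h' hh' hne
      refine ball_disjoint_ball ?_
      rw [Graph.mem_halfEdges] at hh hh'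
      rw [dist_eq_norm]
      linarith [hG.sep h h' (hh.trans hh'.symm) hne]
    · exact fun z hz => hn.differentiableAt_of_far hc hτ hf.regular fun h hh => by
        have := hz h hh
        linarith
  refine ⟨ψ, (isLayerSolution_iff hG hc hn hτ).2 fun e s θ => ?_, hcauchy, hout⟩
  have hw : ‖circleMap (p₀ e s) (ε / 4) θ - p₀ e s‖ = ε / 4 := by
    simp [circleMap, abs_of_pos hε]
  have h1 := hφ e s _ hw
  rw [hψa, hN]
  unfold neckForm
  -- On the opposite circle of radius `ε / 2` the outer form is `f`, so its inner coefficient is `Q`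
  -- itself; `t/φ` falls in the disk where this is valid.
  rw [(hch e (!s)).innerCoeff_neckForm hc (hn.near e (!s)) (hQ e (!s)) (hQ e (!!s)) hρ
    (htb e).2.2.1]
  · intro w hw
    have hfar := fun h hh => hG.le_norm_sphere_sub (h := h) (by linarith) hw hh
    rw [← hout _ w fun h hh => by have := hfar h hh; linarith]
    refine hfQ e (!s) w (hball e (!s) (by linarith) (sphere_subset_closedBall hw)) fun hcore => ?_
    have := hn.norm_sub_lt_of_mem_core hc hτ hcore
    rw [mem_sphere, dist_eq_norm] at hw
    linarith
  · rw [mem_ball_zero_iff, norm_div, div_lt_iff₀ (hm.trans h1)]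
    exact (htb e).2.2.2.trans_lt (by gcongr)

/-- The layers of a bounded regular differential are bounded. -/
theorem NearCentral.norm_layer_le (hf : IsRegularDifferential G Z ρ p t ξ f)
    (hψ : IsLayerSolution hG (Z.coord p ξ) t α ψ)
    (hcauchy : ∀ e s z, ε / 4 < ‖z - p₀ e s‖ → cauchyExt (p₀ e s) (ε / 4)
      (fun θ => f (G.endpt e s) (circleMap (p₀ e s) (ε / 4) θ)) z =
        cauchyExt (p₀ e s) (ε / 4) (fun θ => ψ e (s, θ)) z)
    (hout : ∀ v z, (∀ h ∈ G.halfEdges v, ε / 4 < ‖z - p₀ h.1 h.2‖) →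
      f v z = outerForm G p₀ ε α ψ v z)
    {A M : ℝ} (hA : ∀ e, ‖α e‖ ≤ A) (hM0 : 0 ≤ M) (hM : ∀ v, ∀ z ∈ Omega G p₀ ε v, ‖f v z‖ ≤ M)
    (hk : kernelConst ρ c₂ ε * τ ≤ 1 / 2) (e : E) :
    ‖ψ e‖ ≤ 2 * (A * (8 * ρ / ε / coordBound c₂ ε) + M) := by
  have hε := hc.eps_pos
  have hρ := hc.rho_pos
  have hm := hc.coordBound_pos
  have hch := fun s => hn.admissible.centredChart e s
  -- The trace at radius `ε / 2` is estimated by the Cauchy formula in the annulus between `ε / 4`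
  -- and `ε`: the inner circle contributes `‖ψ e‖`, the outer one `2 * M`. Only the layer at `e`
  -- enters, so no prior bound uniform in `e` is used.
  have htrace : ‖traceReg hG ψ e + tracePol hG α e‖ ≤ ‖ψ e‖ + 2 * M := by
    refine (BoundedContinuousFunction.norm_le (by positivity)).2 ?_
    rintro ⟨s, θ⟩
    set z := circleMap (p₀ e s) (ε / 2) θ with hz
    have hza : ‖z - p₀ e s‖ = ε / 2 := by simp [hz, circleMap, abs_of_pos hε]
    have e1 : (traceReg hG ψ e + tracePol hG α e) (s, θ) = f (G.endpt e s) z := by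
      rw [hout _ z fun h hh => by
        have := hG.le_norm_circleMap_sub e s θ hh
        linarith]
      rfl
    have hfar : ∀ w, ε / 4 ≤ ‖w - p₀ e s‖ → ‖w - p₀ e s‖ ≤ ε → ∀ h ∈ G.halfEdges (G.endpt e s),
        ε / 4 ≤ ‖w - p₀ h.1 h.2‖ := by
      intro w hw hw' h hh
      by_cases hhh : h = (e, s)
      · rw [hhh]; exact hw
      · have h1 := hG.sep h (e, s) (Graph.mem_halfEdges.1 hh) hhh
        have h2 := norm_sub_le (w - p₀ e s) (w - p₀ h.1 h.2)
        rw [sub_sub_sub_cancel_left] at h2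
        simp only at h1
        linarith
    have hfM : ∀ θ', ‖f (G.endpt e s) (circleMap (p₀ e s) ε θ')‖ ≤ M := fun θ' =>
      hG.norm_le_of_norm_sub_eq (h := (e, s)) (fun w hw =>
        (hn.differentiableAt_of_far hc hτ hf fun h hh => by
          have := hw h hh
          linarith).continuousAt) (hM _) (by simp [circleMap, abs_of_pos hε])
    rw [e1, annulus_cauchy_ext (f := f (G.endpt e s)) (a := p₀ e s) (s₀ := ε / 4) (s₁ := ε)
      (by positivity) (fun w hw hw' => hn.differentiableAt_of_far hc hτ hf fun h hh => by
          have := hfar w hw hw' h hh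
          linarith) (by linarith) (by linarith), hcauchy e s z (by linarith)]
    refine (norm_sub_le _ _).trans (add_le_add ?_ ?_)
    · refine (norm_cauchyExt_le (d := ε / 4) (by positivity) ((ψ e).norm_side_le s) (by positivity)
        (by linarith)).trans (le_of_eq ?_)
      field_simp
    · refine (norm_cauchyExt_le_of_inside (d := ε / 2) hε.le hfM (by positivity)
        (by linarith)).trans (le_of_eq ?_)
      field_simp
  have hact : ‖kernelAct (bddCont (edgeKernel (p₀ e) ε (Z.coord p ξ e) (t e)))
      (traceReg hG ψ e + tracePol hG α e)‖ ≤ 1 / 2 * (‖ψ e‖ + 2 * M) :=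
    ((kernelAct _).le_of_opNorm_le ((norm_kernelAct_edgeKernel_le hc hch (hn.near e) hτ
      (hn.neck e)).trans hk) _).trans (by gcongr)
  have hsrc : ‖α e • bddCont (edgeSource (p₀ e) ε (Z.coord p ξ e))‖ ≤
      A * (8 * ρ / ε / coordBound c₂ ε) := by
    rw [norm_smul]
    have h1 := norm_bddCont_le (continuous_edgeSource hc hch (hn.near e))
      (norm_edgeSource_le hc hch (hn.near e)) (by positivity)
    have h2 := (norm_nonneg _).trans (hA e)
    gcongr
    exact hA e
  -- The kernel has norm at most `1 / 2`, so half of `‖ψ e‖` is absorbed on the left.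
  have h1 : ‖ψ e‖ ≤ A * (8 * ρ / ε / coordBound c₂ ε) + 1 / 2 * (‖ψ e‖ + 2 * M) := by
    conv_lhs => rw [hψ e]
    exact (norm_add_le _ _).trans (add_le_add hsrc hact)
  linarith

/-- A regular differential is determined by its values outside the disks of radius `ε / 4`. -/
theorem NearCentral.eq_of_eq_outside (hf : HasPeriods G Z ρ p₀ ε p t ξ α f)
    (hf' : HasPeriods G Z ρ p₀ ε p t ξ α f')
    (hout : ∀ v z, (∀ h ∈ G.halfEdges v, ε / 4 < ‖z - p₀ h.1 h.2‖) → f v z = f' v z) : f = f' := by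
  have hε := hc.eps_pos
  have hρ := hc.rho_pos
  have hm := hc.coordBound_pos
  obtain ⟨Q, hQ, hfQ⟩ := hn.exists_neckForm hc hτ hf
  obtain ⟨Q', hQ', hfQ'⟩ := hn.exists_neckForm hc hτ hf'
  have hch := fun e s => hn.admissible.centredChart e s
  have hball := fun e s {r : ℝ} (hr : r ≤ 3 * ε / 4) =>
    (hch e s).closedBall_subset hc.c₁_pos hc.eps_le hε (hn.near e s) hr
  have htb := fun e => (hch e true).neck_bounds hc (hn.neck_le hτ e)
  have hnc : ∀ e s, ∀ w ∈ sphere (p₀ e s) (ε / 2), w ∉ Z.core ρ p t ξ e s := fun e s w hw hcore => by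
    have := hn.norm_sub_lt_of_mem_core hc hτ hcore
    rw [mem_sphere, dist_eq_norm] at hw
    linarith
  -- Near `0` both functions are recovered from the same values on the circle of radius `ε / 2`; the
  -- identity theorem extends the equality to the disk, hence to the whole neck.
  have hQQ : ∀ e s, EqOn (Q e s) (Q' e s) (ball 0 ρ) := by
    intro e s
    refine ((hQ e s).analyticOnNhd isOpen_ball).eqOn_of_preconnected_of_eventuallyEq
      ((hQ' e s).analyticOnNhd isOpen_ball) (convex_ball _ _).isPreconnected (mem_ball_self hρ) ?_
    filter_upwards [ball_mem_nhds (0:ℂ) hm] with η hη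
    rw [← (hch e s).innerCoeff_neckForm hc (hn.near e s) (hQ e s) (hQ e (!s)) hρ (htb e).2.2.1
      (F := f (G.endpt e s)) (fun w hw => hfQ e s w (hball e s (by linarith)
        (sphere_subset_closedBall hw)) (hnc e s w hw)) hη]
    refine (hch e s).innerCoeff_neckForm (β := edgeCoeff α (e, s)) hc (hn.near e s) (hQ' e s)
      (hQ' e (!s)) hρ (htb e).2.2.1 (fun w hw => ?_) hη
    rw [hout _ w fun h hh => by
      have := hG.le_norm_sphere_sub (h := h) (by linarith) hw hh
      linarith]
    exact hfQ' e s w (hball e s (by linarith) (sphere_subset_closedBall hw)) (hnc e s w hw)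
  funext v z
  by_cases hdisk : ∃ e s, G.endpt e s = v ∧ z ∈ Z.disk p ξ e s
  · obtain ⟨e, s, rfl, hz⟩ := hdisk
    by_cases hcore : z ∈ Z.core ρ p t ξ e s
    · have hoff : z ∉ sphereDomain G Z ρ p t ξ (G.endpt e s) := fun h => h e s rfl hcore
      rw [hf.regular.eq_zero_off _ z hoff, hf'.regular.eq_zero_off _ z hoff]
    · rw [hfQ e s z hz hcore, hfQ' e s z hz hcore]
      have hlt := lt_norm_coord_of_notMem_core hz hcore
      unfold neckForm
      have hpos : 0 < ‖Z.coord p ξ e s z‖ := lt_of_le_of_lt (by positivity) hlt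
      rw [hQQ e s ((hch e s).bijOn.mapsTo hz), hQQ e (!s) (show t e / _ ∈ ball (0:ℂ) ρ by
        rw [mem_ball_zero_iff, norm_div, div_lt_iff₀ hpos]
        rw [div_lt_iff₀ hρ] at hlt
        linarith)]
  · push Not at hdisk
    refine hout v z fun h hh => ?_
    by_contra! hle
    refine hdisk h.1 h.2 (Graph.mem_halfEdges.1 hh) (hball h.1 h.2 (r := ε / 4) (by linarith) ?_)
    rwa [mem_closedBall, dist_eq_norm]

end Layers

/-! ### Regular differentials from layers -/

theorem HolomorphicAtInfty.congr {f g : ℂ → ℂ} (hf : HolomorphicAtInfty f)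
    (h : ∀ᶠ z in Bornology.cobounded ℂ, f z = g z) : HolomorphicAtInfty g := by
  obtain ⟨k, hk, hkf⟩ := hf
  refine ⟨k, hk, ?_⟩
  filter_upwards [hkf, Filter.tendsto_inv₀_nhdsNE_zero.eventually h] with w h1 h2
  rw [h1, h2]

/-- With `z = 1/w`, each `(z - a)⁻¹ / w²` equals `1/w + a/(1 - a w)`; the poles `1/w` cancel because
the residues add up to zero. -/
theorem holomorphicAtInfty_sum_inv {ι : Type*} (s : Finset ι) (b a : ι → ℂ)
    (h : ∑ i ∈ s, b i = 0) : HolomorphicAtInfty fun z => ∑ i ∈ s, b i * (z - a i)⁻¹ := by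
  refine ⟨fun w => -∑ i ∈ s, b i * a i * (1 - a i * w)⁻¹, ?_, ?_⟩
  · refine AnalyticAt.neg (Finset.analyticAt_fun_sum _ fun i _ => ?_)
    refine analyticAt_const.mul (AnalyticAt.inv (by fun_prop) (by simp))
  · have h1 : ∀ᶠ w in 𝓝[≠] (0:ℂ), ∀ i ∈ s, 1 - a i * w ≠ 0 := by
      refine (Filter.eventually_all_finset s).2 fun i _ => ?_
      have : ContinuousAt (fun w => 1 - a i * w) 0 := by fun_prop
      exact (this.eventually_ne (by simp)).filter_mono nhdsWithin_le_nhds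
    filter_upwards [h1, self_mem_nhdsWithin] with w hw hw0
    have hw0' : w ≠ 0 := hw0
    have e1 : ∀ i ∈ s, b i * (w⁻¹ - a i)⁻¹ / w ^ 2 =
        b i * w⁻¹ + b i * a i * (1 - a i * w)⁻¹ := fun i hi => by
      have h2 := hw i hi
      have h3 : w⁻¹ - a i = (1 - a i * w) * w⁻¹ := by field_simp
      rw [h3]
      field_simp
      ring
    rw [neg_div, Finset.sum_div, Finset.sum_congr rfl e1, Finset.sum_add_distrib,
      ← Finset.sum_mul, h, zero_mul, zero_add]

/-- Dividing `φ` by `z - q` gives `φ'/φ = g(z)/(z - q)` with `g q = 1`, so `β φ'/φ` has residue `β`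
in the variable `z` as well. -/
theorem CentredChart.exists_simple_pole {φ Q : ℂ → ℂ} {D : Set ℂ} {ρ c₁ c₂ : ℝ} {q : ℂ}
    (h : CentredChart φ D ρ c₁ c₂ q) (hQ : DifferentiableOn ℂ Q (ball 0 ρ)) (β : ℂ) :
    ∃ A : ℂ → ℂ, AnalyticAt ℂ A q ∧ ∀ᶠ z in 𝓝[≠] q,
      neckForm φ β 0 Q 0 z = β / (z - q) + A z := by
  have hD : D ∈ 𝓝 q := h.isOpen.mem_nhds h.center_mem
  set k := dslope φ q with hk
  have hkd : DifferentiableOn ℂ k D := (Complex.differentiableOn_dslope hD).2 h.differentiableOn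
  have hφk : ∀ z, φ z = (z - q) * k z := fun z => by
    have := sub_smul_dslope φ q z
    rw [h.center, sub_zero, smul_eq_mul] at this
    exact this.symm
  have hk0 : k q ≠ 0 := by
    rw [hk, dslope_same]
    exact h.toIsChart.deriv_ne_zero h.center_mem
  set g : ℂ → ℂ := fun z => deriv φ z / k z with hg
  have hne : ∀ z ∈ D, k z ≠ 0 := by
    intro z hz h0
    rcases eq_or_ne z q with rfl | hzq
    · exact hk0 h0
    · refine hzq (h.eq_center hz ?_)
      rw [hφk, h0, mul_zero]
  have hgd : DifferentiableOn ℂ g D := h.toIsChart.deriv_differentiableOn.div hkd hne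
  have hgq : g q = 1 := by
    simp only [hg, hk, dslope_same]
    exact div_self (h.toIsChart.deriv_ne_zero h.center_mem)
  have hsd : DifferentiableOn ℂ (dslope g q) D := (Complex.differentiableOn_dslope hD).2 hgd
  refine ⟨fun z => β * dslope g q z + deriv φ z * Q (φ z), ?_, ?_⟩
  · exact DifferentiableOn.analyticAt ((hsd.const_mul β).add
      (h.toIsChart.deriv_differentiableOn.mul (hQ.comp h.differentiableOn h.bijOn.mapsTo))) hD
  · filter_upwards [self_mem_nhdsWithin, nhdsWithin_le_nhds hD] with z hz hzD
    have hzq : z - q ≠ 0 := sub_ne_zero.2 hz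
    have h1 := sub_smul_dslope g q z
    rw [hgq, smul_eq_mul] at h1
    have h2 : dslope g q z = (g z - 1) / (z - q) := by
      rw [eq_div_iff hzq, ← h1]
      ring
    have h3 := hne z hzD
    have h4 : deriv φ z / φ z = g z / (z - q) := by
      rw [hφk z]
      simp only [hg]
      field_simp
    have h5 : β * (deriv φ z / φ z) = β / (z - q) + β * dslope g q z := by
      rw [h4, h2]
      field_simp
      ring
    simp only [neckForm, zero_div, zero_mul, sub_zero]
    linear_combination h5

section Construction

variable {V E : Type*} {X : E → Bool → Type*}
  [∀ e s, NormedAddCommGroup (X e s)] [∀ e s, NormedSpace ℂ (X e s)]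
  {G : Graph V E} {Z : CoordinateFamily E X} {p₀ : E → Bool → ℂ} {ρ c₁ c₂ ε τ : ℝ}
  {p : E → Bool → ℂ} {t : E → ℂ} {ξ : ∀ e s, X e s} {α : E → ℂ}
  {ψ : E → Layer}

variable (hG : G.Separated p₀ ε) (hc : Constants ρ c₁ c₂ ε)
  (hn : NearCentral G Z p₀ ρ c₁ c₂ ε τ p t ξ) (hτ : τ ≤ coordBound c₂ ε ^ 2 / 2)
include hG hc hn hτ

omit hG hτ in
theorem NearCentral.far_of_mem_disk {e : E} {s : Bool} {z : ℂ} (hz : z ∈ Z.disk p ξ e s)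
    {h : E × Bool} (hh : h ∈ G.halfEdges (G.endpt e s)) (hne : h ≠ (e, s)) :
    3 * ε / 4 < ‖z - p₀ h.1 h.2‖ := by
  by_contra! hle
  refine Set.disjoint_left.1 (hn.admissible.disjoint h.1 h.2 e s (Graph.mem_halfEdges.1 hh) hne)
    ((hn.admissible.centredChart h.1 h.2).closedBall_subset hc.c₁_pos hc.eps_le hc.eps_pos
      (hn.near h.1 h.2) le_rfl ?_) hz
  rwa [mem_closedBall, dist_eq_norm]

/-- A solution of the layer equation defines forms on the necks that extend the form outside the
disks of radius `ε / 4`. -/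
theorem NearCentral.exists_neckForm_outerForm (hψ : IsLayerSolution hG (Z.coord p ξ) t α ψ) :
    ∃ Q : E → Bool → ℂ → ℂ, (∀ e s, DifferentiableOn ℂ (Q e s) (ball 0 ρ)) ∧
      ∀ e s, ∀ z ∈ Z.disk p ξ e s, ε / 4 < ‖z - p₀ e s‖ →
        outerForm G p₀ ε α ψ (G.endpt e s) z =
          neckForm (Z.coord p ξ e s) (edgeCoeff α (e, s)) (t e) (Q e s) (Q e (!s)) z := by
  classical
  have hε := hc.eps_pos
  have hρ := hc.rho_pos
  have hm := hc.coordBound_pos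
  have hch := fun e s => hn.admissible.centredChart e s
  have hball := fun e s {r : ℝ} (hr : r ≤ 3 * ε / 4) =>
    (hch e s).closedBall_subset hc.c₁_pos hc.eps_le hε (hn.near e s) hr
  have htb := fun e => (hch e true).neck_bounds hc (hn.neck_le hτ e)
  set O := outerForm G p₀ ε α ψ with hO
  -- No form exists inside the circles yet. The candidate for the holomorphic part is the Cauchy
  -- integral of the outer form, defined only on the disk of radius `coordBound`.
  set T : E → Bool → ℂ → ℂ := fun e s => innerCoeff (Z.coord p ξ e s) (p₀ e s) ε (O (G.endpt e s))
    with hT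
  set N : E → Bool → ℂ → ℂ := fun e s =>
    neckForm (Z.coord p ξ e s) (edgeCoeff α (e, s)) (t e) 0 (T e (!s)) with hN
  have hψN : ∀ e s θ, ψ e (s, θ) = N e s (circleMap (p₀ e s) (ε / 4) θ) :=
    (isLayerSolution_iff hG hc hn hτ).1 hψ
  have hOd : ∀ v z, (∀ h ∈ G.halfEdges v, ε / 4 < ‖z - p₀ h.1 h.2‖) →
      DifferentiableAt ℂ (O v) z := fun v z hz => differentiableAt_outerForm hε hz
  have hTd : ∀ e s, DifferentiableOn ℂ (T e s) (ball 0 (coordBound c₂ ε)) := fun e s =>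
    (hch e s).differentiableOn_innerCoeff hc (hn.near e s) fun w hw =>
      (hOd _ w fun h hh => by
        have := hG.le_norm_sphere_sub (h := h) (by linarith) hw hh
        linarith).continuousAt
  have hφ : ∀ e s, ∀ z ∈ Z.disk p ξ e s, ε / 4 ≤ ‖z - p₀ e s‖ →
      coordBound c₂ ε < ‖Z.coord p ξ e s z‖ := fun e s z hz hza =>
    (hch e s).lt_norm hc.c₂_pos (hn.near e s) hz hza
  have hNd : ∀ e s, ∀ z ∈ Z.disk p ξ e s, ε / 4 ≤ ‖z - p₀ e s‖ → DifferentiableAt ℂ (N e s) z := by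
    intro e s z hz hza
    have h1 := hφ e s z hz hza
    refine (hch e s).toIsChart.differentiableAt_neckForm (differentiableOn_const 0) (hTd e (!s)) hz
      (norm_pos_iff.1 (hm.trans h1)) ((htb e).2.2.2.trans_lt (by gcongr))
  have hres : ∀ h : E × Bool, layerResidue (ε / 4) (fun θ => ψ h.1 (h.2, θ)) = edgeCoeff α h :=
    fun h => (hch h.1 h.2).layerResidue_neckForm hc (hn.near _ _) (hTd h.1 (!h.2)) hm
      (htb _).2.2.2 (hψN h.1 h.2)
  have key : ∀ e s, ∃ q, DifferentiableOn ℂ q (Z.disk p ξ e s) ∧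
      ∀ z ∈ Z.disk p ξ e s, ε / 4 < ‖z - p₀ e s‖ → q z = O (G.endpt e s) z - N e s z := by
    intro e s
    set a := p₀ e s with ha
    have hfar : ∀ z ∈ Z.disk p ξ e s, ∀ h ∈ (G.halfEdges (G.endpt e s)).erase (e, s),
        3 * ε / 4 < ‖z - p₀ h.1 h.2‖ := fun z hz h hh =>
      hn.far_of_mem_disk hc hz (Finset.mem_of_mem_erase hh) (Finset.ne_of_mem_erase hh)
    -- In the annulus, the outer form is the Cauchy integral of `N` over the circle of radius `ε /
    -- 4` plus the other layers, and `N` is that integral minus the one over the circle of radius `5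
    -- * ε / 8`. The difference is `q₁`, which is holomorphic across the inner disk.
    set q₁ : ℂ → ℂ := fun z => (∑ h ∈ (G.halfEdges (G.endpt e s)).erase (e, s),
        cauchyExt (p₀ h.1 h.2) (ε / 4) (fun θ => ψ h.1 (h.2, θ)) z) +
      cauchyExt a (5 * ε / 8) (fun θ => N e s (circleMap a (5 * ε / 8) θ)) z with hq₁
    set q : ℂ → ℂ := fun z => if ‖z - a‖ < 5 * ε / 8 then q₁ z else O (G.endpt e s) z - N e s z
      with hq
    have hqO : ∀ z ∈ Z.disk p ξ e s, ε / 4 < ‖z - a‖ → q z = O (G.endpt e s) z - N e s z := by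
      intro z hz hza
      simp only [hq]
      split_ifs with hlt
      · have h1 : O (G.endpt e s) z = _ := outerForm_eq_sum_cauchyExt (z := z) hε (fun h hh => by
          by_cases hhh : h = (e, s)
          · rw [hhh]; exact hza
          · have := hn.far_of_mem_disk hc hz hh hhh
            linarith) fun h _ => hres h
        rw [h1, ← Finset.add_sum_erase _ _ (Graph.mem_halfEdges (h := (e, s)).2 rfl),
          annulus_cauchy_ext (f := N e s) (a := a) (s₀ := ε / 4) (s₁ := 5 * ε / 8) (by positivity)
            (fun w hw hw' => hNd e s w (hball e s (r := 5 * ε / 8) (by linarith)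
              (by rwa [mem_closedBall, dist_eq_norm])) hw) hza hlt]
        simp only [hψN e s, hq₁, ← ha]
        ring
      · rfl
    refine ⟨q, fun z hz => DifferentiableAt.differentiableWithinAt ?_, hqO⟩
    rcases lt_or_ge ‖z - a‖ (5 * ε / 8) with hlt | hge
    · have hev : ∀ᶠ w in 𝓝 z, q w = q₁ w := by
        filter_upwards [(by fun_prop : ContinuousAt (fun w => ‖w - a‖) z).eventually
          (gt_mem_nhds hlt)] with w hw
        simp only [hq, if_pos hw]
      refine DifferentiableAt.congr_of_eventuallyEq ?_ hev
      refine DifferentiableAt.add (DifferentiableAt.fun_sum fun h hh => ?_) ?_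
      · refine differentiableAt_cauchyExt ((ψ h.1).continuous_side _) ?_
        rw [abs_of_pos (by positivity)]
        have := hfar z hz h hh
        linarith
      · refine differentiableAt_cauchyExt (continuous_comp_circleMap (by positivity) fun w hw =>
          (hNd e s w (hball e s (r := 5 * ε / 8) (by linarith)
            (by rw [mem_closedBall, dist_eq_norm]; exact hw.le))
            (by rw [← ha, hw]; linarith)).continuousAt) ?_
        rw [abs_of_pos (by positivity)]
        exact hlt.ne
    · have hza : ε / 4 < ‖z - a‖ := by linarith
      have hev : ∀ᶠ w in 𝓝 z, q w = O (G.endpt e s) w - N e s w := by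
        filter_upwards [(by fun_prop : ContinuousAt (fun w => ‖w - a‖) z).eventually
          (lt_mem_nhds hza), (hch e s).isOpen.mem_nhds hz] with w hw hwD
        exact hqO w hwD hw
      refine DifferentiableAt.congr_of_eventuallyEq (DifferentiableAt.sub (hOd _ z fun h hh => ?_)
        (hNd e s z hz hza.le)) hev
      by_cases hhh : h = (e, s)
      · rw [hhh]; exact hza
      · have := hn.far_of_mem_disk hc hz hh hhh
        linarith
  choose q hqd hqO using key
  choose Q hQd hQ using fun e s => (hch e s).toIsChart.exists_eq_deriv_mul_comp (hqd e s)
  have hOQ : ∀ e s, ∀ z ∈ Z.disk p ξ e s, ε / 4 < ‖z - p₀ e s‖ → O (G.endpt e s) z =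
      neckForm (Z.coord p ξ e s) (edgeCoeff α (e, s)) (t e) (Q e s) (T e (!s)) z := by
    intro e s z hz hza
    rw [neckForm_eq_add, ← hQ e s z hz, hqO e s z hz hza]
    exact (sub_add_cancel _ _).symm
  -- Applying the Cauchy formula to the neck form just obtained shows that `T` is the germ of `Q`,
  -- so `Q` at the opposite end may replace it and the two ends become consistent.
  have hTQ : ∀ e s, ∀ η ∈ ball (0:ℂ) (coordBound c₂ ε), T e s η = Q e s η := fun e s η hη =>
    (hch e s).innerCoeff_neckForm hc (hn.near e s) (hQd e s) (hTd e (!s)) hm (htb e).2.2.2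
      (fun w hw => hOQ e s w (hball e s (by linarith) (sphere_subset_closedBall hw)) (by
        rw [mem_sphere, dist_eq_norm] at hw
        linarith)) hη
  refine ⟨Q, hQd, fun e s z hz hza => ?_⟩
  have h1 := hφ e s z hz hza.le
  rw [hOQ e s z hz hza]
  unfold neckForm
  rw [hTQ e (!s) (t e / Z.coord p ξ e s z)]
  rw [mem_ball_zero_iff, norm_div, div_lt_iff₀ (hm.trans h1)]
  exact (htb e).2.2.2.trans_lt (by gcongr)

omit hG hc hn hτ in
-- The neck form is symmetric under `ζ ↦ t/ζ`, which exchanges `Q` and `Q'` and changes the sign of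
-- the residue.
theorem neckForm_neck {φ φ' Q Q' : ℂ → ℂ} {β t z z' : ℂ} (ht : t ≠ 0) (h : φ z * φ' z' = t)
    (hd : deriv φ' z' ≠ 0) : neckForm φ β t Q Q' z = neckForm φ' (-β) t Q' Q z' *
      -(deriv φ z * φ' z' / (φ z * deriv φ' z')) := by
  have h1 : φ z ≠ 0 := fun h0 => ht (by rw [← h, h0, zero_mul])
  have h2 : φ' z' ≠ 0 := fun h0 => ht (by rw [← h, h0, mul_zero])
  have h3 : t / φ z = φ' z' := by rw [← h]; field_simp
  have h4 : t / φ' z' = φ z := by rw [← h]; field_simp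
  unfold neckForm
  rw [h3, h4, ← h]
  field_simp
  ring

/-- A bounded solution of the layer equation defines a regular differential. -/
theorem NearCentral.exists_hasPeriods {k : ℕ} (hk : ∀ v, (G.edgesAt v).encard ≤ k)
    (hψ : IsLayerSolution hG (Z.coord p ξ) t α ψ) {A B : ℝ} (hA0 : 0 ≤ A) (hB0 : 0 ≤ B)
    (hA : ∀ e, ‖α e‖ ≤ A) (hB : ∀ e, ‖ψ e‖ ≤ B) (hα : ∀ v, ∑ h ∈ G.halfEdges v, edgeCoeff α h = 0) :
    ∃ f, HasPeriods G Z ρ p₀ ε p t ξ α f ∧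
      ∀ v z, (∀ h ∈ G.halfEdges v, ε / 4 < ‖z - p₀ h.1 h.2‖) → f v z = outerForm G p₀ ε α ψ v z := by
  classical
  have hε := hc.eps_pos
  have hρ := hc.rho_pos
  have hm := hc.coordBound_pos
  have hch := fun e s => hn.admissible.centredChart e s
  have htb := fun e => (hch e true).neck_bounds hc (hn.neck_le hτ e)
  obtain ⟨Q, hQ, hOQ⟩ := hn.exists_neckForm_outerForm hG hc hτ hψ
  set N : E → Bool → ℂ → ℂ := fun e s =>
    neckForm (Z.coord p ξ e s) (edgeCoeff α (e, s)) (t e) (Q e s) (Q e (!s)) with hN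
  -- Inside a disk the neck form is used, outside all of them the outer form. The disks at a vertex
  -- are disjoint, so the chosen end is the only possible one.
  set f : V → ℂ → ℂ := fun v z => if h : ∃ h : E × Bool, G.endpt h.1 h.2 = v ∧ z ∈ Z.disk p ξ h.1 h.2
    then (if z ∈ Z.core ρ p t ξ h.choose.1 h.choose.2 then 0 else N h.choose.1 h.choose.2 z)
    else outerForm G p₀ ε α ψ v z with hf
  have hfD : ∀ e s, ∀ z ∈ Z.disk p ξ e s,
      f (G.endpt e s) z = if z ∈ Z.core ρ p t ξ e s then 0 else N e s z := by
    intro e s z hz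
    have hex : ∃ h : E × Bool, G.endpt h.1 h.2 = G.endpt e s ∧ z ∈ Z.disk p ξ h.1 h.2 :=
      ⟨(e, s), rfl, hz⟩
    have hch : hex.choose = (e, s) := by
      by_contra hne
      exact Set.disjoint_left.1 (hn.admissible.disjoint _ _ _ _ hex.choose_spec.1 hne)
        hex.choose_spec.2 hz
    simp only [hf, dif_pos hex, hch]
  have hfN : ∀ e s, ∀ z ∈ Z.disk p ξ e s, z ∉ Z.core ρ p t ξ e s → f (G.endpt e s) z = N e s z :=
    fun e s z hz hzc => by rw [hfD e s z hz, if_neg hzc]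
  have hfO : ∀ v z, (∀ h ∈ G.halfEdges v, ε / 4 < ‖z - p₀ h.1 h.2‖) →
      f v z = outerForm G p₀ ε α ψ v z := by
    intro v z hz
    by_cases hex : ∃ h : E × Bool, G.endpt h.1 h.2 = v ∧ z ∈ Z.disk p ξ h.1 h.2
    · obtain ⟨⟨e, s⟩, rfl, hzD⟩ := hex
      have h1 := hz (e, s) (Graph.mem_halfEdges.2 rfl)
      rw [hfN e s z hzD fun hcore => by
        have := hn.norm_sub_lt_of_mem_core hc hτ hcore
        simp only at h1
        linarith, hOQ e s z hzD h1]
    · simp only [hf, dif_neg hex]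
  have hopen : ∀ v z, (∀ h ∈ G.halfEdges v, ε / 4 < ‖z - p₀ h.1 h.2‖) →
      ∀ᶠ w in 𝓝 z, ∀ h ∈ G.halfEdges v, ε / 4 < ‖w - p₀ h.1 h.2‖ := fun v z hz =>
    (Filter.eventually_all_finset _).2 fun h hh =>
      (by fun_prop : ContinuousAt (fun w => ‖w - p₀ h.1 h.2‖) z).eventually (lt_mem_nhds (hz h hh))
  refine ⟨f, ⟨⟨?_, ?_, ?_, ?_, ?_⟩, ?_, ?_⟩, hfO⟩
  · intro v z hz
    refine DifferentiableAt.differentiableWithinAt ?_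
    by_cases hex : ∃ h : E × Bool, G.endpt h.1 h.2 = v ∧ z ∈ Z.disk p ξ h.1 h.2
    · obtain ⟨⟨e, s⟩, rfl, hzD⟩ := hex
      simp only at hz hzD ⊢
      have hlt := lt_norm_coord_of_notMem_core hzD (hz e s rfl)
      have hpos : 0 < ‖Z.coord p ξ e s z‖ := lt_of_le_of_lt (by positivity) hlt
      have hev : ∀ᶠ w in 𝓝 z, f (G.endpt e s) w = N e s w := by
        filter_upwards [(hch e s).isOpen.mem_nhds hzD,
          ((hch e s).differentiableAt hzD).continuousAt.norm.eventually (lt_mem_nhds hlt)]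
          with w hw hw'
        exact hfN e s w hw fun hcore => not_le.2 hw' hcore.2
      refine DifferentiableAt.congr_of_eventuallyEq ?_ hev
      refine (hch e s).toIsChart.differentiableAt_neckForm (hQ e s) (hQ e (!s)) hzD
        (norm_pos_iff.1 hpos) ?_
      rw [div_lt_iff₀ hρ] at hlt
      linarith
    · have hfar : ∀ h ∈ G.halfEdges v, ε / 4 < ‖z - p₀ h.1 h.2‖ := by
        intro h hh
        by_contra! hle
        refine hex ⟨h, Graph.mem_halfEdges.1 hh, (hch h.1 h.2).closedBall_subset hc.c₁_pos hc.eps_le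
          hε (hn.near h.1 h.2) (r := ε / 4) (by linarith) ?_⟩
        rwa [mem_closedBall, dist_eq_norm]
      refine DifferentiableAt.congr_of_eventuallyEq (f := outerForm G p₀ ε α ψ v)
        (differentiableAt_outerForm hε hfar) ?_
      filter_upwards [hopen v z hfar] with w hw
      exact hfO v w hw
  · intro v
    -- The regular part decays quadratically, and compatibility of the periods cancels the residue
    -- of the polar part at infinity.
    have h1 : HolomorphicAtInfty (outerForm G p₀ ε α ψ v) :=
      (holomorphicAtInfty_regSum ψ v hε).add (holomorphicAtInfty_sum_inv _ _ _ (hα v))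
    refine h1.congr ?_
    have h2 : ∀ᶠ z in Bornology.cobounded ℂ, ∀ h ∈ G.halfEdges v, ε / 4 < ‖z - p₀ h.1 h.2‖ := by
      refine (Filter.eventually_all_finset _).2 fun h _ => ?_
      rw [cobounded_eq_cocompact]
      exact (tendsto_norm_sub_cocompact _).eventually_gt_atTop _
    filter_upwards [h2] with z hz
    exact (hfO v z hz).symm
  · intro v z hz
    unfold sphereDomain at hz
    simp only [Set.mem_ofPred_eq, not_forall, not_not] at hz
    obtain ⟨e, s, rfl, hcore⟩ := hz
    rw [hfD e s z hcore.1, if_pos hcore]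
  · intro e ht z hz z' hz' h
    have hzn := (hch e false).toIsChart.norm_lt hz
    have hzn' := (hch e true).toIsChart.norm_lt hz'
    have hn2 : ‖Z.coord p ξ e false z‖ * ‖Z.coord p ξ e true z'‖ = ‖t e‖ := by
      rw [← norm_mul, h]
    have hpos := norm_pos_iff.2 ht
    have p1 : 0 < ‖Z.coord p ξ e false z‖ := by
      by_contra! h0
      rw [le_antisymm h0 (norm_nonneg _), zero_mul] at hn2
      linarith
    have p2 : 0 < ‖Z.coord p ξ e true z'‖ := by
      by_contra! h0
      rw [le_antisymm h0 (norm_nonneg _), mul_zero] at hn2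
      linarith
    -- Since both coordinates are less than `ρ` and their product has modulus `‖t e‖`, neither point
    -- of an identified pair lies in a removed part.
    have h1 := hfN e false z hz fun hcore => by
      have := hcore.2
      rw [le_div_iff₀ hρ] at this
      nlinarith
    have h2 := hfN e true z' hz' fun hcore => by
      have := hcore.2
      rw [le_div_iff₀ hρ] at this
      nlinarith
    change f (G.endpt e false) z = f (G.endpt e true) z' * _
    rw [h1, h2]
    have h3 : edgeCoeff α (e, true) = -edgeCoeff α (e, false) := edgeCoeff_not α e false
    simp only [hN, h3, Bool.not_true, Bool.not_false]
    exact neckForm_neck ht h ((hch e true).toIsChart.deriv_ne_zero hz')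
  · intro e ht
    choose A hA hA' using fun s => (hch e s).exists_simple_pole (hQ e s) (edgeCoeff α (e, s))
    have key : ∀ s, ∀ᶠ z in 𝓝[≠] (p e s), f (G.endpt e s) z =
        edgeCoeff α (e, s) / (z - p e s) + A s z := by
      intro s
      filter_upwards [hA' s, self_mem_nhdsWithin,
        nhdsWithin_le_nhds ((hch e s).isOpen.mem_nhds (hch e s).center_mem)] with z h1 hne hz
      rw [← h1, hfN e s z hz]
      · simp [hN, neckForm, ht]
      · intro hcore
        have h2 := hcore.2
        rw [ht, norm_zero, zero_div, norm_le_zero_iff] at h2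
        exact hne ((hch e s).eq_center hz h2)
    refine ⟨edgeCoeff α (e, true), A false, A true, hA false, hA true, ?_, key true⟩
    have h3 : edgeCoeff α (e, false) = -edgeCoeff α (e, true) := edgeCoeff_not α e true
    have h4 := key false
    rw [h3] at h4
    exact h4
  -- At most `2 * k` ends meet at a vertex, and the factor `2 / ε` bounds the poles at distance at
  -- least `ε / 2`.
  · refine ⟨2 * (k * B) + 2 / ε * (2 * (k * A)), fun v z hz => ?_⟩
    have hz' : ∀ h ∈ G.halfEdges v, ε < ‖z - p₀ h.1 h.2‖ := fun h hh =>
      hz h.1 h.2 (Graph.mem_halfEdges.1 hh)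
    rw [hfO v z fun h hh => by linarith [hz' h hh]]
    refine (norm_add_le _ _).trans (add_le_add ?_ ?_)
    · refine (norm_regSum_le ψ hε fun h hh => by linarith [hz' h hh]).trans ?_
      refine (G.sum_halfEdges_le v (u := fun e => ‖ψ e‖) fun _ => norm_nonneg _).trans ?_
      gcongr
      exact G.finsum_edgesAt_le hk v hB0 fun e _ => hB e
    · refine (norm_polSum_le α hε fun h hh => by linarith [hz' h hh]).trans ?_
      gcongr
      refine (G.sum_halfEdges_le v (u := fun e => ‖α e‖) fun _ => norm_nonneg _).trans ?_
      gcongr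
      exact G.finsum_edgesAt_le hk v hA0 fun e _ => hA e
  · intro e
    have hpp := hn.near e true
    have hsub : closedBall (p e true) (ε / 2) ⊆ Z.disk p ξ e true :=
      (closedBall_subset_ball (by linarith [hc.eps_le])).trans
        ((hch e true).ball_subset hc.c₁_pos)
    have hcore : Z.core ρ p t ξ e true ⊆ ball (p e true) (ε / 2) := fun w hw => by
      have h1 := hn.norm_sub_lt_of_mem_core hc hτ hw
      have h2 := norm_sub_le (w - p₀ e true) (p e true - p₀ e true)
      rw [sub_sub_sub_cancel_right] at h2
      rw [mem_ball, dist_eq_norm]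
      linarith
    refine ⟨ε / 2, by positivity, hsub, hcore, ?_⟩
    have h1 : (∮ z in C(p e true, ε / 2), f (G.tgt e) z) = ∮ z in C(p e true, ε / 2), N e true z := by
      refine circleIntegral.integral_congr (by positivity) fun w hw => ?_
      refine hfN e true w (hsub (sphere_subset_closedBall hw)) fun hw' => ?_
      have := hcore hw'
      rw [mem_sphere] at hw
      rw [mem_ball, hw] at this
      exact lt_irrefl _ this
    have h2 := (hch e true).toIsChart.circleIntegral_neckForm_residue (β := edgeCoeff α (e, true))
      (hQ e true) (hQ e false) hρ (r := ε / 2) (a := p e true) (z := p e true) (t := t e)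
      (by positivity) hsub (mem_ball_self (by positivity)) (hch e true).center hm
      (fun w hw => (hch e true).lt_norm hc.c₂_pos hpp (hsub (sphere_subset_closedBall hw)) (by
        rw [mem_sphere, dist_eq_norm] at hw
        have h2 := norm_sub_le (w - p₀ e true) (p e true - p₀ e true)
        rw [sub_sub_sub_cancel_right, hw] at h2
        linarith)) (htb e).2.2.1
    refine h1.trans (h2.trans ?_)
    unfold edgeCoeff
    simp only [if_true]
    rw [mul_inv_cancel_left₀ two_pi_I_ne_zero']

end Construction

/-! ### Compatible periods -/

section Periods

variable {V E : Type*} (G : Graph V E)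

theorem Graph.sum_edgeCoeff_eq_zero (α : G.compatible) (v : V) :
    ∑ h ∈ G.halfEdges v, edgeCoeff (fun e => α.1 e) h = 0 := by
  classical
  have h1 : ∀ s, ({e | G.endpt e s = v} : Set E).Finite := fun s => (G.finite_edges v).subset
    fun e he => by cases s; exacts [Or.inl he, Or.inr he]
  have h2 : ∀ s, ∑ᶠ e ∈ {e | G.endpt e s = v}, α.1 e =
      ∑ h ∈ G.halfEdges v with h.2 = s, α.1 h.1 := fun s => by
    rw [finsum_mem_eq_finite_toFinset_sum _ (h1 s)]
    refine Finset.sum_nbij' (fun e => (e, s)) Prod.fst ?_ ?_ ?_ ?_ ?_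
    · intro e he
      simpa using he
    · rintro ⟨e, s'⟩ he
      simp only [Finset.mem_filter, Graph.mem_halfEdges] at he
      simpa [← he.2] using he.1
    · simp
    · rintro ⟨e, s'⟩ he
      simp only [Finset.mem_filter] at he
      simp [← he.2]
    · simp
  have h3 : ∑ᶠ e ∈ {e | G.endpt e false = v}, α.1 e = ∑ᶠ e ∈ {e | G.endpt e true = v}, α.1 e :=
    α.2 v
  rw [h2, h2] at h3
  unfold edgeCoeff
  rw [← Finset.mul_sum, ← Finset.sum_filter_add_sum_filter_not _ (fun h : E × Bool => h.2 = true)]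
  have e1 : ∑ h ∈ G.halfEdges v with h.2 = true, (if h.2 then α.1 h.1 else -α.1 h.1) =
      ∑ h ∈ G.halfEdges v with h.2 = true, α.1 h.1 :=
    Finset.sum_congr rfl fun h hh => if_pos (Finset.mem_filter.1 hh).2
  have e2 : ∑ h ∈ G.halfEdges v with ¬h.2 = true, (if h.2 then α.1 h.1 else -α.1 h.1) =
      -∑ h ∈ G.halfEdges v with h.2 = false, α.1 h.1 := by
    rw [← Finset.sum_neg_distrib]
    refine Finset.sum_congr (by simp) fun h hh => if_neg ?_
    simp [(Finset.mem_filter.1 hh).2]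
  rw [e1, e2, ← h3, add_neg_cancel, mul_zero]

/-- The admissible periods as bounded families. -/
def Graph.periodFam : G.compatible →L[ℂ] (boundedNorm E).Fam (fun _ => ℂ) :=
  (LinearMap.mkContinuous
    { toFun := fun α => (boundedNorm E).famMk (fun e => α.1 e)
        (boundedNorm_mem (C := ‖α‖) fun e => lp.norm_apply_le_norm ENNReal.top_ne_zero α.1 e)
      map_add' := fun _ _ => rfl
      map_smul' := fun _ _ => rfl } 1 fun α => by
    rw [one_mul]
    exact boundedNorm_norm_le (norm_nonneg _) fun e =>
      lp.norm_apply_le_norm ENNReal.top_ne_zero α.1 e)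

end Periods

theorem exists_supNorm_fam_single {ι : Type*} {w : ι → ℝ} (hw : ∀ i, 0 < w i) {Y : ι → Type*}
    [∀ i, NormedAddCommGroup (Y i)] [∀ i, NormedSpace ℂ (Y i)] (y : ∀ i, Y i) {i₀ : ι}
    (h0 : ∀ i, i ≠ i₀ → y i = 0) {c : ℝ} (hc : 0 ≤ c) (h : ‖y i₀‖ ≤ c * w i₀) :
    ∃ y' : (supNorm w hw).Fam Y, (∀ i, y' i = y i) ∧ ‖y'‖ ≤ c := by
  have h1 : ∀ i, ‖y i‖ ≤ c * w i := fun i => by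
    by_cases hi : i = i₀
    · rw [hi]; exact h
    · rw [h0 i hi, norm_zero]
      exact mul_nonneg hc (hw i).le
  exact ⟨(supNorm w hw).famMk y (supNorm_fam_mem hw h1), fun _ => rfl,
    supNorm_fam_norm_le hw hc h1⟩

/-! ### Existence, uniqueness, smoothness and decay -/

section Main

variable {V E : Type*} {X : E → Bool → Type*}
  [∀ e s, NormedAddCommGroup (X e s)] [∀ e s, NormedSpace ℂ (X e s)]
  {G : Graph V E} {Z : CoordinateFamily E X} {p₀ : E → Bool → ℂ}
  {ξ₀ : ∀ e s, X e s} {ρ c₁ c₂ η ε τ : ℝ}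

/-- A bounded solution of the layer equation describes the unique regular differential. -/
theorem NearCentral.existsUnique_hasPeriods (hG : G.Separated p₀ ε) (hc : Constants ρ c₁ c₂ ε)
    {p : E → Bool → ℂ} {t : E → ℂ} {ξ : ∀ e s, X e s}
    (hn : NearCentral G Z p₀ ρ c₁ c₂ ε τ p t ξ) (hτ : τ ≤ coordBound c₂ ε ^ 2 / 2) (hτ0 : 0 ≤ τ)
    {k : ℕ} (hk : ∀ v, (G.edgesAt v).encard ≤ k) {K : ℝ}
    (hK : G.Incidence (boundedNorm E) (boundedNorm V) K)
    (hhalf : kernelConst ρ c₂ ε * τ ≤ 1 / 2) (hq : kernelConst ρ c₂ ε * τ * ‖traceRegFam hG hK‖ < 1)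
    (α : G.compatible) {ψ : E → Layer} (hψ : IsLayerSolution hG (Z.coord p ξ) t (fun e => α.1 e) ψ)
    {B : ℝ} (hB0 : 0 ≤ B) (hB : ∀ e, ‖ψ e‖ ≤ B) :
    (∃! f, HasPeriods G Z ρ p₀ ε p t ξ (fun e => α.1 e) f) ∧
      ∀ f, HasPeriods G Z ρ p₀ ε p t ξ (fun e => α.1 e) f → ∀ v z,
        (∀ h ∈ G.halfEdges v, ε / 4 < ‖z - p₀ h.1 h.2‖) →
          f v z = outerForm G p₀ ε (fun e => α.1 e) ψ v z := by
  have hA : ∀ e, ‖α.1 e‖ ≤ ‖α‖ := fun e => lp.norm_apply_le_norm ENNReal.top_ne_zero α.1 e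
  have key : ∀ f, HasPeriods G Z ρ p₀ ε p t ξ (fun e => α.1 e) f → ∀ v z,
      (∀ h ∈ G.halfEdges v, ε / 4 < ‖z - p₀ h.1 h.2‖) →
        f v z = outerForm G p₀ ε (fun e => α.1 e) ψ v z := by
    intro f hf
    obtain ⟨ψ', hψ', hcauchy, hout⟩ := hn.exists_layers hG hc hτ hf
    obtain ⟨M, hM⟩ := hf.bounded
    have hle := hn.norm_layer_le hG hc hτ hf.regular hψ' hcauchy hout hA (abs_nonneg M)
      (fun v z hz => (hM v z hz).trans (le_abs_self M)) hhalf
    -- The layers of an arbitrary bounded differential are bounded by the a priori estimate, so they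
    -- coincide with the given bounded solution.
    rw [IsLayerSolution.eq_of_bounded hc hn hτ hτ0 hK hq (fun e => (hB e).trans (le_max_left _ _))
      (fun e => (hle e).trans (le_max_right _ _)) hψ hψ']
    exact hout
  obtain ⟨f, hf, -⟩ := hn.exists_hasPeriods hG hc hτ hk hψ (norm_nonneg α) hB0 hA hB
    (G.sum_edgeCoeff_eq_zero α)
  refine ⟨⟨f, hf, fun f' hf' => ?_⟩, key⟩
  exact hn.eq_of_eq_outside hG hc hτ hf' hf fun v z hz => by rw [key f hf v z hz, key f' hf' v z hz]

theorem exists_small_neck (hc : Constants ρ c₁ c₂ ε) {a b : ℝ} (ha : 0 ≤ a) (hb : 0 ≤ b) :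
    ∃ τ > 0, τ ≤ coordBound c₂ ε ^ 2 / 2 ∧ kernelConst ρ c₂ ε * τ ≤ 1 / 2 ∧
      kernelConst ρ c₂ ε * τ * a < 1 ∧ kernelConst ρ c₂ ε * τ * b < 1 := by
  have hm := hc.coordBound_pos
  have hκ := hc.kernelConst_pos
  set κ := kernelConst ρ c₂ ε
  -- A single condition `κ * τ * (1 + a + b) ≤ 1 / 2` contains the last three requirements.
  have h0 : κ * min (coordBound c₂ ε ^ 2 / 2) (1 / (2 * κ * (1 + a + b))) * (1 + a + b) ≤ 1 / 2 := by
    calc _ ≤ κ * (1 / (2 * κ * (1 + a + b))) * (1 + a + b) := by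
          gcongr
          exact min_le_right _ _
      _ = 1 / 2 := by field_simp
  have hpos : 0 < min (coordBound c₂ ε ^ 2 / 2) (1 / (2 * κ * (1 + a + b))) := by positivity
  set τ := min (coordBound c₂ ε ^ 2 / 2) (1 / (2 * κ * (1 + a + b)))
  have h1 : 0 ≤ κ * τ * a := by positivity
  have h2 : 0 ≤ κ * τ * b := by positivity
  have h3 : 0 < κ * τ := by positivity
  exact ⟨τ, hpos, min_le_left _ _, by nlinarith, by nlinarith, by nlinarith⟩

/-- Existence, uniqueness and smooth dependence on the parameters. -/
theorem UniformCoordinates.exists_smooth_difference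
    (hU : UniformCoordinates G Z p₀ ξ₀ ρ c₁ c₂ η ε) {k : ℕ} (hk : ∀ v, (G.edgesAt v).encard ≤ k)
    {N : MonotoneNorm E} {NV : MonotoneNorm V} {C : ℝ}
    (hC : N.BoundedBy C) (hC0 : 0 ≤ C) [CompleteSpace (N.Fam fun _ => ℂ)] {K : ℝ}
    (hK : G.Incidence N NV K) :
    ∃ τ > 0, ∀ t₀ : lp (fun _ : E => ℂ) (⊤ : ENNReal), ‖t₀‖ < τ → ∃ δ > 0,
      (∀ (dp : PointSpace N) (dt : NeckSpace N) (dξ : CoordSpace N X) (α : G.compatible),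
        ‖dp‖ < δ → ‖dt‖ < δ → ‖dξ‖ < δ → ∃! ω : V → ℂ → ℂ, HasPeriods G Z ρ p₀ ε
          (fun e s => p₀ e s + dp e s) (fun e => t₀ e + dt e) (fun e s => ξ₀ e s + dξ e s)
          (fun e => α.1 e) ω) ∧
      ∃ Φ : PointSpace N × NeckSpace N × CoordSpace N X × G.compatible → HolForms G NV p₀ ε,
        ContDiffOn ℂ ((⊤ : ℕ∞) : WithTop ℕ∞) Φ {x | ‖x.1‖ < δ ∧ ‖x.2.1‖ < δ ∧ ‖x.2.2.1‖ < δ} ∧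
        ∀ (dp : PointSpace N) (dt : NeckSpace N) (dξ : CoordSpace N X) (α : G.compatible),
          ‖dp‖ < δ → ‖dt‖ < δ → ‖dξ‖ < δ → ∀ ω ω₀ : V → ℂ → ℂ,
            HasPeriods G Z ρ p₀ ε (fun e s => p₀ e s + dp e s) (fun e => t₀ e + dt e)
              (fun e s => ξ₀ e s + dξ e s) (fun e => α.1 e) ω →
            HasPeriods G Z ρ p₀ ε p₀ (fun e => t₀ e) ξ₀ (fun e => α.1 e) ω₀ →
            ∀ (v : V) (z : Omega G p₀ ε v), (Φ (dp, dt, dξ, α) v).1 z = ω v z - ω₀ v z := by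
  have hε := hU.eps_pos
  -- The supremum norm is used alongside `N`: the central solution and the uniqueness argument
  -- concern layers that are only bounded.
  have hK' : G.Incidence (boundedNorm E) (boundedNorm V) ((k + 2) * 1) :=
    G.supNorm_incidence hk _ _ zero_le_one (fun _ _ => by simp) (fun _ _ => by simp)
  obtain ⟨τ, hτ0, hτ, hhalf, hq, hq'⟩ := exists_small_neck hU.toConstants
    (norm_nonneg (traceRegFam hU.separated hK)) (norm_nonneg (traceRegFam hU.separated hK'))
  refine ⟨τ / 2, by positivity, fun t₀ ht₀ => ?_⟩
  have ht₀' : ∀ e, ‖t₀ e‖ ≤ τ / 2 := fun e =>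
    (lp.norm_apply_le_norm ENNReal.top_ne_zero t₀ e).trans ht₀.le
  obtain ⟨δ, hδ, Ψ, D, hD, hΨ, hΨD⟩ :=
    hU.exists_smooth_layers hC hC0 hK hK' hτ0 hτ hq hq' ht₀'
  have hn₀ : NearCentral G Z p₀ ρ c₁ c₂ ε τ p₀ (fun e => t₀ e) ξ₀ :=
    ⟨hU.admissible p₀ ξ₀ (fun e s => by simpa using hU.eta_pos)
      (fun e s => by simpa using hU.eta_pos), fun e s => by
        rw [sub_self, norm_zero]; positivity, fun e => (ht₀' e).trans (by linarith)⟩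
  have main := fun (dp : PointSpace N) (dt : NeckSpace N) (dξ : CoordSpace N X) (α : G.compatible)
      (h1 : ‖dp‖ < δ) (h2 : ‖dt‖ < δ) (h3 : ‖dξ‖ < δ) =>
    (hΨD dp dt dξ h1 h2 h3).1.existsUnique_hasPeriods hU.separated hU.toConstants hτ hτ0.le hk hK'
      hhalf hq' α ((hΨD dp dt dξ h1 h2 h3).2 (G.periodFam α))
      (B := ‖Ψ (G.periodFam α)‖ + C * ‖D ((dp, dt, dξ), G.periodFam α)‖) (by positivity)
      fun e => (norm_add_le _ _).trans
        (add_le_add (boundedNorm_apply_le _ e) (hC.norm_apply_le _ e))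
  have main₀ := fun α : G.compatible =>
    hn₀.existsUnique_hasPeriods hU.separated hU.toConstants hτ hτ0.le hk hK' hhalf hq' α
      (hΨ (G.periodFam α)) (norm_nonneg _) (boundedNorm_apply_le (Ψ (G.periodFam α)))
  -- The polar sums depend on `α` and the fixed central points only, so they cancel in the
  -- difference, which is the regular sum of `D`.
  refine ⟨δ, hδ, fun dp dt dξ α h1 h2 h3 => (main dp dt dξ α h1 h2 h3).1,
    fun x => formRegFam hε hK (D ((x.1, x.2.1, x.2.2.1), G.periodFam x.2.2.2)), ?_, ?_⟩
  · refine (formRegFam hε hK).contDiff.comp_contDiffOn (hD.comp (ContDiff.contDiffOn ?_) ?_)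
    · have := G.periodFam.contDiff (n := ((⊤ : ℕ∞) : WithTop ℕ∞))
      exact (contDiff_fst.prodMk ((contDiff_fst.comp contDiff_snd).prodMk
        (contDiff_fst.comp (contDiff_snd.comp contDiff_snd)))).prodMk
          (this.comp (contDiff_snd.comp (contDiff_snd.comp contDiff_snd)))
    · exact fun x hx => ⟨hx, mem_univ _⟩
  · intro dp dt dξ α h1 h2 h3 ω ω₀ hω hω₀ v z
    have hz : ∀ h ∈ G.halfEdges v, ε / 4 < ‖(z : ℂ) - p₀ h.1 h.2‖ := fun h hh => by
      have := lt_norm_of_mem_Omega z hh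
      linarith
    rw [(main dp dt dξ α h1 h2 h3).2 ω hω v z hz, (main₀ α).2 ω₀ hω₀ v z hz]
    have h4 := regSum_add (ψ := fun e => Ψ (G.periodFam α) e)
      (ψ' := fun e => D ((dp, dt, dξ), G.periodFam α) e) hε hz
    have h5 : outerForm G p₀ ε (fun e => α.1 e) (fun e => Ψ (G.periodFam α) e +
        D ((dp, dt, dξ), G.periodFam α) e) v z = regSum G p₀ ε (fun e => Ψ (G.periodFam α) e) v z +
          regSum G p₀ ε (fun e => D ((dp, dt, dξ), G.periodFam α) e) v z +
          polSum G p₀ (fun e => α.1 e) v z := by rw [← h4]; rfl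
    rw [h5, outerForm]
    change regSum G p₀ ε (fun e => D ((dp, dt, dξ), G.periodFam α) e) v z = _
    ring

theorem Graph.dist_src_tgt (G : Graph V E) (e : E) (v : V) :
    G.dist (G.src e) v ≤ G.dist (G.tgt e) v + 1 ∧ G.dist (G.tgt e) v ≤ G.dist (G.src e) v + 1 := by
  set S := SimpleGraph.fromRel (fun v w => ∃ e, G.src e = v ∧ G.tgt e = w) with hS
  have h1 : S.dist (G.src e) (G.tgt e) ≤ 1 := by
    by_cases h : G.src e = G.tgt e
    · rw [h, SimpleGraph.dist_self]
      exact zero_le_one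
    · have hadj : S.Adj (G.src e) (G.tgt e) := ⟨h, Or.inl ⟨e, rfl, rfl⟩⟩
      exact (SimpleGraph.dist_eq_one_iff_adj.2 hadj).le
  have h2 := G.connected.dist_triangle (u := G.src e) (v := G.tgt e) (w := v)
  have h3 := G.connected.dist_triangle (u := G.tgt e) (v := G.src e) (w := v)
  unfold Graph.dist
  simp only [← hS] at h2 h3 ⊢
  rw [SimpleGraph.dist_comm (u := G.tgt e) (v := G.src e)] at h3
  omega

theorem zpow_neg_le_mul {r : ℝ} (hr : 1 < r) {m n : ℕ} (h : n ≤ m + 1) :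
    r ^ (-(m : ℤ)) ≤ r * r ^ (-(n : ℤ)) := by
  rw [← zpow_one_add₀ (by positivity)]
  exact zpow_le_zpow_right₀ hr.le (by omega)

/-- The influence of the parameters at one edge decays exponentially. -/
theorem UniformCoordinates.exists_decay
    (hU : UniformCoordinates G Z p₀ ξ₀ ρ c₁ c₂ η ε) {k : ℕ} (hk : ∀ v, (G.edgesAt v).encard ≤ k)
    {r : ℝ} (v₀ : V) (hr : 1 < r) :
    ∃ τ > 0, ∀ t₀ : lp (fun _ : E => ℂ) (⊤ : ENNReal), ‖t₀‖ < τ → ∀ e : E, ∃ δ > 0,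
      ∀ (p : E → Bool → ℂ) (t : E → ℂ) (ξ : ∀ e s, X e s) (α : G.compatible),
        (∀ e', e' ≠ e → p e' = p₀ e' ∧ t e' = t₀ e' ∧ ξ e' = ξ₀ e') →
        (∀ s, ‖p e s - p₀ e s‖ < δ) → ‖t e - t₀ e‖ < δ → (∀ s, ‖ξ e s - ξ₀ e s‖ < δ) →
        (∃! ω : V → ℂ → ℂ, HasPeriods G Z ρ p₀ ε p t ξ (fun e => α.1 e) ω) ∧
        ∀ ω ω₀ : V → ℂ → ℂ, HasPeriods G Z ρ p₀ ε p t ξ (fun e => α.1 e) ω →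
          HasPeriods G Z ρ p₀ ε p₀ (fun e => t₀ e) ξ₀ (fun e => α.1 e) ω₀ →
          ∃ C : ℝ, ∀ v, ∀ z ∈ Omega G p₀ ε v,
            ‖ω v z - ω₀ v z‖ ≤ C * r ^ (-(G.dist v v₀ : ℤ)) := by
  have hr0 : 0 < r := by linarith
  set w' : V → ℝ := fun v => r ^ (-(G.dist v v₀ : ℤ)) with hw'
  have hw'0 : ∀ v, 0 < w' v := fun v => zpow_pos hr0 _
  -- The source is an arbitrary choice: the weights at the two ends of an edge differ by a factor at
  -- most `r`. All weights are at most `1`, so the weighted space embeds in the bounded families.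
  set w : E → ℝ := fun e => w' (G.src e) with hw
  have hw0 : ∀ e, 0 < w e := fun e => hw'0 _
  have hcomp : ∀ e s, w e ≤ r * w' (G.endpt e s) ∧ w' (G.endpt e s) ≤ r * w e := by
    intro e s
    have h := G.dist_src_tgt e v₀
    cases s
    · exact ⟨zpow_neg_le_mul hr (Nat.le_succ _), zpow_neg_le_mul hr (Nat.le_succ _)⟩
    · exact ⟨zpow_neg_le_mul hr h.2, zpow_neg_le_mul hr h.1⟩
  have hK := G.supNorm_incidence hk hw0 hw'0 hr0.le (fun e s => (hcomp e s).1)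
    fun e s => (hcomp e s).2
  have hC : (supNorm w hw0).BoundedBy 1 := supNorm_boundedBy hw0 fun e =>
    zpow_le_one_of_nonpos₀ hr.le (by omega)
  have := supNorm_completeSpace hw0 (Y := fun _ => ℂ)
  obtain ⟨τ, hτ, hmain⟩ := hU.exists_smooth_difference hk hC zero_le_one hK
  refine ⟨τ, hτ, fun t₀ ht₀ e => ?_⟩
  obtain ⟨δ, hδ, hex, Φ, -, hΦ⟩ := hmain t₀ ht₀
  -- A perturbation supported at `e` has weighted norm equal to its size divided by `w e`. Thus the
  -- admissible size depends on the distance from `e` to `v₀`, whereas the bound on `t₀` does not.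
  refine ⟨δ / 2 * w e, mul_pos (by positivity) (hw0 e), fun p t ξ α hne hp ht hξ => ?_⟩
  have hδ' : (0:ℝ) ≤ δ / 2 := by positivity
  obtain ⟨dp, hdp, hdp'⟩ := exists_supNorm_fam_single hw0 (fun e s => p e s - p₀ e s) (i₀ := e)
    (fun e' h => by funext s; simp [(hne e' h).1]) hδ'
    ((pi_norm_le_iff_of_nonneg (mul_nonneg hδ' (hw0 e).le)).2 fun s => (hp s).le)
  obtain ⟨dt, hdt, hdt'⟩ := exists_supNorm_fam_single hw0 (fun e => t e - t₀ e) (i₀ := e)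
    (fun e' h => by simp [(hne e' h).2.1]) hδ' ht.le
  obtain ⟨dξ, hdξ, hdξ'⟩ := exists_supNorm_fam_single hw0 (fun e s => ξ e s - ξ₀ e s) (i₀ := e)
    (fun e' h => by funext s; simp [(hne e' h).2.2]) hδ'
    ((pi_norm_le_iff_of_nonneg (mul_nonneg hδ' (hw0 e).le)).2 fun s => (hξ s).le)
  have ep : (fun e s => p₀ e s + dp e s) = p := by
    funext e s
    rw [hdp]
    exact add_sub_cancel _ _
  have et : (fun e => t₀ e + dt e) = t := by
    funext e
    rw [hdt]
    exact add_sub_cancel _ _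
  have eξ : (fun e s => ξ₀ e s + dξ e s) = ξ := by
    funext e s
    rw [hdξ]
    exact add_sub_cancel _ _
  have hlt : δ / 2 < δ := half_lt_self hδ
  have h1 := hex dp dt dξ α (hdp'.trans_lt hlt) (hdt'.trans_lt hlt) (hdξ'.trans_lt hlt)
  have h2 := hΦ dp dt dξ α (hdp'.trans_lt hlt) (hdt'.trans_lt hlt) (hdξ'.trans_lt hlt)
  rw [ep, et, eξ] at h1 h2
  -- The weighted norm of the difference is the constant in the decay estimate.
  refine ⟨h1, fun ω ω₀ hω hω₀ => ⟨‖Φ (dp, dt, dξ, α)‖, fun v z hz => ?_⟩⟩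
  rw [← h2 ω ω₀ hω hω₀ v ⟨z, hz⟩]
  exact ((Φ (dp, dt, dξ, α) v).1.norm_coe_le_norm _).trans
    (supNorm_fam_apply_le hw'0 (Φ (dp, dt, dξ, α)) v)

end Main

end Traizet

end

theorem theorem5 {V E : Type*} {X : E → Bool → Type*}
    [∀ e s, NormedAddCommGroup (X e s)] [∀ e s, NormedSpace ℂ (X e s)]
    [∀ e s, FiniteDimensional ℂ (X e s)]
    (d : ℕ) (hd : ∀ e s, Module.finrank ℂ (X e s) ≤ d)
    (G : Traizet.Graph V E) (k : ℕ) (hk : ∀ v, (G.edgesAt v).encard ≤ k)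
    (Z : Traizet.CoordinateFamily E X)
    (p₀ : E → Bool → ℂ) (ξ₀ : ∀ e s, X e s)
    (ρ c₁ c₂ η : ℝ) (hρ : 0 < ρ) (hc₁ : 0 < c₁) (hc₂ : 0 < c₂) (hη : 0 < η)
    (hZ : ∀ (p : E → Bool → ℂ) (ξ : ∀ e s, X e s),
      (∀ e s, ‖p e s - p₀ e s‖ < η) → (∀ e s, ‖ξ e s - ξ₀ e s‖ < η) →
        Traizet.AdmissibleCoordinates G Z ρ c₁ c₂ p ξ)
    (ε : ℝ) (hε : 0 < ε) (hε' : ε ≤ ρ * c₁)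
    (NE : Traizet.MonotoneNorm E) (NV : Traizet.MonotoneNorm V)
    (hN : G.AdmissibleNorms NE NV)
    (hemb : ∃ C : ℝ, ∀ α ∈ NE.space, ∀ e, ‖α e‖ ≤ C * NE.norm α) :
    (∃ τ > 0, ∀ t₀ : lp (fun _ : E => ℂ) (⊤ : ENNReal), ‖t₀‖ < τ → ∃ δ > 0,
      (∀ (dp : Traizet.PointSpace NE) (dt : Traizet.NeckSpace NE) (dξ : Traizet.CoordSpace NE X)
          (α : G.compatible), ‖dp‖ < δ → ‖dt‖ < δ → ‖dξ‖ < δ →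
        ∃! ω : V → ℂ → ℂ, Traizet.HasPeriods G Z ρ p₀ ε
          (fun e s => p₀ e s + dp e s) (fun e => t₀ e + dt e) (fun e s => ξ₀ e s + dξ e s)
          (fun e => α.1 e) ω) ∧
      ∃ Φ : Traizet.PointSpace NE × Traizet.NeckSpace NE × Traizet.CoordSpace NE X × G.compatible →
          Traizet.HolForms G NV p₀ ε,
        ContDiffOn ℂ ((⊤ : ℕ∞) : WithTop ℕ∞) Φ {x | ‖x.1‖ < δ ∧ ‖x.2.1‖ < δ ∧ ‖x.2.2.1‖ < δ} ∧
        ∀ (dp : Traizet.PointSpace NE) (dt : Traizet.NeckSpace NE) (dξ : Traizet.CoordSpace NE X)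
          (α : G.compatible), ‖dp‖ < δ → ‖dt‖ < δ → ‖dξ‖ < δ →
          ∀ ω ω₀ : V → ℂ → ℂ,
            Traizet.HasPeriods G Z ρ p₀ ε
              (fun e s => p₀ e s + dp e s) (fun e => t₀ e + dt e) (fun e s => ξ₀ e s + dξ e s)
              (fun e => α.1 e) ω →
            Traizet.HasPeriods G Z ρ p₀ ε p₀ (fun e => t₀ e) ξ₀ (fun e => α.1 e) ω₀ →
            ∀ (v : V) (z : Traizet.Omega G p₀ ε v),
              (Φ (dp, dt, dξ, α) v).1 z = ω v z - ω₀ v z) ∧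
    (∀ (r : ℝ) (v₀ : V), 1 < r → ∃ τ > 0,
      ∀ t₀ : lp (fun _ : E => ℂ) (⊤ : ENNReal), ‖t₀‖ < τ → ∀ e : E, ∃ δ > 0,
        ∀ (p : E → Bool → ℂ) (t : E → ℂ) (ξ : ∀ e s, X e s) (α : G.compatible),
          (∀ e', e' ≠ e → p e' = p₀ e' ∧ t e' = t₀ e' ∧ ξ e' = ξ₀ e') →
          (∀ s, ‖p e s - p₀ e s‖ < δ) → ‖t e - t₀ e‖ < δ → (∀ s, ‖ξ e s - ξ₀ e s‖ < δ) →
          (∃! ω : V → ℂ → ℂ, Traizet.HasPeriods G Z ρ p₀ ε p t ξ (fun e => α.1 e) ω) ∧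
          ∀ ω ω₀ : V → ℂ → ℂ,
            Traizet.HasPeriods G Z ρ p₀ ε p t ξ (fun e => α.1 e) ω →
            Traizet.HasPeriods G Z ρ p₀ ε p₀ (fun e => t₀ e) ξ₀ (fun e => α.1 e) ω₀ →
            ∃ C : ℝ, ∀ v, ∀ z ∈ Traizet.Omega G p₀ ε v,
              ‖ω v z - ω₀ v z‖ ≤ C * r ^ (-(G.dist v v₀ : ℤ))) := by
  
  have hU : Traizet.UniformCoordinates G Z p₀ ξ₀ ρ c₁ c₂ η ε := ⟨⟨hρ, hc₁, hc₂, hε, hε'⟩, hη, hZ⟩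
  obtain ⟨C, hC⟩ := hemb
  have hC' : NE.BoundedBy (max C 0) := fun u hu e => (hC u hu e).trans
    (mul_le_mul_of_nonneg_right (le_max_left _ _) (NE.norm_nonneg hu))
  have := hN.complete_edges
  obtain ⟨K, hK⟩ := hN.exists_incidence
  exact ⟨hU.exists_smooth_difference hk hC' (le_max_right _ _) hK,
    fun r v₀ hr => hU.exists_decay hk v₀ hr⟩
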